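/- Let $d,m\in\mathbb N$, $T>0$, and let $\mathcal U\subset\mathbb R^{dm}$ be nonempty, compact and convex. Admissible controls are the measurable $u=(u_1,\dots,u_m):[0,T]\to\mathbb R^{dm}$ with $u(t)\in\mathcal U$ for a.e. $t$, i.e. $u\in L^\infty([0,T],\mathcal U)$. Write $\mathcal P_1(\mathbb R^d)$ for the probability measures with finite first moment and $\mathcal W_1$ for the $1$-Wasserstein distance. Assume: (H) $H,G^1,\dots,G^d:\mathbb R^d\to\mathbb R^d$ are bounded, locally Lipschitz and of sublinear growth, $|H(\xi)|\le C_H(1+|\xi|)$, $|G^\ell(\xi)|\le C_{G^\ell}(1+|\xi|)$. (L) $\mathcal L:\mathbb R^{dm}\times\mathcal P_1(\mathbb R^d)\to[0,\infty)$ satisfies, for every $R>0$: the restriction of $\mathcal L$ to $\mathbb R^{dm}\times\{\mu\in\mathcal P_1(\mathbb R^d):\operatorname{supp}\mu\subset \overline{B(0,R)}\}$ is continuous for the distance $\frac1m\sum_k|Y_k-Y_k'|+\mathcal W_1(\mu,\mu')$; and if $\mu_j\to\mu$ narrowly with all supports in $\overline{B(0,R)}$, then $\mathcal L(Y,\mu_j)\to\mathcal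 L(Y,\mu)$ uniformly in $Y$. For a measure $\mu$ and $Y,u\in\mathbb R^{dm}$ put $$v[\mu,Y,u](x)=(H*\mu)(x)+\sum_{\ell=1}^d (G^\ell*\mu_{m,\ell})(x),\qquad \mu_{m,\ell}=\frac1m\sum_{k=1}^m u_{k\ell}\,\delta_{Y_k}.$$ Let $Y^0\in\mathbb R^{dm}$ and let $\mu^0\in\mathcal P_1(\mathbb R^d)$ be compactly supported. *Mean-field problem.* For an admissible $u$, a solution of $$\dot Y_k=u_k\ (k=1,\dots,m),\qquad \partial_t\mu+\nabla\cdot\big(v[\mu,Y,u]\,\mu\big)=0,\qquad (Y,\mu)(0)=(Y^0,\mu^0)$$ is a map $(Y,\mu):[0,T]\to\mathbb R^{dm}\times\mathcal P_1(\mathbb R^d)$, continuous for the above distance, with the supports of all $\mu(t)$ in one ball, such that $Y_k(t)=Y^0_k+\int_0^tu_k\,ds$ and, for all $\varphi\in C_c^\infty(\mathbb R^d)$ and $t\in[0,T]$, $$\int\varphi\,d\mu(t)-\int\varphi\,d\mu^0=\int_0^t\int\nabla\varphi\cdot v[\mu(s),Y(s),u(s)]\,d\mu(s)\,ds .$$ The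 problem is to minimize $J(u)=\int_0^T\big(\mathcal L(Y(t),\mu(t))+\sum_k|u_k(t)|^2\big)\,dt$ over admissible $u$. *Problem with $N\ge1$ followers.* Given $X^0_N\in(\mathbb R^d)^N$, minimize over admissible $u$ the same integral with $(Y,\mu)$ replaced by $(Y_N,\mu_N)$, where $\mu_N=\frac1N\sum_{i=1}^N\delta_{X_i}$ and $(Y_N,X)$ is the Carathéodory solution of $\dot Y_k=u_k$, $\dot X_i=v[\mu_N,Y,u](X_i)$ with initial datum $(Y^0,X_N^0)$. Then: 1. For every admissible $u$ the mean-field system has exactly one solution, so $J$ is well defined. 2. The mean-field problem has a minimizer: there is an admissible $u^*$ with $J(u^*)\le J(u)$ for all admissible $u$. 3. There are initial data $X^0_N\in(\mathbb R^d)^N$, $N\ge 1$, all of whose components lie in one ball, with $\mathcal W_1(\mu_N^0,\mu^0)\to0$, where $\mu^0_N$ is the empirical measure of $X^0_N$. For every such family $(X^0_N)_N$: for each $N\ge1$ the finite-dimensional system is uniquely solvable for every admissible control and the problem with $N$ followers has an optimal control; every sequence $(u_N^*)_{N\ge1}$ of such optimal controls has a subsequence that converges in $L^2([0,T])$ (equivalently,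 in $L^p([0,T])$ for every $1\le p<\infty$) to a minimizer $u^*$ of the mean-field problem; and whenever a subsequence of $(u_N^*)$ converges in $L^2([0,T])$, its limit is a minimizer of the mean-field problem. -/

import Mathlib

open MeasureTheory Set Filter Topology
open scoped ENNReal BoundedContinuousFunction ContDiff

noncomputable section

namespace LeaderFollower

/-- Physical space `ℝ^d` with the Euclidean norm. -/
abbrev Space (d : ℕ) : Type := EuclideanSpace ℝ (Fin d)

/-- Positions (or velocities) of the `m` leaders: an element of `ℝ^{dm}`. -/
abbrev Leaders (m d : ℕ) : Type := Fin m → Space d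

/-- Hypothesis (H) for one interaction function: bounded, locally Lipschitz, and
`|F ξ| ≤ C (1 + |ξ|)`. -/
structure HypHFun {d : ℕ} (F : Space d → Space d) : Prop where
  bounded : ∃ B : ℝ, ∀ ξ, ‖F ξ‖ ≤ B
  locallyLipschitz : LocallyLipschitz F
  growth : ∃ C : ℝ, ∀ ξ, ‖F ξ‖ ≤ C * (1 + ‖ξ‖)

/-- Hypothesis (H). -/
structure HypH {d : ℕ} (H : Space d → Space d) (G : Fin d → Space d → Space d) : Prop where
  hypH : HypHFun H
  hypG : ∀ ℓ, HypHFun (G ℓ)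

/-- Membership in `𝒫₁(ℝ^d)`: probability measures of finite first moment. -/
structure InP1 {d : ℕ} (μ : Measure (Space d)) : Prop where
  prob : IsProbabilityMeasure μ
  moment : Integrable (fun x => ‖x‖) μ

/-- The support of `μ` is contained in the closed ball of radius `R` about the origin
(for a closed set this means that the complement is a null set). -/
def SuppIn {d : ℕ} (R : ℝ) (μ : Measure (Space d)) : Prop :=
  μ (Metric.closedBall 0 R)ᶜ = 0

/-- The set `Π(μ, ν)` of transport plans. -/
def couplings {d : ℕ} (μ ν : Measure (Space d)) : Set (Measure (Space d × Space d)) :=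
  {π | IsProbabilityMeasure π ∧ π.map Prod.fst = μ ∧ π.map Prod.snd = ν}

/-- The `1`-Wasserstein distance, as an element of `[0, ∞]`. -/
def W1 {d : ℕ} (μ ν : Measure (Space d)) : ℝ≥0∞ :=
  ⨅ π ∈ couplings μ ν, ∫⁻ p, ENNReal.ofReal ‖p.1 - p.2‖ ∂π

/-- Narrow convergence of a sequence of measures. -/
def NarrowTendsto {d : ℕ} (μs : ℕ → Measure (Space d)) (μ : Measure (Space d)) : Prop :=
  ∀ f : Space d →ᵇ ℝ, Tendsto (fun j => ∫ x, f x ∂(μs j)) atTop (𝓝 (∫ x, f x ∂μ))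

/-- Hypothesis (L) on the running cost `𝓛 : ℝ^{dm} × 𝒫₁(ℝ^d) → ℝ` (only the values on
`𝒫₁(ℝ^d)` matter): nonnegative; continuous in `(Y, μ)` for the distance `|Y - Y'| + W1(μ, μ')`;
and `𝓛(Y, μ_j) → 𝓛(Y, μ)` uniformly in `Y` whenever `μ_j → μ` narrowly. Convergence is tested
on equi-compactly supported sequences of measures, so that costs such as
`∫ |x - x⋆|² dμ(x)` are included. -/
structure HypL {m d : ℕ} (L : Leaders m d → Measure (Space d) → ℝ) : Prop where
  nonneg : ∀ Y μ, InP1 μ → 0 ≤ L Y μ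
  continuous : ∀ (R : ℝ) (Ys : ℕ → Leaders m d) (Y : Leaders m d)
    (μs : ℕ → Measure (Space d)) (μ : Measure (Space d)),
    (∀ j, InP1 (μs j) ∧ SuppIn R (μs j)) → InP1 μ → SuppIn R μ →
    Tendsto Ys atTop (𝓝 Y) → Tendsto (fun j => W1 (μs j) μ) atTop (𝓝 0) →
    Tendsto (fun j => L (Ys j) (μs j)) atTop (𝓝 (L Y μ))
  narrow : ∀ (R : ℝ) (μs : ℕ → Measure (Space d)) (μ : Measure (Space d)),
    (∀ j, InP1 (μs j) ∧ SuppIn R (μs j)) → InP1 μ → SuppIn R μ →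
    NarrowTendsto μs μ → TendstoUniformly (fun j Y => L Y (μs j)) (fun Y => L Y μ) atTop

/-- Admissible controls, `u ∈ L^∞([0,T], 𝒰)`. -/
structure Admissible {m d : ℕ} (T : ℝ) (U : Set (Leaders m d)) (u : ℝ → Leaders m d) : Prop where
  measurable : AEStronglyMeasurable u (volume.restrict (Icc 0 T))
  mem : ∀ᵐ t ∂(volume.restrict (Icc 0 T)), u t ∈ U

/-- The velocity field `H * μ + ∑_ℓ G^ℓ * μ_{m,ℓ}` at `x`, where
`μ_{m,ℓ} = (1/m) ∑_k u_{kℓ} δ_{Y_k}`. -/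
def velocity {m d : ℕ} (H : Space d → Space d) (G : Fin d → Space d → Space d)
    (μ : Measure (Space d)) (Y u : Leaders m d) (x : Space d) : Space d :=
  (∫ ξ, H (x - ξ) ∂μ) + ∑ ℓ : Fin d, (m : ℝ)⁻¹ • ∑ k : Fin m, (u k ℓ) • G ℓ (x - Y k)

/-- The empirical measure `(1/N) ∑_i δ_{X_i}`. -/
def empirical {N d : ℕ} (X : Fin N → Space d) : Measure (Space d) :=
  (N : ℝ≥0∞)⁻¹ • ∑ i : Fin N, Measure.dirac (X i)

/-- `Y` is the Carathéodory solution on `[0,T]` of `Y_k' = u_k`, `Y(0) = Y0`. -/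
def IsLeaderPath {m d : ℕ} (T : ℝ) (u : ℝ → Leaders m d) (Y0 : Leaders m d)
    (Y : ℝ → Leaders m d) : Prop :=
  ∀ t ∈ Icc 0 T, ∀ k, Y t k = Y0 k + ∫ s in (0 : ℝ)..t, u s k

/-- Carathéodory solutions on `[0,T]` of the system of `m` leaders and `N` followers,
in integral form. -/
structure IsFiniteSol {m d N : ℕ} (T : ℝ) (H : Space d → Space d)
    (G : Fin d → Space d → Space d) (u : ℝ → Leaders m d)
    (Y0 : Leaders m d) (X0 : Fin N → Space d)
    (Y : ℝ → Leaders m d) (X : ℝ → Fin N → Space d) : Prop where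
  leaders : IsLeaderPath T u Y0 Y
  continuous : ContinuousOn X (Icc 0 T)
  followers : ∀ t ∈ Icc 0 T, ∀ i,
    X t i = X0 i + ∫ s in (0 : ℝ)..t, velocity H G (empirical (X s)) (Y s) (u s) (X s i)

/-- Solutions `(Y, μ)` on `[0,T]` of the coupled system
`Y_k' = u_k`, `∂_t μ + ∇·((H * μ + ∑_ℓ G^ℓ * μ_{m,ℓ}) μ) = 0` with initial datum `(Y0, μ0)`:
equi-compactly supported, continuous for the distance of `ℝ^{dm} × 𝒫₁(ℝ^d)`, with the continuity
equation tested against smooth compactly supported functions. As the control is only measurable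
in time, the identity for `d/dt ∫ φ dμ(t)` is imposed in its time-integrated form. -/
structure IsMeanFieldSol {m d : ℕ} (T : ℝ) (H : Space d → Space d)
    (G : Fin d → Space d → Space d) (u : ℝ → Leaders m d)
    (Y0 : Leaders m d) (μ0 : Measure (Space d))
    (Y : ℝ → Leaders m d) (μ : ℝ → Measure (Space d)) : Prop where
  inP1 : ∀ t ∈ Icc 0 T, InP1 (μ t)
  compactSupport : ∃ R : ℝ, ∀ t ∈ Icc 0 T, SuppIn R (μ t)
  continuousY : ContinuousOn Y (Icc 0 T)
  continuousμ : ∀ t ∈ Icc 0 T, Tendsto (fun s => W1 (μ s) (μ t)) (𝓝[Icc 0 T] t) (𝓝 0)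
  leaders : IsLeaderPath T u Y0 Y
  initial : μ 0 = μ0
  followers : ∀ φ : Space d → ℝ, ContDiff ℝ ∞ φ → HasCompactSupport φ → ∀ t ∈ Icc 0 T,
    ∫ x, φ x ∂(μ t) = ∫ x, φ x ∂μ0 +
      ∫ s in (0 : ℝ)..t, ∫ x, fderiv ℝ φ x (velocity H G (μ s) (Y s) (u s) x) ∂(μ s)

/-- The cost `∫_0^T (𝓛(Y(t), μ(t)) + ∑_k |u_k(t)|²) dt`. -/
def cost {m d : ℕ} (T : ℝ) (L : Leaders m d → Measure (Space d) → ℝ)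
    (u Y : ℝ → Leaders m d) (μ : ℝ → Measure (Space d)) : ℝ :=
  ∫ t in (0 : ℝ)..T, (L (Y t) (μ t) + ∑ k, ‖u t k‖ ^ 2)

/-- `u` is an optimal control of the problem with `N` followers. -/
def IsFiniteOptimal {m d N : ℕ} (T : ℝ) (U : Set (Leaders m d)) (H : Space d → Space d)
    (G : Fin d → Space d → Space d) (L : Leaders m d → Measure (Space d) → ℝ)
    (Y0 : Leaders m d) (X0 : Fin N → Space d) (u : ℝ → Leaders m d) : Prop :=
  Admissible T U u ∧ ∃ Y X, IsFiniteSol T H G u Y0 X0 Y X ∧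
    ∀ v, Admissible T U v → ∀ Z W, IsFiniteSol T H G v Y0 X0 Z W →
      cost T L u Y (fun t => empirical (X t)) ≤ cost T L v Z (fun t => empirical (W t))

/-- `u` is an optimal control of the infinite dimensional (mean-field) problem. -/
def IsMeanFieldOptimal {m d : ℕ} (T : ℝ) (U : Set (Leaders m d)) (H : Space d → Space d)
    (G : Fin d → Space d → Space d) (L : Leaders m d → Measure (Space d) → ℝ)
    (Y0 : Leaders m d) (μ0 : Measure (Space d)) (u : ℝ → Leaders m d) : Prop :=
  Admissible T U u ∧ ∃ Y μ, IsMeanFieldSol T H G u Y0 μ0 Y μ ∧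
    ∀ v, Admissible T U v → ∀ Z ν, IsMeanFieldSol T H G v Y0 μ0 Z ν →
      cost T L u Y μ ≤ cost T L v Z ν

/-- Convergence of controls in `L²([0,T])`; for controls with values in a bounded set this is
convergence in every `L^p([0,T])`, `1 ≤ p < ∞`. -/
def ControlsTendsto {m d : ℕ} (T : ℝ) (us : ℕ → ℝ → Leaders m d) (u : ℝ → Leaders m d) : Prop :=
  Tendsto (fun j => eLpNorm (fun t => us j t - u t) 2 (volume.restrict (Icc 0 T))) atTop (𝓝 0)

end LeaderFollower

end

/-! Controls are bounded and enter the dynamics linearly, while their energy is a squared Hilbert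
norm. Weak limits of controls therefore suffice to pass to the limit in the trajectories, and the
energy upgrades weak convergence of optimal controls to strong convergence. Moreover, the empirical
measure of the `N`-follower system solves the mean-field system with empirical datum
(`isFiniteOptimal_iff`). The finite problems are thus mean-field problems with perturbed data, and
everything reduces to the stability of one problem under `W1`-perturbations of the datum and weak
perturbations of the control.

Well-posedness. Bounded interactions give bounded speeds, so trajectories stay in a ball that
depends only on the bounds, and the interactions may be cut off outside a larger ball to become
globally Lipschitz (`HypH.exists_globalization`). A fixed point in a weighted sup norm then yields a
characteristic flow (`exists_isFlow`), and the image of the datum under it is a solution. Uniqueness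
has to hold among all weak solutions, for fields that are only measurable in time and Lipschitz in
space. Two solutions are compared by pulling test functions back through one and the same Euler
scheme with mollified displacements (`Transported.iterate`). This bounds their distance in duality
with Lipschitz functions by the time integral of the distance of their fields, and that bound is a
contraction in an exponentially weighted norm (`IsMeanFieldSol.unique`).

Stability. A coupling of two initial data is transported by the two flows, and Grönwall's inequality
controls the mean distance (`flowDist_le`). The difference of the controls appears only through the
time integral of the leaders' force along the unperturbed flow, which tends to zero under weak
convergence. So the measures converge in `W1` along convergent times (`WeakTendsto.tendsto_W1_flow`)
and the integrated running costs converge (`tendsto_integral_flowCost`).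

Optimality. Almost optimal controls have a weakly convergent subsequence, whose limit `u` takes
values in the convex set `U`. Comparison with `u` itself forces the energy of the differences to
zero, which is strong convergence; comparison with an arbitrary competitor shows that `u` is optimal
(`exists_tendsto_isMeanFieldOptimal`). A constant datum and a minimizing sequence give existence;
empirical data and exact minimizers give convergence of the finite problems. Empirical
approximations of the datum come from cell averages of a function on the unit interval whose law is
the datum (`exists_tendsto_empirical`). -/

noncomputable section

namespace LeaderFollower

/-! ### Mollification of Lipschitz functions -/

section Mollification

variable {d : ℕ} {F : Type*} [NormedAddCommGroup F] [NormedSpace ℝ F]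

/-- The difference of the two derivatives is the derivative at `0` of `z ↦ f (x + z) - g (y + z)`.
Comparing derivatives through increments suits mollification, which commutes with increments
(`moll_increment`), so no derivative has to be moved under a convolution. -/
theorem norm_fderiv_sub_le_of_increments {f g : Space d → F} {x y : Space d} {c : ℝ} (hc : 0 ≤ c)
    (hf : DifferentiableAt ℝ f x) (hg : DifferentiableAt ℝ g y)
    (h : ∀ z, ‖(f (x + z) - f x) - (g (y + z) - g y)‖ ≤ c * ‖z‖) :
    ‖fderiv ℝ f x - fderiv ℝ g y‖ ≤ c := by
  have h1 : HasFDerivAt (fun z => f (x + z) - g (y + z)) (fderiv ℝ f x - fderiv ℝ g y) 0 := by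
    have hf' : HasFDerivAt f (fderiv ℝ f x) (x + 0) := by simpa using hf.hasFDerivAt
    have hg' : HasFDerivAt g (fderiv ℝ g y) (y + 0) := by simpa using hg.hasFDerivAt
    exact ((hasFDerivAt_comp_add_left x).2 hf').sub ((hasFDerivAt_comp_add_left y).2 hg')
  refine h1.le_of_lip' hc (Eventually.of_forall fun z => ?_)
  have := h z
  simp only [add_zero, sub_zero]
  convert this using 2
  abel

theorem norm_fderiv_le_of_norm_sub_le {f : Space d → F} {A : ℝ} (hA : 0 ≤ A)
    (h : ∀ x y, ‖f x - f y‖ ≤ A * ‖x - y‖) (x : Space d) : ‖fderiv ℝ f x‖ ≤ A := by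
  have := norm_fderiv_le_of_lipschitz (𝕜 := ℝ) (f := f) (x₀ := x) (C := A.toNNReal)
    (LipschitzWith.of_dist_le_mul fun x y => by
      rw [Real.coe_toNNReal A hA, dist_eq_norm, dist_eq_norm]; exact h x y)
  rwa [Real.coe_toNNReal A hA] at this

theorem continuous_of_norm_sub_le {E F : Type*} [NormedAddCommGroup F] [NormedAddCommGroup E] {f : E → F} {A : ℝ}
    (h : ∀ x y, ‖f x - f y‖ ≤ A * ‖x - y‖) : Continuous f := by
  refine (LipschitzWith.of_dist_le_mul (K := A.toNNReal) fun x y => ?_).continuous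
  rw [dist_eq_norm, dist_eq_norm]
  exact (h x y).trans (mul_le_mul_of_nonneg_right (Real.le_coe_toNNReal A) (norm_nonneg _))

/-- A smooth bump of radius `δ` about the origin. -/
def mollBump (d : ℕ) (δ : ℝ) (hδ : 0 < δ) : ContDiffBump (0 : Space d) :=
  ⟨δ / 2, δ, by positivity, by linarith⟩

/-- Mollification at scale `δ`. -/
def moll {δ : ℝ} (hδ : 0 < δ) (g : Space d → F) : Space d → F :=
  convolution ((mollBump d δ hδ).normed volume) g (ContinuousLinearMap.lsmul ℝ ℝ) volume

variable {δ : ℝ} (hδ : 0 < δ)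

theorem contDiff_moll [CompleteSpace F] {g : Space d → F} (hg : Continuous g) :
    ContDiff ℝ ∞ (moll hδ g) :=
  ((mollBump d δ hδ).hasCompactSupport_normed (μ := volume)).contDiff_convolution_left _
    ((mollBump d δ hδ).contDiff_normed (μ := volume)) hg.locallyIntegrable

theorem differentiable_moll [CompleteSpace F] {g : Space d → F} (hg : Continuous g) :
    Differentiable ℝ (moll hδ g) :=
  (contDiff_moll hδ hg).differentiable (by simp)

theorem norm_moll_sub_le [CompleteSpace F] {g : Space d → F} (hg : Continuous g) {x : Space d}
    {v : F} {c : ℝ} (hc : 0 ≤ c) (h : ∀ y, ‖y - x‖ < δ → ‖g y - v‖ ≤ c) :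
    ‖moll hδ g x - v‖ ≤ c := by
  rw [← dist_eq_norm]
  refine dist_convolution_le hc (mollBump d δ hδ).support_normed_eq.subset
    (mollBump d δ hδ).nonneg_normed (mollBump d δ hδ).integral_normed
    hg.aestronglyMeasurable fun y hy => ?_
  rw [dist_eq_norm]
  exact h y (by simpa [mollBump, dist_eq_norm] using hy)

theorem norm_moll_le [CompleteSpace F] {g : Space d → F} (hg : Continuous g) {x : Space d}
    {c : ℝ} (hc : 0 ≤ c) (h : ∀ y, ‖g y‖ ≤ c) : ‖moll hδ g x‖ ≤ c := by
  simpa using norm_moll_sub_le hδ hg (x := x) (v := 0) hc fun y _ => by simpa using h y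

theorem moll_integrable {g : Space d → F} (hg : Continuous g) (x : Space d) :
    Integrable (fun t => (mollBump d δ hδ).normed volume t • g (x - t)) := by
  refine Continuous.integrable_of_hasCompactSupport ?_ ?_
  · exact ((mollBump d δ hδ).continuous_normed (μ := volume)).smul (hg.comp (continuous_const.sub continuous_id))
  · exact (mollBump d δ hδ).hasCompactSupport_normed.smul_right

theorem moll_apply (g : Space d → F) (x : Space d) :
    moll hδ g x = ∫ t, (mollBump d δ hδ).normed volume t • g (x - t) := rfl

theorem moll_increment {g : Space d → F} (hg : Continuous g) (x z : Space d) :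
    moll hδ g (x + z) - moll hδ g x = moll hδ (fun y => g (y + z) - g y) x := by
  rw [moll_apply, moll_apply, moll_apply,
    ← integral_sub (moll_integrable hδ hg _) (moll_integrable hδ hg _)]
  refine integral_congr_ae (Eventually.of_forall fun t => ?_)
  simp only [smul_sub]
  congr 3
  abel

theorem norm_moll_sub_moll_le [CompleteSpace F] {g : Space d → F} {A : ℝ} (hA : 0 ≤ A)
    (h : ∀ x y, ‖g x - g y‖ ≤ A * ‖x - y‖) (x y : Space d) :
    ‖moll hδ g x - moll hδ g y‖ ≤ A * ‖x - y‖ := by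
  have hg := continuous_of_norm_sub_le h
  have := moll_increment hδ hg y (x - y)
  rw [add_sub_cancel] at this
  rw [this]
  refine norm_moll_le hδ (by fun_prop) (by positivity) fun z => ?_
  simpa using h (z + (x - y)) z

theorem norm_moll_sub_self_le [CompleteSpace F] {g : Space d → F} {A : ℝ} (hA : 0 ≤ A)
    (h : ∀ x y, ‖g x - g y‖ ≤ A * ‖x - y‖) (x : Space d) :
    ‖moll hδ g x - g x‖ ≤ A * δ :=
  norm_moll_sub_le hδ (continuous_of_norm_sub_le h) (by positivity) fun y hy =>
    (h y x).trans (by gcongr)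

/-- Mollification gains one derivative: the modulus of continuity is that of the kernel, so only a
sup bound on `g` enters. The constant may blow up as `δ → 0`, but it is the same for all `g` and all
target spaces. -/
theorem exists_norm_moll_sub_moll_le_of_bounded (d : ℕ) {δ : ℝ} (hδ : 0 < δ) :
    ∃ C : ℝ, 0 ≤ C ∧ ∀ (F : Type) [NormedAddCommGroup F] [NormedSpace ℝ F] (g : Space d → F)
      (c : ℝ), Continuous g → (∀ x, ‖g x‖ ≤ c) →
      ∀ x y, ‖moll hδ g x - moll hδ g y‖ ≤ C * c * ‖x - y‖ := by
  set φ := mollBump d δ hδ with hφ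
  obtain ⟨Λ, hΛ⟩ : ∃ Λ, LipschitzWith Λ (φ.normed volume) :=
    ((φ.contDiff_normed (n := 1) (μ := volume)).lipschitzWith_of_hasCompactSupport
      φ.hasCompactSupport_normed (by simp))
  set V : ℝ := volume.real (Metric.closedBall (0 : Space d) δ) with hV
  refine ⟨2 * Λ * V, by positivity, fun F _ _ g c hg hc x y => ?_⟩
  have hc0 : 0 ≤ c := (norm_nonneg _).trans (hc 0)
  have hsw : ∀ x, moll hδ g x = ∫ t, φ.normed volume (x - t) • g t := fun x =>
    convolution_eq_swap (ContinuousLinearMap.lsmul ℝ ℝ)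
  have hint : ∀ x, Integrable fun t => φ.normed volume (x - t) • g t := by
    intro x
    have := (moll_integrable hδ hg x).comp_sub_left x
    simpa using this
  have hsupp : ∀ x t, t ∉ Metric.closedBall x δ → φ.normed volume (x - t) = 0 := by
    intro x t ht
    by_contra hne
    have h1 : x - t ∈ Function.support (φ.normed volume) := hne
    rw [φ.support_normed_eq] at h1
    apply ht
    rw [Metric.mem_closedBall, dist_comm, dist_eq_norm]
    have : ‖x - t‖ < δ := by simpa [hφ, mollBump] using h1
    exact this.le
  have hvol : ∀ x, volume.real (Metric.closedBall (x : Space d) δ) = V := by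
    intro x
    rw [hV, measureReal_def, measureReal_def, Measure.addHaar_closedBall_center]
  -- Outside these two balls both kernels vanish. The constant `2 * Λ * V` is the Lipschitz constant
  -- of the kernel times a bound for the volume of the union.
  set S := Metric.closedBall x δ ∪ Metric.closedBall y δ with hS
  have hSm : MeasurableSet S := Metric.isClosed_closedBall.measurableSet.union
    Metric.isClosed_closedBall.measurableSet
  have hSfin : volume S ≠ ⊤ := ((isCompact_closedBall x δ).union
    (isCompact_closedBall y δ)).measure_ne_top
  rw [hsw, hsw, ← integral_sub (hint x) (hint y)]
  have hb : ∀ t, ‖φ.normed volume (x - t) • g t - φ.normed volume (y - t) • g t‖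
      ≤ S.indicator (fun _ => Λ * ‖x - y‖ * c) t := by
    intro t
    by_cases ht : t ∈ S
    · rw [indicator_of_mem ht, ← sub_smul, norm_smul]
      have := hΛ.dist_le_mul (x - t) (y - t)
      rw [dist_eq_norm, dist_eq_norm, sub_sub_sub_cancel_right] at this
      exact mul_le_mul this (hc t) (norm_nonneg _) (by positivity)
    · rw [indicator_of_notMem ht]
      rw [hS, mem_union, not_or] at ht
      simp [hsupp x t ht.1, hsupp y t ht.2]
  refine (norm_integral_le_of_norm_le (g := S.indicator (fun _ => Λ * ‖x - y‖ * c)) ?_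
    (Eventually.of_forall hb)).trans ?_
  · exact (integrable_indicator_iff hSm).2 (integrableOn_const hSfin)
  · rw [integral_indicator hSm, setIntegral_const, smul_eq_mul]
    have : volume.real S ≤ 2 * V := by
      refine (measureReal_union_le _ _).trans ?_
      rw [hvol, hvol]; linarith
    calc volume.real S * (Λ * ‖x - y‖ * c) ≤ 2 * V * (Λ * ‖x - y‖ * c) := by gcongr
      _ = _ := by ring

/-- The increments `g (· + z) - g` are bounded by `A * ‖z‖`, so the bound for mollified bounded
functions applies to them with a constant linear in `‖z‖`. -/
theorem exists_norm_fderiv_moll_sub_le (d : ℕ) {δ : ℝ} (hδ : 0 < δ) :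
    ∃ C : ℝ, 0 ≤ C ∧ ∀ (F : Type) [NormedAddCommGroup F] [NormedSpace ℝ F] [CompleteSpace F]
      (g : Space d → F) (A : ℝ), 0 ≤ A → (∀ x y, ‖g x - g y‖ ≤ A * ‖x - y‖) →
      ∀ x y, ‖fderiv ℝ (moll hδ g) x - fderiv ℝ (moll hδ g) y‖ ≤ C * A * ‖x - y‖ := by
  obtain ⟨C, hC, h⟩ := exists_norm_moll_sub_moll_le_of_bounded d hδ
  refine ⟨C, hC, fun F _ _ _ g A hA hg x y => ?_⟩
  have hgc := continuous_of_norm_sub_le hg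
  refine norm_fderiv_sub_le_of_increments (by positivity) (differentiable_moll hδ hgc x)
    (differentiable_moll hδ hgc y) fun z => ?_
  rw [moll_increment hδ hgc, moll_increment hδ hgc]
  refine (h F _ (A * ‖z‖) (by fun_prop) (fun w => ?_) x y).trans (le_of_eq (by ring))
  simpa using hg (w + z) w

theorem norm_fderiv_moll_sub_fderiv_le [CompleteSpace F] {g : Space d → F} {M : ℝ} (hM : 0 ≤ M)
    (hg : Differentiable ℝ g)
    (h : ∀ x y, ‖fderiv ℝ g x - fderiv ℝ g y‖ ≤ M * ‖x - y‖) (x : Space d) :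
    ‖fderiv ℝ (moll hδ g) x - fderiv ℝ g x‖ ≤ M * δ := by
  refine norm_fderiv_sub_le_of_increments (by positivity) (differentiable_moll hδ hg.continuous x)
    (hg x) fun z => ?_
  rw [moll_increment hδ hg.continuous]
  have hgc := hg.continuous
  refine norm_moll_sub_le hδ (by fun_prop) (by positivity) fun y hy => ?_
  -- The second difference of `g` is an increment in `w` of `g (y + w) - g (x + w)`, whose
  -- derivative is at most `M * ‖y - x‖ ≤ M * δ`.
  have key := Convex.norm_image_sub_le_of_norm_fderiv_le (𝕜 := ℝ) (s := univ)
    (f := fun w => g (y + w) - g (x + w)) (C := M * δ) (x := 0) (y := z) ?_ ?_ convex_univ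
    (mem_univ _) (mem_univ _)
  · simp only [add_zero, sub_zero] at key
    refine le_trans (le_of_eq ?_) key
    congr 1
    abel
  · intro w _
    exact ((differentiableAt_comp_add_left y).2 (hg _)).sub
      ((differentiableAt_comp_add_left x).2 (hg _))
  · intro w _
    rw [fderiv_fun_sub ((differentiableAt_comp_add_left y).2 (hg _))
      ((differentiableAt_comp_add_left x).2 (hg _)), fderiv_comp_add_left, fderiv_comp_add_left]
    refine (h _ _).trans ?_
    rw [add_sub_add_right_eq_sub]
    gcongr

end Mollification

end LeaderFollower
end

noncomputable section

namespace LeaderFollower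

/-! ### The Wasserstein distance -/

section Wasserstein

variable {d : ℕ}

theorem W1_map_le {Ω : Type*} [MeasurableSpace Ω] (P : Measure Ω) [IsProbabilityMeasure P]
    {f g : Ω → Space d} (hf : Measurable f) (hg : Measurable g) :
    W1 (P.map f) (P.map g) ≤ ∫⁻ w, ENNReal.ofReal ‖f w - g w‖ ∂P := by
  have hfg : Measurable fun w => (f w, g w) := hf.prodMk hg
  have hπ : P.map (fun w => (f w, g w)) ∈ couplings (P.map f) (P.map g) := by
    refine ⟨Measure.isProbabilityMeasure_map hfg.aemeasurable, ?_, ?_⟩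
    · rw [Measure.map_map measurable_fst hfg]; rfl
    · rw [Measure.map_map measurable_snd hfg]; rfl
  refine (iInf₂_le _ hπ).trans (le_of_eq ?_)
  · rw [lintegral_map (by fun_prop) hfg]

theorem exists_coupling_of_W1_lt {μ ν : Measure (Space d)} {ε : ℝ≥0∞} (h : W1 μ ν < ε) :
    ∃ π ∈ couplings μ ν, ∫⁻ p, ENNReal.ofReal ‖p.1 - p.2‖ ∂π < ε := by
  simpa [W1, iInf_lt_iff] using h

theorem InP1.of_suppIn {μ : Measure (Space d)} [IsProbabilityMeasure μ] {R : ℝ}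
    (h : SuppIn R μ) : InP1 μ := by
  refine ⟨inferInstance, ?_⟩
  refine Integrable.mono' (integrable_const R) (by fun_prop) ?_
  have : ∀ᵐ x ∂μ, x ∈ Metric.closedBall (0 : Space d) R := h
  filter_upwards [this] with x hx
  simpa using hx

theorem SuppIn.ae_norm_le {μ : Measure (Space d)} {R : ℝ} (h : SuppIn R μ) :
    ∀ᵐ x ∂μ, ‖x‖ ≤ R := by
  have : ∀ᵐ x ∂μ, x ∈ Metric.closedBall (0 : Space d) R := h
  filter_upwards [this] with x hx
  simpa using hx

theorem suppIn_of_ae {μ : Measure (Space d)} {R : ℝ} (h : ∀ᵐ x ∂μ, ‖x‖ ≤ R) : SuppIn R μ := by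
  have : ∀ᵐ x ∂μ, x ∈ Metric.closedBall (0 : Space d) R := by
    filter_upwards [h] with x hx
    simpa using hx
  exact this

theorem SuppIn.mono {μ : Measure (Space d)} {R R' : ℝ} (h : SuppIn R μ) (hR : R ≤ R') :
    SuppIn R' μ :=
  suppIn_of_ae (h.ae_norm_le.mono fun _ hx => hx.trans hR)

theorem InP1.integrable_of_lipschitz {F : Type*} [NormedAddCommGroup F]
    {μ : Measure (Space d)} (hμ : InP1 μ) {ψ : Space d → F} {Λ : ℝ}
    (hψ : ∀ x y, ‖ψ x - ψ y‖ ≤ Λ * ‖x - y‖) : Integrable ψ μ := by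
  have := hμ.prob
  refine Integrable.mono' ((hμ.moment.const_mul Λ).add (integrable_const ‖ψ 0‖))
    (continuous_of_norm_sub_le hψ).aestronglyMeasurable (Eventually.of_forall fun x => ?_)
  have h1 := hψ x 0
  rw [sub_zero] at h1
  have h2 := norm_le_norm_add_norm_sub (ψ 0) (ψ x)
  have h3 := norm_sub_rev (ψ x) (ψ 0)
  simp only [Pi.add_apply]
  linarith

/-- The elementary half of Kantorovich duality: both integrals are written on a common coupling. -/
theorem norm_integral_sub_le_W1 {F : Type*} [NormedAddCommGroup F] [NormedSpace ℝ F]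
    [CompleteSpace F]
    {μ ν : Measure (Space d)} (hμ : InP1 μ) (hν : InP1 ν) {ψ : Space d → F} {Λ : ℝ}
    (hψ : ∀ x y, ‖ψ x - ψ y‖ ≤ Λ * ‖x - y‖) :
    ENNReal.ofReal ‖∫ x, ψ x ∂μ - ∫ x, ψ x ∂ν‖ ≤ ENNReal.ofReal Λ * W1 μ ν := by
  have hψc : Continuous ψ := continuous_of_norm_sub_le hψ
  have key : ∀ π ∈ couplings μ ν, ENNReal.ofReal ‖∫ x, ψ x ∂μ - ∫ x, ψ x ∂ν‖ ≤
      ENNReal.ofReal Λ * ∫⁻ p, ENNReal.ofReal ‖p.1 - p.2‖ ∂π := by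
    rintro π ⟨hπ, h1, h2⟩
    have e1 : ∫ x, ψ x ∂μ = ∫ p, ψ p.1 ∂π := by
      rw [← h1, integral_map measurable_fst.aemeasurable hψc.aestronglyMeasurable]
    have e2 : ∫ x, ψ x ∂ν = ∫ p, ψ p.2 ∂π := by
      rw [← h2, integral_map measurable_snd.aemeasurable hψc.aestronglyMeasurable]
    have i1 : Integrable (fun p => ψ p.1) π := by
      have := hμ.integrable_of_lipschitz hψ
      rw [← h1] at this
      exact this.comp_measurable measurable_fst
    have i2 : Integrable (fun p => ψ p.2) π := by
      have := hν.integrable_of_lipschitz hψ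
      rw [← h2] at this
      exact this.comp_measurable measurable_snd
    rw [e1, e2, ← integral_sub i1 i2, ofReal_norm]
    refine (enorm_integral_le_lintegral_enorm _).trans ?_
    rw [← lintegral_const_mul _ (by fun_prop)]
    refine lintegral_mono fun p => ?_
    rw [← ofReal_norm, ← ENNReal.ofReal_mul' (norm_nonneg _)]
    exact ENNReal.ofReal_le_ofReal (hψ _ _)
  -- A factor may be moved inside an infimum in `[0, ∞]` when it is neither `0` nor `∞`. In the
  -- degenerate case either one coupling already gives the bound, or the constancy of `ψ` is used.
  by_cases hΛ : ENNReal.ofReal Λ = 0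
  · by_cases hne : (couplings μ ν).Nonempty
    · obtain ⟨π, hπ⟩ := hne
      simpa [hΛ] using key π hπ
    · have hΛ' : ∀ x y, ψ x = ψ y := fun x y => by
        have h1 := hψ x y
        have h2 : Λ ≤ 0 := by simpa using hΛ
        have h3 : ‖ψ x - ψ y‖ ≤ 0 := h1.trans (mul_nonpos_of_nonpos_of_nonneg h2 (norm_nonneg _))
        simpa [sub_eq_zero] using h3
      have := hμ.prob
      have := hν.prob
      have h4 : ψ = fun _ => ψ 0 := funext fun x => hΛ' x 0
      rw [h4]
      simp
  · rw [W1, ENNReal.mul_iInf_of_ne hΛ ENNReal.ofReal_ne_top]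
    refine le_iInf fun π => ?_
    rw [ENNReal.mul_iInf_of_ne hΛ ENNReal.ofReal_ne_top]
    exact le_iInf fun hπ => key π hπ

end Wasserstein

/-! ### Velocity fields of bounded and globally Lipschitz interactions -/

section Velocity

variable {m d : ℕ}

/-- A function bounded by `B` and Lipschitz with constant `K`. -/
structure BddLip {d : ℕ} (B K : ℝ) (F : Space d → Space d) : Prop where
  bdd : ∀ ξ, ‖F ξ‖ ≤ B
  lip : ∀ x y, ‖F x - F y‖ ≤ K * ‖x - y‖

theorem BddLip.cont {B K : ℝ} {F : Space d → Space d} (h : BddLip B K F) : Continuous F :=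
  continuous_of_norm_sub_le h.lip

theorem BddLip.lip_sub {B K : ℝ} {F : Space d → Space d} (h : BddLip B K F) (x y z : Space d) :
    ‖F (x - z) - F (y - z)‖ ≤ K * ‖x - y‖ := by
  simpa using h.lip (x - z) (y - z)

theorem BddLip.lip_sub' {B K : ℝ} {F : Space d → Space d} (h : BddLip B K F) (x y z : Space d) :
    ‖F (z - x) - F (z - y)‖ ≤ K * ‖x - y‖ := by
  have := h.lip (z - x) (z - y)
  rwa [sub_sub_sub_cancel_left, norm_sub_rev y x] at this

/-- Interactions bounded by `B` and Lipschitz with constant `K`. -/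
structure Interactions {d : ℕ} (B K : ℝ) (H : Space d → Space d)
    (G : Fin d → Space d → Space d) : Prop where
  B_nonneg : 0 ≤ B
  K_nonneg : 0 ≤ K
  H : BddLip B K H
  G : ∀ ℓ, BddLip B K (G ℓ)

/-- The part of the velocity field due to the leaders. -/
def leaderField (G : Fin d → Space d → Space d) (Y u : Leaders m d) (x : Space d) : Space d :=
  ∑ ℓ : Fin d, (m : ℝ)⁻¹ • ∑ k : Fin m, (u k ℓ) • G ℓ (x - Y k)

theorem velocity_eq (H : Space d → Space d) (G : Fin d → Space d → Space d)
    (μ : Measure (Space d)) (Y u : Leaders m d) (x : Space d) :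
    velocity H G μ Y u x = (∫ ξ, H (x - ξ) ∂μ) + leaderField G Y u x := rfl

theorem abs_coord_le (u : Leaders m d) (k : Fin m) (ℓ : Fin d) : |u k ℓ| ≤ ‖u‖ :=
  (PiLp.norm_apply_le (u k) ℓ).trans (norm_le_pi_norm u k)

/-- The average over the leaders costs no factor, while the sum over the coordinates costs `d`. For
`m = 0` the inverse is `0` by convention and the sum vanishes. -/
theorem norm_leaderSum_le {F : Type*} [NormedAddCommGroup F] [NormedSpace ℝ F]
    {u : Leaders m d} {C a : ℝ} (hu : ‖u‖ ≤ C) (ha : 0 ≤ a)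
    {f : Fin d → Fin m → F} (hf : ∀ ℓ k, ‖f ℓ k‖ ≤ a) :
    ‖∑ ℓ : Fin d, (m : ℝ)⁻¹ • ∑ k : Fin m, (u k ℓ) • f ℓ k‖ ≤ d * (C * a) := by
  have hC : 0 ≤ C := (norm_nonneg _).trans hu
  have h1 : ∀ ℓ : Fin d, ‖(m : ℝ)⁻¹ • ∑ k : Fin m, (u k ℓ) • f ℓ k‖ ≤ C * a := by
    intro ℓ
    rw [norm_smul, norm_inv, Real.norm_natCast]
    have h2 : ‖∑ k : Fin m, (u k ℓ) • f ℓ k‖ ≤ m * (C * a) := by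
      refine (norm_sum_le_of_le _ (f := fun k => u k ℓ • f ℓ k) (n := fun _ => C * a)
        fun k _ => ?_).trans (by simp)
      rw [norm_smul]
      exact mul_le_mul ((abs_coord_le u k ℓ).trans hu) (hf ℓ k) (norm_nonneg _) hC
    rcases Nat.eq_zero_or_pos m with hm | hm
    · subst hm; simp; positivity
    · have hm' : (0 : ℝ) < m := by exact_mod_cast hm
      rw [inv_mul_le_iff₀ hm']
      exact h2
  refine (norm_sum_le_of_le _ (n := fun _ => C * a) fun ℓ _ => h1 ℓ).trans (by simp)

variable {B K C : ℝ} {H : Space d → Space d} {G : Fin d → Space d → Space d}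

theorem Interactions.norm_leaderField_le (h : Interactions B K H G) {u : Leaders m d}
    (hu : ‖u‖ ≤ C) (Y : Leaders m d) (x : Space d) : ‖leaderField G Y u x‖ ≤ d * (C * B) :=
  norm_leaderSum_le hu h.B_nonneg fun ℓ _ => (h.G ℓ).bdd _

theorem Interactions.norm_leaderField_sub_le (h : Interactions B K H G) {u : Leaders m d}
    (hu : ‖u‖ ≤ C) (Y Z : Leaders m d) (x y : Space d) :
    ‖leaderField G Y u x - leaderField G Z u y‖ ≤ d * (C * (K * (‖x - y‖ + ‖Y - Z‖))) := by
  have : leaderField G Y u x - leaderField G Z u y =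
      ∑ ℓ : Fin d, (m : ℝ)⁻¹ • ∑ k : Fin m, (u k ℓ) • (G ℓ (x - Y k) - G ℓ (y - Z k)) := by
    simp only [leaderField, ← Finset.sum_sub_distrib, ← smul_sub]
  rw [this]
  have hK := h.K_nonneg
  refine norm_leaderSum_le hu (by positivity) fun ℓ k => ((h.G ℓ).lip _ _).trans ?_
  gcongr
  rw [sub_sub_sub_comm]
  refine (norm_sub_le _ _).trans ?_
  gcongr
  exact norm_le_pi_norm (Y - Z) k

theorem leaderField_sub (G : Fin d → Space d → Space d) (Y u v : Leaders m d) (x : Space d) :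
    leaderField G Y (u - v) x = leaderField G Y u x - leaderField G Y v x := by
  simp only [leaderField, ← Finset.sum_sub_distrib, ← smul_sub, ← sub_smul]
  rfl

theorem Interactions.norm_conv_le (h : Interactions B K H G) (μ : Measure (Space d))
    [IsProbabilityMeasure μ] (x : Space d) : ‖∫ ξ, H (x - ξ) ∂μ‖ ≤ B := by
  simpa using norm_integral_le_of_norm_le_const (μ := μ) (f := fun ξ => H (x - ξ)) (C := B)
    (Eventually.of_forall fun ξ => h.H.bdd _)

theorem Interactions.integrable_conv (h : Interactions B K H G) (μ : Measure (Space d))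
    [IsProbabilityMeasure μ] (x : Space d) : Integrable (fun ξ => H (x - ξ)) μ := by
  have := h.H.cont
  exact Integrable.of_bound (C := B) (by fun_prop) (Eventually.of_forall fun ξ => h.H.bdd _)

theorem Interactions.norm_conv_sub_le (h : Interactions B K H G) (μ : Measure (Space d))
    [IsProbabilityMeasure μ] (x y : Space d) :
    ‖(∫ ξ, H (x - ξ) ∂μ) - ∫ ξ, H (y - ξ) ∂μ‖ ≤ K * ‖x - y‖ := by
  rw [← integral_sub (h.integrable_conv μ x) (h.integrable_conv μ y)]
  simpa using norm_integral_le_of_norm_le_const (μ := μ)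
    (f := fun ξ => H (x - ξ) - H (y - ξ)) (C := K * ‖x - y‖)
    (Eventually.of_forall fun ξ => h.H.lip_sub _ _ _)

/-- A bound for the velocity field when controls are bounded by `C`. -/
def velBound (d : ℕ) (B C : ℝ) : ℝ := B + d * (C * B)

/-- A Lipschitz constant for the velocity field when controls are bounded by `C`. -/
def velLip (d : ℕ) (K C : ℝ) : ℝ := K + d * (C * K)

theorem Interactions.velBound_nonneg (h : Interactions B K H G) (hC : 0 ≤ C) :
    0 ≤ velBound d B C := by
  have := h.B_nonneg
  unfold velBound; positivity

theorem Interactions.velLip_nonneg (h : Interactions B K H G) (hC : 0 ≤ C) :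
    0 ≤ velLip d K C := by
  have := h.K_nonneg
  unfold velLip; positivity

theorem Interactions.norm_velocity_le (h : Interactions B K H G) (μ : Measure (Space d))
    [IsProbabilityMeasure μ] {u : Leaders m d} (hu : ‖u‖ ≤ C) (Y : Leaders m d) (x : Space d) :
    ‖velocity H G μ Y u x‖ ≤ velBound d B C :=
  (norm_add_le _ _).trans (add_le_add (h.norm_conv_le μ x) (h.norm_leaderField_le hu Y x))

theorem Interactions.norm_velocity_sub_le (h : Interactions B K H G) (μ : Measure (Space d))
    [IsProbabilityMeasure μ] {u : Leaders m d} (hu : ‖u‖ ≤ C) (Y : Leaders m d) (x y : Space d) :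
    ‖velocity H G μ Y u x - velocity H G μ Y u y‖ ≤ velLip d K C * ‖x - y‖ := by
  rw [velocity_eq, velocity_eq, add_sub_add_comm]
  refine (norm_add_le _ _).trans ?_
  have h1 := h.norm_conv_sub_le μ x y
  have h2 := h.norm_leaderField_sub_le hu Y Y x y
  rw [sub_self, norm_zero, add_zero] at h2
  unfold velLip
  linarith

/-- Writing both measures as laws on one probability space makes the convolution Lipschitz in the
pair of random variables, with no optimal transport involved. The fixed point argument, the
stability estimate and the couplings all use this form. -/
theorem Interactions.norm_conv_map_sub_le (h : Interactions B K H G) {Ω : Type*}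
    [MeasurableSpace Ω] {P : Measure Ω} [IsProbabilityMeasure P] {f g : Ω → Space d}
    (hf : Measurable f) (hg : Measurable g) (hfg : Integrable (fun w => ‖f w - g w‖) P)
    (x y : Space d) :
    ‖(∫ ξ, H (x - ξ) ∂(P.map f)) - ∫ ξ, H (y - ξ) ∂(P.map g)‖ ≤
      K * (‖x - y‖ + ∫ w, ‖f w - g w‖ ∂P) := by
  have hHc := h.H.cont
  rw [integral_map hf.aemeasurable (by fun_prop), integral_map hg.aemeasurable (by fun_prop)]
  have i1 : Integrable (fun w => H (x - f w)) P := Integrable.of_bound (C := B)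
    (by have := hHc.measurable; fun_prop) (Eventually.of_forall fun ξ => h.H.bdd _)
  have i2 : Integrable (fun w => H (y - g w)) P := Integrable.of_bound (C := B)
    (by have := hHc.measurable; fun_prop) (Eventually.of_forall fun ξ => h.H.bdd _)
  rw [← integral_sub i1 i2]
  have i3 : Integrable (fun w => K * (‖x - y‖ + ‖f w - g w‖)) P :=
    ((integrable_const _).add hfg).const_mul K
  refine (norm_integral_le_of_norm_le i3 (Eventually.of_forall fun w => ?_)).trans (le_of_eq ?_)
  · refine (h.H.lip _ _).trans ?_
    have := h.K_nonneg
    gcongr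
    rw [sub_sub_sub_comm]
    exact norm_sub_le _ _
  · rw [integral_const_mul, integral_add (integrable_const _) hfg]
    simp

end Velocity

end LeaderFollower
end

noncomputable section

namespace LeaderFollower

/-! ### The characteristic flow -/

section Flow

variable {m d : ℕ} {B K C : ℝ} {H : Space d → Space d} {G : Fin d → Space d → Space d}

/-- A jointly continuous flow of `H * μ(t) + ∑_ℓ G^ℓ * μ_{m,ℓ}(t)`, with `μ(t)` the image
of `μ0`, for nonnegative times. -/
structure IsFlow (H : Space d → Space d) (G : Fin d → Space d → Space d) (u Y : ℝ → Leaders m d)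
    (μ0 : Measure (Space d)) (Φ : ℝ → Space d → Space d) : Prop where
  cont : Continuous fun p : ℝ × Space d => Φ p.1 p.2
  eq : ∀ t, 0 ≤ t → ∀ x, Φ t x = x + ∫ s in (0 : ℝ)..t,
    velocity H G (μ0.map (Φ s)) (Y s) (u s) (Φ s x)

theorem measurable_coord {u : ℝ → Leaders m d} (hu : Measurable u) (k : Fin m) (ℓ : Fin d) :
    Measurable fun s => u s k ℓ := by
  have : Continuous fun v : Leaders m d => v k ℓ := by fun_prop
  exact this.measurable.comp hu

theorem measurable_leaderField (h : Interactions B K H G) {α : Type*} [MeasurableSpace α]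
    {u Y : α → Leaders m d} (hu : Measurable u) (hY : Measurable Y) {x : α → Space d}
    (hx : Measurable x) : Measurable fun p => leaderField G (Y p) (u p) (x p) := by
  unfold leaderField
  refine Finset.measurable_fun_sum _ fun ℓ _ => Measurable.fun_const_smul (Finset.measurable_fun_sum _
    fun k _ => ?_) _
  have h1 : Continuous fun v : Leaders m d => v k ℓ := by fun_prop
  have h2 : Continuous fun v : Leaders m d => v k := by fun_prop
  exact (h1.measurable.comp hu).smul
    ((h.G ℓ).cont.measurable.comp (hx.sub (h2.measurable.comp hY)))

theorem continuous_conv_flow (h : Interactions B K H G) (μ0 : Measure (Space d))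
    [IsProbabilityMeasure μ0] {X : ℝ → Space d → Space d}
    (hX : Continuous fun p : ℝ × Space d => X p.1 p.2) :
    Continuous fun p : ℝ × Space d => ∫ ξ, H (p.2 - ξ) ∂(μ0.map (X p.1)) := by
  have hc := h.H.cont
  have hXs : ∀ s, Continuous (X s) := fun s => hX.comp (by fun_prop : Continuous fun x => (s, x))
  have : (fun p : ℝ × Space d => ∫ ξ, H (p.2 - ξ) ∂(μ0.map (X p.1))) =
      fun p => ∫ ξ, H (p.2 - X p.1 ξ) ∂μ0 := by
    ext1 p
    rw [integral_map (hXs _).measurable.aemeasurable (by fun_prop)]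
  rw [this]
  refine continuous_of_dominated (bound := fun _ => B) (fun p => ?_) (fun p => ?_)
    (integrable_const _) (Eventually.of_forall fun ξ => ?_)
  · have := hXs p.1
    exact (by fun_prop : Continuous fun ξ => H (p.2 - X p.1 ξ)).aestronglyMeasurable
  · exact Eventually.of_forall fun ξ => h.H.bdd _
  · have : Continuous fun p : ℝ × Space d => X p.1 ξ :=
      hX.comp (by fun_prop : Continuous fun p : ℝ × Space d => (p.1, ξ))
    fun_prop

theorem measurable_velocity_flow (h : Interactions B K H G) (μ0 : Measure (Space d))
    [IsProbabilityMeasure μ0] {X : ℝ → Space d → Space d} {u Y : ℝ → Leaders m d}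
    (hX : Continuous fun p : ℝ × Space d => X p.1 p.2) (hu : Measurable u) (hY : Continuous Y) :
    Measurable fun p : ℝ × Space d => velocity H G (μ0.map (X p.1)) (Y p.1) (u p.1) (p.2) :=
  (continuous_conv_flow h μ0 hX).measurable.add
    (measurable_leaderField h (hu.comp measurable_fst) (hY.measurable.comp measurable_fst)
      measurable_snd)

theorem measurable_velocity_flow_comp (h : Interactions B K H G) (μ0 : Measure (Space d))
    [IsProbabilityMeasure μ0] {X : ℝ → Space d → Space d} {u Y : ℝ → Leaders m d}
    (hX : Continuous fun p : ℝ × Space d => X p.1 p.2) (hu : Measurable u) (hY : Continuous Y) :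
    Measurable fun p : ℝ × Space d =>
      velocity H G (μ0.map (X p.1)) (Y p.1) (u p.1) (X p.1 p.2) :=
  (measurable_velocity_flow h μ0 hX hu hY).comp (measurable_fst.prodMk hX.measurable)

theorem Interactions.continuous_velocity (h : Interactions B K H G) (μ : Measure (Space d))
    [IsProbabilityMeasure μ] (Y u : Leaders m d) : Continuous (velocity H G μ Y u) :=
  continuous_of_norm_sub_le fun x y => h.norm_velocity_sub_le μ (le_refl ‖u‖) Y x y

/-- The curves `x + e^{λ t⁺} Z(t, x)`. -/
def expCurve (lam : ℝ) (Z : (ℝ × Space d) →ᵇ Space d) (t : ℝ) (x : Space d) : Space d :=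
  x + Real.exp (lam * max t 0) • Z (t, x)

theorem continuous_expCurve (lam : ℝ) (Z : (ℝ × Space d) →ᵇ Space d) :
    Continuous fun p : ℝ × Space d => expCurve lam Z p.1 p.2 := by
  unfold expCurve
  have := Z.continuous
  fun_prop

/-- The velocity along `expCurve`. -/
def expVel (H : Space d → Space d) (G : Fin d → Space d → Space d) (u Y : ℝ → Leaders m d)
    (μ0 : Measure (Space d)) (lam : ℝ) (Z : (ℝ × Space d) →ᵇ Space d) (x : Space d) (s : ℝ) :
    Space d :=
  velocity H G (μ0.map (expCurve lam Z s)) (Y s) (u s) (expCurve lam Z s x)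

theorem isProbabilityMeasure_map_flow (μ0 : Measure (Space d)) [IsProbabilityMeasure μ0]
    {X : ℝ → Space d → Space d} (hX : Continuous fun p : ℝ × Space d => X p.1 p.2) (s : ℝ) :
    IsProbabilityMeasure (μ0.map (X s)) :=
  Measure.isProbabilityMeasure_map
    (hX.comp (by fun_prop : Continuous fun x => (s, x))).measurable.aemeasurable

variable {u Y : ℝ → Leaders m d} {μ0 : Measure (Space d)} [IsProbabilityMeasure μ0]

theorem norm_expVel_le (h : Interactions B K H G) (hC : ∀ t, ‖u t‖ ≤ C) (lam : ℝ)
    (Z : (ℝ × Space d) →ᵇ Space d) (x : Space d) (s : ℝ) :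
    ‖expVel H G u Y μ0 lam Z x s‖ ≤ velBound d B C := by
  have := isProbabilityMeasure_map_flow μ0 (continuous_expCurve lam Z) s
  exact h.norm_velocity_le _ (hC s) _ _

theorem measurable_expVel (h : Interactions B K H G) (hu : Measurable u) (hY : Continuous Y)
    (lam : ℝ) (Z : (ℝ × Space d) →ᵇ Space d) (x : Space d) :
    Measurable (expVel H G u Y μ0 lam Z x) := by
  have h1 := measurable_velocity_flow_comp h μ0 (continuous_expCurve lam Z) hu hY
  have h2 : Measurable fun s : ℝ => (s, x) := by fun_prop
  have h3 := h1.comp h2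
  simp only [Function.comp_def] at h3
  exact h3

theorem intervalIntegrable_expVel (h : Interactions B K H G) (hu : Measurable u)
    (hC : ∀ t, ‖u t‖ ≤ C) (hY : Continuous Y) (lam : ℝ) (Z : (ℝ × Space d) →ᵇ Space d)
    (x : Space d) (a b : ℝ) :
    IntervalIntegrable (expVel H G u Y μ0 lam Z x) volume a b := by
  rw [intervalIntegrable_iff]
  exact IntegrableOn.of_bound (by simp) (measurable_expVel h hu hY lam Z x).aestronglyMeasurable
    (velBound d B C) (Eventually.of_forall fun s => norm_expVel_le h hC lam Z x s)

/-- One `K` comes from moving the point of evaluation, the other from moving the measure, and `d *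
(C * K)` from the leaders' force. The exponential weight is the factor by which the curves scale `Z
- Z'`. -/
theorem norm_expVel_sub_le (h : Interactions B K H G) (hC : ∀ t, ‖u t‖ ≤ C) (lam : ℝ)
    (Z Z' : (ℝ × Space d) →ᵇ Space d) (x : Space d) (s : ℝ) :
    ‖expVel H G u Y μ0 lam Z x s - expVel H G u Y μ0 lam Z' x s‖ ≤
      (2 * K + d * (C * K)) * (Real.exp (lam * max s 0) * dist Z Z') := by
  have hsub : ∀ y, ‖expCurve lam Z s y - expCurve lam Z' s y‖ ≤
      Real.exp (lam * max s 0) * dist Z Z' := by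
    intro y
    unfold expCurve
    rw [add_sub_add_left_eq_sub, ← smul_sub, norm_smul, Real.norm_of_nonneg (Real.exp_pos _).le,
      ← dist_eq_norm]
    gcongr
    exact BoundedContinuousFunction.dist_coe_le_dist _
  have hm : ∀ W : (ℝ × Space d) →ᵇ Space d, Continuous (expCurve lam W s) := fun W =>
    (continuous_expCurve lam W).comp (by fun_prop : Continuous fun x => (s, x))
  have hi : Integrable (fun y => ‖expCurve lam Z s y - expCurve lam Z' s y‖) μ0 := by
    refine Integrable.of_bound ((hm Z).sub (hm Z')).norm.aestronglyMeasurable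
      (Real.exp (lam * max s 0) * dist Z Z') (Eventually.of_forall fun y => ?_)
    rw [norm_norm]; exact hsub y
  have hi' : ∫ y, ‖expCurve lam Z s y - expCurve lam Z' s y‖ ∂μ0 ≤
      Real.exp (lam * max s 0) * dist Z Z' := by
    refine (integral_mono hi (integrable_const _) hsub).trans (by simp)
  unfold expVel
  rw [velocity_eq, velocity_eq, add_sub_add_comm]
  refine (norm_add_le _ _).trans ?_
  have h1 := h.norm_conv_map_sub_le (hm Z).measurable (hm Z').measurable hi
    (expCurve lam Z s x) (expCurve lam Z' s x)
  have h2 := h.norm_leaderField_sub_le (hC s) (Y s) (Y s)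
    (expCurve lam Z s x) (expCurve lam Z' s x)
  rw [sub_self, norm_zero, add_zero] at h2
  have hK := h.K_nonneg
  have hC0 : 0 ≤ C := (norm_nonneg _).trans (hC 0)
  have h3 := hsub x
  set D := Real.exp (lam * max s 0) * dist Z Z'
  have h4 : K * (‖expCurve lam Z s x - expCurve lam Z' s x‖ +
      ∫ y, ‖expCurve lam Z s y - expCurve lam Z' s y‖ ∂μ0) ≤ K * (D + D) := by gcongr
  have h5 : d * (C * (K * ‖expCurve lam Z s x - expCurve lam Z' s x‖)) ≤ d * (C * (K * D)) := by
    gcongr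
  linarith

theorem integral_exp_mul_le {lam t : ℝ} (hlam : 0 < lam) (ht : 0 ≤ t) :
    ∫ s in (0 : ℝ)..t, Real.exp (lam * max s 0) ≤ lam⁻¹ * Real.exp (lam * t) := by
  have h1 : ∫ s in (0 : ℝ)..t, Real.exp (lam * max s 0) =
      ∫ s in (0 : ℝ)..t, Real.exp (lam * s) := by
    refine intervalIntegral.integral_congr fun s hs => ?_
    rw [uIcc_of_le ht] at hs
    simp [hs.1]
  rw [h1, intervalIntegral.integral_comp_mul_left (fun s => Real.exp s) hlam.ne', integral_exp,
    smul_eq_mul]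
  gcongr
  have := Real.exp_pos (lam * 0)
  linarith

/-- The field at time `s` depends on the positions of all particles, so the unknown is the whole map
`(t, x) ↦ Φ t x`. The exponential weight makes the Picard map a contraction on all nonnegative times
at once. -/
theorem exists_isFlow (h : Interactions B K H G) (hu : Measurable u) (hC : ∀ t, ‖u t‖ ≤ C)
    (hY : Continuous Y) : ∃ Φ, IsFlow H G u Y μ0 Φ := by
  have hC0 : 0 ≤ C := (norm_nonneg _).trans (hC 0)
  have hK := h.K_nonneg
  have hV := h.velBound_nonneg hC0
  set Λ : ℝ := 2 * K + d * (C * K) with hΛ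
  have hΛ0 : 0 ≤ Λ := by positivity
  -- This gives `Λ / lam ≤ 1 / 2`, which is the contraction, and `lam ≥ 1`, which bounds `t * exp
  -- (-(lam * t))` by `1` and keeps the Picard map inside the bounded functions.
  set lam : ℝ := 2 * Λ + 1 with hlam
  have hlam0 : 0 < lam := by positivity
  have hlam1 : 1 ≤ lam := by linarith
  -- The unknown is `Z = e^{-λ t⁺} (Φ - id)`, which is bounded although `Φ` is not. Replacing `t` by
  -- `max t 0` makes the flow stationary at negative times.
  let f (Z : (ℝ × Space d) →ᵇ Space d) (p : ℝ × Space d) : Space d :=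
    Real.exp (-(lam * max p.1 0)) • ∫ s in (0 : ℝ)..max p.1 0, expVel H G u Y μ0 lam Z p.2 s
  have hfc : ∀ Z, Continuous (f Z) := by
    intro Z
    have h1 : Continuous fun q : Space d × ℝ =>
        ∫ s in (0 : ℝ)..q.2, expVel H G u Y μ0 lam Z q.1 s := by
      rw [continuous_iff_continuousAt]
      rintro ⟨x, t⟩
      refine intervalIntegral.continuousAt_parametric_primitive_of_dominated
        (F := fun x s => expVel H G u Y μ0 lam Z x s) (bound := fun _ => velBound d B C)
        (a := min 0 t - 1) (b := max 0 t + 1) (a₀ := 0) (b₀ := t) ?_ ?_ ?_ ?_ ?_ ?_ ?_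
      · exact fun y => (measurable_expVel h hu hY lam Z y).aestronglyMeasurable
      · exact Eventually.of_forall fun y => Eventually.of_forall fun s => norm_expVel_le h hC _ _ _ _
      · exact intervalIntegrable_const
      · refine Eventually.of_forall fun s => Continuous.continuousAt ?_
        have := isProbabilityMeasure_map_flow μ0 (continuous_expCurve lam Z) s
        exact (h.continuous_velocity _ _ _).comp
          ((continuous_expCurve lam Z).comp (by fun_prop : Continuous fun x => (s, x)))
      · constructor <;> [linarith [min_le_left 0 t]; linarith [le_max_left 0 t]]
      · constructor <;> [linarith [min_le_right 0 t]; linarith [le_max_right 0 t]]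
      · simp
    exact (by fun_prop : Continuous fun p : ℝ × Space d => Real.exp (-(lam * max p.1 0))).smul
      (h1.comp (by fun_prop : Continuous fun p : ℝ × Space d => (p.2, max p.1 0)))
  have hexp : ∀ t : ℝ, 0 ≤ t → t * Real.exp (-(lam * t)) ≤ 1 := by
    intro t ht
    rw [Real.exp_neg, ← div_eq_mul_inv, div_le_one (Real.exp_pos _)]
    nlinarith [Real.add_one_le_exp (lam * t)]
  have hfb : ∀ Z p, ‖f Z p‖ ≤ velBound d B C := by
    intro Z p
    have h0 : (0 : ℝ) ≤ max p.1 0 := le_max_right _ _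
    simp only [f]
    rw [norm_smul, Real.norm_of_nonneg (Real.exp_pos _).le]
    have := intervalIntegral.norm_integral_le_of_norm_le_const (a := 0) (b := max p.1 0)
      (f := expVel H G u Y μ0 lam Z p.2) (C := velBound d B C)
      (fun s _ => norm_expVel_le h hC _ _ _ _)
    rw [sub_zero, abs_of_nonneg h0] at this
    calc _ ≤ Real.exp (-(lam * max p.1 0)) * (velBound d B C * max p.1 0) := by gcongr
      _ = velBound d B C * (max p.1 0 * Real.exp (-(lam * max p.1 0))) := by ring
      _ ≤ velBound d B C * 1 := by gcongr; exact hexp _ h0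
      _ = _ := mul_one _
  let Ψ (Z : (ℝ × Space d) →ᵇ Space d) : (ℝ × Space d) →ᵇ Space d :=
    BoundedContinuousFunction.ofNormedAddCommGroup (f Z) (hfc Z) _ (hfb Z)
  have hΨ : ContractingWith (1 / 2) Ψ := by
    refine ⟨by norm_num, LipschitzWith.of_dist_le_mul fun Z Z' => ?_⟩
    refine (BoundedContinuousFunction.dist_le (by positivity)).2 fun p => ?_
    have h0 : (0 : ℝ) ≤ max p.1 0 := le_max_right _ _
    change dist (f Z p) (f Z' p) ≤ _
    simp only [f]
    rw [dist_eq_norm, ← smul_sub, norm_smul, Real.norm_of_nonneg (Real.exp_pos _).le,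
      ← intervalIntegral.integral_sub (intervalIntegrable_expVel h hu hC hY _ _ _ _ _)
        (intervalIntegrable_expVel h hu hC hY _ _ _ _ _)]
    have h1 := intervalIntegral.norm_integral_le_of_norm_le h0
      (f := fun s => expVel H G u Y μ0 lam Z p.2 s - expVel H G u Y μ0 lam Z' p.2 s)
      (g := fun s => Λ * (Real.exp (lam * max s 0) * dist Z Z')) (μ := volume)
      (Eventually.of_forall fun s _ => norm_expVel_sub_le h hC _ _ _ _ _)
      ((by fun_prop : Continuous fun s : ℝ =>
        Λ * (Real.exp (lam * max s 0) * dist Z Z')).intervalIntegrable _ _)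
    rw [intervalIntegral.integral_const_mul, intervalIntegral.integral_mul_const] at h1
    have h2 := integral_exp_mul_le hlam0 h0
    have h3 : Λ * lam⁻¹ ≤ 1 / 2 := by
      rw [← div_eq_mul_inv, div_le_iff₀ hlam0]; linarith
    calc _ ≤ Real.exp (-(lam * max p.1 0)) *
          (Λ * ((lam⁻¹ * Real.exp (lam * max p.1 0)) * dist Z Z')) := by
            gcongr
            refine h1.trans ?_
            gcongr
      _ = (Real.exp (-(lam * max p.1 0)) * Real.exp (lam * max p.1 0)) *
          ((Λ * lam⁻¹) * dist Z Z') := by ring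
      _ = (Λ * lam⁻¹) * dist Z Z' := by rw [← Real.exp_add]; simp
      _ ≤ (1 / 2) * dist Z Z' := by gcongr
      _ = _ := by simp
  set Z := hΨ.fixedPoint Ψ with hZdef
  have hZ : Ψ Z = Z := hΨ.fixedPoint_isFixedPt
  refine ⟨expCurve lam Z, continuous_expCurve lam Z, fun t ht x => ?_⟩
  have h1 : Z (t, x) = f Z (t, x) := by
    conv_lhs => rw [← hZ]
    rfl
  change x + _ = x + _
  rw [h1]
  simp only [f, max_eq_left ht]
  rw [smul_smul, ← Real.exp_add]
  simp [expVel]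

end Flow

end LeaderFollower
end

noncomputable section

namespace LeaderFollower

/-! ### Functions with bounded and Lipschitz derivative -/

section C11

variable {d : ℕ} {F : Type*} [NormedAddCommGroup F] [NormedSpace ℝ F]

/-- Differentiable functions whose derivative is bounded by `A` and Lipschitz with constant `M`. -/
structure C11 (A M : ℝ) (g : Space d → F) : Prop where
  diff : Differentiable ℝ g
  bdd : ∀ x, ‖fderiv ℝ g x‖ ≤ A
  lip : ∀ x y, ‖fderiv ℝ g x - fderiv ℝ g y‖ ≤ M * ‖x - y‖
  M_nonneg : 0 ≤ M

namespace C11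

variable {A M : ℝ} {g : Space d → F}

theorem A_nonneg (h : C11 A M g) : 0 ≤ A := (norm_nonneg _).trans (h.bdd 0)

theorem norm_sub_le (h : C11 A M g) (x y : Space d) : ‖g x - g y‖ ≤ A * ‖x - y‖ :=
  Convex.norm_image_sub_le_of_norm_fderiv_le (𝕜 := ℝ) (s := univ) (fun z _ => h.diff z)
    (fun z _ => h.bdd z) convex_univ (mem_univ _) (mem_univ _)

theorem continuous_fderiv (h : C11 A M g) : Continuous (fderiv ℝ g) :=
  continuous_of_norm_sub_le h.lip

theorem taylor (h : C11 A M g) (x y : Space d) :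
    ‖g y - g x - fderiv ℝ g x (y - x)‖ ≤ M * ‖y - x‖ ^ 2 := by
  have hM := h.M_nonneg
  have := Convex.norm_image_sub_le_of_norm_hasFDerivWithin_le' (𝕜 := ℝ) (f := g)
    (f' := fderiv ℝ g) (φ := fderiv ℝ g x)
    (s := Metric.closedBall x ‖y - x‖) (C := M * ‖y - x‖) (x := x) (y := y)
    (fun z _ => (h.diff z).hasFDerivAt.hasFDerivWithinAt) (fun z hz => ?_)
    (convex_closedBall _ _) (Metric.mem_closedBall_self (norm_nonneg _)) (by simp [dist_eq_norm])
  · refine this.trans (le_of_eq (by ring))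
  · refine (h.lip z x).trans ?_
    gcongr
    rwa [← dist_eq_norm]

theorem norm_apply_sub_le (h : C11 A M g) {B K : ℝ} {b : Space d → Space d}
    (hb : ∀ x, ‖b x‖ ≤ B) (hK : ∀ x y, ‖b x - b y‖ ≤ K * ‖x - y‖) (x y : Space d) :
    ‖fderiv ℝ g x (b x) - fderiv ℝ g y (b y)‖ ≤ (M * B + A * K) * ‖x - y‖ := by
  have h1 : fderiv ℝ g x (b x) - fderiv ℝ g y (b y) =
      (fderiv ℝ g x - fderiv ℝ g y) (b x) + fderiv ℝ g y (b x - b y) := by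
    simp
  have hM := h.M_nonneg
  have hA := h.A_nonneg
  rw [h1]
  refine (norm_add_le _ _).trans ?_
  have h2 := (fderiv ℝ g x - fderiv ℝ g y).le_opNorm (b x)
  have h3 := (fderiv ℝ g y).le_opNorm (b x - b y)
  have h4 : ‖fderiv ℝ g x - fderiv ℝ g y‖ * ‖b x‖ ≤ (M * ‖x - y‖) * B :=
    mul_le_mul (h.lip x y) (hb x) (norm_nonneg _) (by positivity)
  have h5 : ‖fderiv ℝ g y‖ * ‖b x - b y‖ ≤ A * (K * ‖x - y‖) :=
    mul_le_mul (h.bdd y) (hK x y) (norm_nonneg _) hA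
  linarith

end C11

theorem exists_c11_of_contDiff {φ : Space d → F} (h : ContDiff ℝ ∞ φ) (hc : HasCompactSupport φ) :
    ∃ A M, C11 A M φ := by
  have h1 : ContDiff ℝ 1 (fderiv ℝ φ) := h.fderiv_right (by norm_cast)
  have hc1 : HasCompactSupport (fderiv ℝ φ) := hc.fderiv (𝕜 := ℝ)
  obtain ⟨A, hA⟩ := hc1.exists_bound_of_continuous h1.continuous
  obtain ⟨M, hM⟩ := h1.lipschitzWith_of_hasCompactSupport hc1 (by simp)
  refine ⟨A, M, h.differentiable (by simp), hA, fun x y => ?_, M.2⟩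
  simpa [dist_eq_norm] using hM.dist_le_mul x y

/-- The chain rule along a Lipschitz curve. -/
theorem C11.comp_primitive [CompleteSpace F] {A M : ℝ} {g : Space d → F} (h : C11 A M g)
    {f : ℝ → Space d}
    {V : ℝ} (hf : Measurable f) (hV : ∀ s, ‖f s‖ ≤ V) (x : Space d) (t : ℝ) :
    g (x + ∫ s in (0 : ℝ)..t, f s) = g x +
      ∫ s in (0 : ℝ)..t, fderiv ℝ g (x + ∫ r in (0 : ℝ)..s, f r) (f s) := by
  have hV0 : 0 ≤ V := (norm_nonneg _).trans (hV 0)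
  have hM := h.M_nonneg
  have hA := h.A_nonneg
  have hfi : ∀ a b, IntervalIntegrable f volume a b := fun a b => by
    rw [intervalIntegrable_iff]
    exact IntegrableOn.of_bound (by simp) hf.aestronglyMeasurable V (Eventually.of_forall hV)
  set X : ℝ → Space d := fun t => x + ∫ s in (0 : ℝ)..t, f s with hX
  have hXd : ∀ a b, X b - X a = ∫ s in a..b, f s := fun a b => by
    simp only [hX, add_sub_add_left_eq_sub]
    exact intervalIntegral.integral_interval_sub_left (hfi _ _) (hfi _ _)
  have hXl : ∀ a b, ‖X b - X a‖ ≤ V * |b - a| := fun a b => by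
    rw [hXd]
    exact intervalIntegral.norm_integral_le_of_norm_le_const fun s _ => hV s
  have hXc : Continuous X := continuous_of_norm_sub_le fun a b => by
    rw [Real.norm_eq_abs]; exact hXl b a
  have hDm : AEStronglyMeasurable (fun s => fderiv ℝ g (X s) (f s)) volume :=
    isBoundedBilinearMap_apply.continuous.comp_aestronglyMeasurable
      ((h.continuous_fderiv.comp hXc).aestronglyMeasurable.prodMk hf.aestronglyMeasurable)
  have hDb : ∀ s, ‖fderiv ℝ g (X s) (f s)‖ ≤ A * V := fun s =>
    ((fderiv ℝ g (X s)).le_opNorm _).trans (mul_le_mul (h.bdd _) (hV s) (norm_nonneg _) hA)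
  have hDi : ∀ a b, IntervalIntegrable (fun s => fderiv ℝ g (X s) (f s)) volume a b :=
    fun a b => by
      rw [intervalIntegrable_iff]
      exact IntegrableOn.of_bound (by simp) hDm.restrict _ (Eventually.of_forall hDb)
  -- The velocity `f` is only measurable, so `X` need not be differentiable at every time. The
  -- defect `D` nevertheless has increments of quadratic size: the first-order terms cancel after
  -- integration, leaving the Taylor remainder and the variation of `fderiv ℝ g` along `X`. Hence
  -- `D` has zero derivative everywhere.
  set D : ℝ → F := fun t => g (X t) - ∫ s in (0 : ℝ)..t, fderiv ℝ g (X s) (f s) with hD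
  have key : ∀ a b, ‖D b - D a‖ ≤ 2 * M * V ^ 2 * |b - a| ^ 2 := by
    intro a b
    have e1 : D b - D a = (g (X b) - g (X a) - fderiv ℝ g (X a) (X b - X a)) -
        ∫ s in a..b, (fderiv ℝ g (X s) - fderiv ℝ g (X a)) (f s) := by
      have e2 : ∫ s in a..b, (fderiv ℝ g (X s) - fderiv ℝ g (X a)) (f s) =
          (∫ s in a..b, fderiv ℝ g (X s) (f s)) - fderiv ℝ g (X a) (X b - X a) := by
        rw [hXd, ← ContinuousLinearMap.intervalIntegral_comp_comm _ (hfi a b),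
          ← intervalIntegral.integral_sub (hDi a b)]
        · simp
        · exact ⟨(fderiv ℝ g (X a)).integrable_comp (hfi a b).1,
            (fderiv ℝ g (X a)).integrable_comp (hfi a b).2⟩
      have e3 := intervalIntegral.integral_interval_sub_left (hDi 0 b) (hDi 0 a)
      rw [e2, ← e3]
      simp only [hD]
      abel
    rw [e1]
    refine (_root_.norm_sub_le _ _).trans ?_
    have h1 : ‖g (X b) - g (X a) - fderiv ℝ g (X a) (X b - X a)‖ ≤ M * (V * |b - a|) ^ 2 :=
      (h.taylor _ _).trans (by gcongr; exact hXl _ _)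
    have h2 : ‖∫ s in a..b, (fderiv ℝ g (X s) - fderiv ℝ g (X a)) (f s)‖ ≤
        (M * (V * |b - a|) * V) * |b - a| := by
      refine intervalIntegral.norm_integral_le_of_norm_le_const fun s hs => ?_
      refine (ContinuousLinearMap.le_opNorm _ _).trans ?_
      refine mul_le_mul ((h.lip _ _).trans ?_) (hV s) (norm_nonneg _) (by positivity)
      gcongr
      refine (hXl _ _).trans ?_
      gcongr 1
      exact abs_sub_left_of_mem_uIcc (uIoc_subset_uIcc hs)
    refine (add_le_add h1 h2).trans (le_of_eq (by ring))
  have hder : ∀ a, HasDerivAt D 0 a := by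
    intro a
    rw [hasDerivAt_iff_isLittleO]
    simp only [smul_zero, sub_zero]
    refine Asymptotics.IsBigO.trans_isLittleO (g := fun b => ‖b - a‖ ^ 2) ?_ ?_
    · refine Asymptotics.IsBigO.of_bound (2 * M * V ^ 2) (Eventually.of_forall fun b => ?_)
      rw [norm_pow, norm_norm]
      exact key a b
    · exact Asymptotics.isLittleO_pow_sub_sub a (by norm_num)
  have hconst := is_const_of_deriv_eq_zero (fun a => (hder a).differentiableAt)
    (fun a => (hder a).deriv) t 0
  simp only [hD, hX, intervalIntegral.integral_same, add_zero, sub_zero] at hconst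
  exact sub_eq_iff_eq_add.1 hconst

end C11

/-! ### The flow solves the mean-field system -/

section FlowSol

variable {m d : ℕ} {B K C : ℝ} {H : Space d → Space d} {G : Fin d → Space d → Space d}
  {u Y : ℝ → Leaders m d} {μ0 : Measure (Space d)} [IsProbabilityMeasure μ0]
  {Φ : ℝ → Space d → Space d}

omit [IsProbabilityMeasure μ0] in
theorem IsFlow.continuous (hΦ : IsFlow H G u Y μ0 Φ) (t : ℝ) : Continuous (Φ t) :=
  hΦ.cont.comp (by fun_prop : Continuous fun x => (t, x))

omit [IsProbabilityMeasure μ0] in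
theorem IsFlow.continuous_left (hΦ : IsFlow H G u Y μ0 Φ) (x : Space d) :
    Continuous fun t => Φ t x :=
  hΦ.cont.comp (by fun_prop : Continuous fun t => (t, x))

omit [IsProbabilityMeasure μ0] in
theorem IsFlow.zero (hΦ : IsFlow H G u Y μ0 Φ) (x : Space d) : Φ 0 x = x := by
  simpa using hΦ.eq 0 le_rfl x

theorem IsFlow.prob (hΦ : IsFlow H G u Y μ0 Φ) (t : ℝ) : IsProbabilityMeasure (μ0.map (Φ t)) :=
  isProbabilityMeasure_map_flow μ0 hΦ.cont t

theorem IsFlow.norm_vel_le (hΦ : IsFlow H G u Y μ0 Φ) (h : Interactions B K H G)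
    (hC : ∀ t, ‖u t‖ ≤ C) (s : ℝ) (x : Space d) :
    ‖velocity H G (μ0.map (Φ s)) (Y s) (u s) x‖ ≤ velBound d B C := by
  have := hΦ.prob s
  exact h.norm_velocity_le _ (hC s) _ _

theorem IsFlow.measurable_vel (hΦ : IsFlow H G u Y μ0 Φ) (h : Interactions B K H G)
    (hu : Measurable u) (hY : Continuous Y) (x : Space d) :
    Measurable fun s => velocity H G (μ0.map (Φ s)) (Y s) (u s) (Φ s x) := by
  have h1 := measurable_velocity_flow_comp h μ0 hΦ.cont hu hY
  have h2 : Measurable fun s : ℝ => (s, x) := by fun_prop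
  have h3 := h1.comp h2
  simp only [Function.comp_def] at h3
  exact h3

theorem IsFlow.intervalIntegrable_vel (hΦ : IsFlow H G u Y μ0 Φ) (h : Interactions B K H G)
    (hu : Measurable u) (hC : ∀ t, ‖u t‖ ≤ C) (hY : Continuous Y) (x : Space d) (a b : ℝ) :
    IntervalIntegrable (fun s => velocity H G (μ0.map (Φ s)) (Y s) (u s) (Φ s x)) volume a b := by
  rw [intervalIntegrable_iff]
  exact IntegrableOn.of_bound (by simp) (hΦ.measurable_vel h hu hY x).aestronglyMeasurable
    (velBound d B C) (Eventually.of_forall fun s => hΦ.norm_vel_le h hC s _)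

theorem IsFlow.norm_sub_le (hΦ : IsFlow H G u Y μ0 Φ) (h : Interactions B K H G)
    (hu : Measurable u) (hC : ∀ t, ‖u t‖ ≤ C) (hY : Continuous Y) {s t : ℝ} (hs : 0 ≤ s)
    (ht : 0 ≤ t) (x : Space d) : ‖Φ t x - Φ s x‖ ≤ velBound d B C * |t - s| := by
  rw [hΦ.eq t ht, hΦ.eq s hs, add_sub_add_left_eq_sub,
    intervalIntegral.integral_interval_sub_left (hΦ.intervalIntegrable_vel h hu hC hY x _ _)
      (hΦ.intervalIntegrable_vel h hu hC hY x _ _)]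
  exact intervalIntegral.norm_integral_le_of_norm_le_const fun s _ => hΦ.norm_vel_le h hC s _

theorem IsFlow.norm_le (hΦ : IsFlow H G u Y μ0 Φ) (h : Interactions B K H G)
    (hu : Measurable u) (hC : ∀ t, ‖u t‖ ≤ C) (hY : Continuous Y) {t T : ℝ}
    (ht : t ∈ Icc 0 T) (x : Space d) : ‖Φ t x‖ ≤ ‖x‖ + velBound d B C * T := by
  have h1 := hΦ.norm_sub_le h hu hC hY le_rfl ht.1 x
  rw [hΦ.zero, sub_zero, abs_of_nonneg ht.1] at h1
  have hC0 : 0 ≤ C := (norm_nonneg _).trans (hC 0)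
  have h2 : velBound d B C * t ≤ velBound d B C * T :=
    mul_le_mul_of_nonneg_left ht.2 (h.velBound_nonneg hC0)
  have h3 := norm_le_norm_add_norm_sub x (Φ t x)
  rw [norm_sub_rev] at h3
  linarith

theorem IsFlow.suppIn (hΦ : IsFlow H G u Y μ0 Φ) (h : Interactions B K H G)
    (hu : Measurable u) (hC : ∀ t, ‖u t‖ ≤ C) (hY : Continuous Y) {t T R : ℝ}
    (ht : t ∈ Icc 0 T) (hR : SuppIn R μ0) :
    SuppIn (R + velBound d B C * T) (μ0.map (Φ t)) := by
  refine suppIn_of_ae ?_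
  rw [ae_map_iff (hΦ.continuous t).measurable.aemeasurable
    (measurableSet_le measurable_norm measurable_const)]
  filter_upwards [hR.ae_norm_le] with x hx
  have := hΦ.norm_le h hu hC hY ht x
  linarith

theorem IsFlow.W1_le (hΦ : IsFlow H G u Y μ0 Φ) (h : Interactions B K H G)
    (hu : Measurable u) (hC : ∀ t, ‖u t‖ ≤ C) (hY : Continuous Y) {s t : ℝ} (hs : 0 ≤ s)
    (ht : 0 ≤ t) :
    W1 (μ0.map (Φ t)) (μ0.map (Φ s)) ≤ ENNReal.ofReal (velBound d B C * |t - s|) := by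
  refine (W1_map_le μ0 (hΦ.continuous t).measurable (hΦ.continuous s).measurable).trans ?_
  refine (lintegral_mono fun x => ENNReal.ofReal_le_ofReal
    (hΦ.norm_sub_le h hu hC hY hs ht x)).trans (by simp)

/-- The chain rule along each trajectory is integrated over the starting point, and Fubini's theorem
exchanges space and time. -/
theorem IsFlow.weak_form (hΦ : IsFlow H G u Y μ0 Φ) (h : Interactions B K H G)
    (hu : Measurable u) (hC : ∀ t, ‖u t‖ ≤ C) (hY : Continuous Y) {R : ℝ} (hR : SuppIn R μ0)
    {A M : ℝ} {φ : Space d → ℝ} (hφ : C11 A M φ) {t : ℝ} (ht : 0 ≤ t) :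
    ∫ x, φ x ∂(μ0.map (Φ t)) = ∫ x, φ x ∂μ0 + ∫ s in (0 : ℝ)..t, ∫ x, fderiv ℝ φ x
      (velocity H G (μ0.map (Φ s)) (Y s) (u s) x) ∂(μ0.map (Φ s)) := by
  have hφc := hφ.diff.continuous
  have hA := hφ.A_nonneg
  have hP0 : InP1 μ0 := InP1.of_suppIn hR
  have hvel : ∀ s, Continuous (velocity H G (μ0.map (Φ s)) (Y s) (u s)) := fun s => by
    have := hΦ.prob s
    exact h.continuous_velocity _ _ _
  have e1 : ∀ s, ∫ x, fderiv ℝ φ x (velocity H G (μ0.map (Φ s)) (Y s) (u s) x) ∂(μ0.map (Φ s)) =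
      ∫ x, fderiv ℝ φ (Φ s x) (velocity H G (μ0.map (Φ s)) (Y s) (u s) (Φ s x)) ∂μ0 := fun s => by
    rw [integral_map (hΦ.continuous s).measurable.aemeasurable]
    exact (hφ.continuous_fderiv.clm_apply (hvel s)).aestronglyMeasurable
  simp only [e1]
  rw [integral_map (hΦ.continuous t).measurable.aemeasurable hφc.aestronglyMeasurable]
  have e2 : ∀ x, φ (Φ t x) = φ x + ∫ s in (0 : ℝ)..t,
      fderiv ℝ φ (Φ s x) (velocity H G (μ0.map (Φ s)) (Y s) (u s) (Φ s x)) := fun x => by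
    have := hφ.comp_primitive (hΦ.measurable_vel h hu hY x)
      (fun s => hΦ.norm_vel_le h hC s (Φ s x)) x t
    rw [← hΦ.eq t ht] at this
    rw [this]
    congr 1
    refine intervalIntegral.integral_congr fun s hs => ?_
    rw [uIcc_of_le ht] at hs
    rw [← hΦ.eq s hs.1]
  have hm : Measurable fun p : Space d × ℝ =>
      fderiv ℝ φ (Φ p.2 p.1) (velocity H G (μ0.map (Φ p.2)) (Y p.2) (u p.2) (Φ p.2 p.1)) := by
    have h1 := (measurable_velocity_flow_comp h μ0 hΦ.cont hu hY).comp measurable_swap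
    simp only [Function.comp_def, Prod.fst_swap, Prod.snd_swap] at h1
    have h2 : Measurable fun p : Space d × ℝ => fderiv ℝ φ (Φ p.2 p.1) :=
      (hφ.continuous_fderiv.comp (hΦ.cont.comp continuous_swap)).measurable
    exact (isBoundedBilinearMap_apply.continuous.comp_stronglyMeasurable
      (h2.stronglyMeasurable.prodMk h1.stronglyMeasurable)).measurable
  have hb : ∀ p : Space d × ℝ, ‖fderiv ℝ φ (Φ p.2 p.1)
      (velocity H G (μ0.map (Φ p.2)) (Y p.2) (u p.2) (Φ p.2 p.1))‖ ≤ A * velBound d B C :=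
    fun p => (ContinuousLinearMap.le_opNorm _ _).trans
      (mul_le_mul (hφ.bdd _) (hΦ.norm_vel_le h hC _ _) (norm_nonneg _) hA)
  have hi : Integrable (fun p : Space d × ℝ => fderiv ℝ φ (Φ p.2 p.1)
      (velocity H G (μ0.map (Φ p.2)) (Y p.2) (u p.2) (Φ p.2 p.1)))
      (μ0.prod (volume.restrict (Ioc 0 t))) :=
    Integrable.of_bound hm.aestronglyMeasurable _ (Eventually.of_forall hb)
  simp only [e2]
  rw [integral_add (hP0.integrable_of_lipschitz hφ.norm_sub_le)]
  · congr 1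
    simp only [intervalIntegral.integral_of_le ht]
    exact integral_integral_swap hi
  · simp only [intervalIntegral.integral_of_le ht]
    exact hi.integral_prod_left

/-- The leaders' path driven by `u`. -/
def leaderPath (u : ℝ → Leaders m d) (Y0 : Leaders m d) (t : ℝ) : Leaders m d :=
  fun k => Y0 k + ∫ s in (0 : ℝ)..t, u s k

omit [IsProbabilityMeasure μ0] in
theorem norm_leaderPath_sub_le (hu : Measurable u) (hC : ∀ t, ‖u t‖ ≤ C) (Y0 : Leaders m d)
    (s t : ℝ) : ‖leaderPath u Y0 t - leaderPath u Y0 s‖ ≤ C * |t - s| := by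
  have hC0 : 0 ≤ C := (norm_nonneg _).trans (hC 0)
  refine (pi_norm_le_iff_of_nonneg (by positivity)).2 fun k => ?_
  have hi : ∀ a b, IntervalIntegrable (fun s => u s k) volume a b := fun a b => by
    rw [intervalIntegrable_iff]
    exact IntegrableOn.of_bound (by simp)
      ((measurable_pi_apply k).comp hu).aestronglyMeasurable C
      (Eventually.of_forall fun s => (norm_le_pi_norm (u s) k).trans (hC s))
  simp only [leaderPath, Pi.sub_apply, add_sub_add_left_eq_sub]
  rw [intervalIntegral.integral_interval_sub_left (hi _ _) (hi _ _)]
  exact intervalIntegral.norm_integral_le_of_norm_le_const fun s _ =>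
    (norm_le_pi_norm (u s) k).trans (hC s)

theorem continuous_leaderPath (hu : Measurable u) (hC : ∀ t, ‖u t‖ ≤ C) (Y0 : Leaders m d) :
    Continuous (leaderPath u Y0) :=
  continuous_of_norm_sub_le fun s t => norm_leaderPath_sub_le hu hC Y0 t s

theorem IsFlow.isMeanFieldSol {T : ℝ} {Y0 : Leaders m d} (h : Interactions B K H G)
    (hu : Measurable u) (hC : ∀ t, ‖u t‖ ≤ C)
    (hΦ : IsFlow H G u (leaderPath u Y0) μ0 Φ) {R : ℝ} (hR : SuppIn R μ0) :
    IsMeanFieldSol T H G u Y0 μ0 (leaderPath u Y0) (fun t => μ0.map (Φ t)) := by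
  have hY := continuous_leaderPath hu hC Y0
  refine ⟨fun t ht => ?_, ⟨_, fun t ht => hΦ.suppIn h hu hC hY ht hR⟩, hY.continuousOn,
    fun t ht => ?_, fun t _ k => rfl, ?_, fun φ hφ hφc t ht => ?_⟩
  · have := hΦ.prob t
    exact InP1.of_suppIn (hΦ.suppIn h hu hC hY ht hR)
  · refine tendsto_of_tendsto_of_tendsto_of_le_of_le' tendsto_const_nhds
      (h := fun s => ENNReal.ofReal (velBound d B C * |s - t|)) ?_
      (Eventually.of_forall fun _ => zero_le)
      (eventually_nhdsWithin_of_forall fun s hs => hΦ.W1_le h hu hC hY ht.1 hs.1)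
    have : Continuous fun s => ENNReal.ofReal (velBound d B C * |s - t|) :=
      ENNReal.continuous_ofReal.comp (by fun_prop)
    simpa using this.continuousWithinAt (s := Icc 0 T) (x := t) |>.tendsto
  · have : Φ 0 = id := funext fun x => hΦ.zero x
    rw [this, Measure.map_id]
  · obtain ⟨A, M, hAM⟩ := exists_c11_of_contDiff hφ hφc
    exact hΦ.weak_form h hu hC hY hR hAM ht.1

end FlowSol

end LeaderFollower
end

noncomputable section

namespace LeaderFollower

/-! ### Uniqueness for the continuity equation -/

section Transport

variable {d : ℕ}

/-- Bounded time-dependent vector fields, Lipschitz in space. -/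
structure Field (V κ : ℝ) (b : ℝ → Space d → Space d) : Prop where
  meas : Measurable (Function.uncurry b)
  bdd : ∀ s x, ‖b s x‖ ≤ V
  lip : ∀ s x y, ‖b s x - b s y‖ ≤ κ * ‖x - y‖
  V_nonneg : 0 ≤ V
  κ_nonneg : 0 ≤ κ

/-- Curves of measures with supports in one ball that solve `∂_t μ + ∇·(b μ) = 0` on `[0, T]`. -/
structure Transported (T R : ℝ) (b : ℝ → Space d → Space d) (μ : ℝ → Measure (Space d)) :
    Prop where
  inP1 : ∀ s, InP1 (μ s)
  supp : ∀ s, SuppIn R (μ s)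
  meas : ∀ (A M : ℝ) (g : Space d → ℝ), C11 A M g →
    Measurable fun s => ∫ x, fderiv ℝ g x (b s x) ∂(μ s)
  weak : ∀ φ : Space d → ℝ, ContDiff ℝ ∞ φ → HasCompactSupport φ → ∀ t ∈ Icc 0 T,
    ∫ x, φ x ∂(μ t) = ∫ x, φ x ∂(μ 0) + ∫ s in (0 : ℝ)..t, ∫ x, fderiv ℝ φ x (b s x) ∂(μ s)

theorem C11.moll {δ : ℝ} (hδ : 0 < δ) :
    ∃ C : ℝ, 0 ≤ C ∧ ∀ (F : Type) [NormedAddCommGroup F] [NormedSpace ℝ F] [CompleteSpace F]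
      (g : Space d → F) (A : ℝ), 0 ≤ A → (∀ x y, ‖g x - g y‖ ≤ A * ‖x - y‖) →
      C11 A (C * A) (moll hδ g) := by
  obtain ⟨C, hC, h⟩ := exists_norm_fderiv_moll_sub_le d hδ
  refine ⟨C, hC, fun F _ _ _ g A hA hg => ⟨?_, ?_, h F g A hA hg, by positivity⟩⟩
  · exact differentiable_moll hδ (continuous_of_norm_sub_le hg)
  · exact norm_fderiv_le_of_norm_sub_le hA (norm_moll_sub_moll_le hδ hA hg)

theorem Field.continuous {V κ : ℝ} {b : ℝ → Space d → Space d} (hb : Field V κ b) (s : ℝ) :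
    Continuous (b s) :=
  continuous_of_norm_sub_le (hb.lip s)

theorem Field.norm_fderiv_apply_le {V κ : ℝ} {b : ℝ → Space d → Space d} (hb : Field V κ b)
    {A M : ℝ} {g : Space d → ℝ} (hg : C11 A M g) (s : ℝ) (x : Space d) :
    ‖fderiv ℝ g x (b s x)‖ ≤ A * V :=
  (ContinuousLinearMap.le_opNorm _ _).trans
    (mul_le_mul (hg.bdd _) (hb.bdd _ _) (norm_nonneg _) hg.A_nonneg)

theorem Field.integrable_fderiv_apply {V κ : ℝ} {b : ℝ → Space d → Space d} (hb : Field V κ b)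
    {A M : ℝ} {g : Space d → ℝ} (hg : C11 A M g) (s : ℝ) {P : Measure (Space d)}
    [IsProbabilityMeasure P] : Integrable (fun x => fderiv ℝ g x (b s x)) P :=
  Integrable.of_bound (hg.continuous_fderiv.clm_apply (hb.continuous s)).aestronglyMeasurable
    (A * V) (Eventually.of_forall (hb.norm_fderiv_apply_le hg s))

theorem norm_integral_le_of_prob {F : Type*} [NormedAddCommGroup F] [NormedSpace ℝ F]
    {α : Type*} [MeasurableSpace α] {P : Measure α}
    [IsProbabilityMeasure P] {f : α → F} {c : ℝ} (h : ∀ x, ‖f x‖ ≤ c) :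
    ‖∫ x, f x ∂P‖ ≤ c := by
  simpa using norm_integral_le_of_norm_le_const (μ := P) (Eventually.of_forall h)

namespace Transported

variable {T R V κ : ℝ} {b : ℝ → Space d → Space d} {μ : ℝ → Measure (Space d)}

theorem norm_rate_le (hμ : Transported T R b μ) (hb : Field V κ b) {A M : ℝ} {g : Space d → ℝ}
    (hg : C11 A M g) (s : ℝ) : ‖∫ x, fderiv ℝ g x (b s x) ∂(μ s)‖ ≤ A * V := by
  have := (hμ.inP1 s).prob
  exact norm_integral_le_of_prob (hb.norm_fderiv_apply_le hg s)

theorem intervalIntegrable_rate (hμ : Transported T R b μ) (hb : Field V κ b) {A M : ℝ}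
    {g : Space d → ℝ} (hg : C11 A M g) (s t : ℝ) :
    IntervalIntegrable (fun s => ∫ x, fderiv ℝ g x (b s x) ∂(μ s)) volume s t := by
  rw [intervalIntegrable_iff]
  exact IntegrableOn.of_bound (by simp) (hμ.meas A M g hg).aestronglyMeasurable
    (A * V) (Eventually.of_forall (hμ.norm_rate_le hb hg))

theorem weak_of_contDiff (hμ : Transported T R b μ) {g : Space d → ℝ} (hg : ContDiff ℝ ∞ g)
    {t : ℝ} (ht : t ∈ Icc 0 T) :
    ∫ x, g x ∂(μ t) = ∫ x, g x ∂(μ 0) +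
      ∫ s in (0 : ℝ)..t, ∫ x, fderiv ℝ g x (b s x) ∂(μ s) := by
  have hR1 : 0 < |R| + 1 := by positivity
  -- The cutoff has to equal `1` on a neighbourhood of the supporting ball, so that derivatives are
  -- unchanged there as well. The absolute value covers a negative `R`.
  let χ : ContDiffBump (0 : Space d) := ⟨|R| + 1, |R| + 2, hR1, by linarith⟩
  have hχ : ∀ x : Space d, ‖x‖ ≤ R → (fun y => χ y * g y) =ᶠ[𝓝 x] g := by
    intro x hx
    have hx' : x ∈ Metric.ball (0 : Space d) (|R| + 1) := by
      rw [mem_ball_zero_iff]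
      linarith [le_abs_self R]
    filter_upwards [Metric.isOpen_ball.mem_nhds hx'] with y hy
    rw [χ.one_of_mem_closedBall (Metric.ball_subset_closedBall hy), one_mul]
  have h1 := hμ.weak (fun y => χ y * g y) (χ.contDiff.mul hg) χ.hasCompactSupport.mul_right t ht
  have e1 : ∀ s, ∫ x, χ x * g x ∂(μ s) = ∫ x, g x ∂(μ s) := fun s =>
    integral_congr_ae ((hμ.supp s).ae_norm_le.mono fun x hx => (hχ x hx).eq_of_nhds)
  have e2 : ∀ s, ∫ x, fderiv ℝ (fun y => χ y * g y) x (b s x) ∂(μ s) =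
      ∫ x, fderiv ℝ g x (b s x) ∂(μ s) := fun s =>
    integral_congr_ae ((hμ.supp s).ae_norm_le.mono fun x hx => by
      simp only [(hχ x hx).fderiv_eq])
  simpa only [e1, e2] using h1

/-- Mollification at scale `δ` changes the test function by `A * δ`, which counts at two times, and
its derivative by `M * δ`, which counts along the field. Then `δ → 0`. -/
theorem weak_of_c11 (hμ : Transported T R b μ) (hb : Field V κ b) {A M : ℝ} {g : Space d → ℝ}
    (hg : C11 A M g) {t : ℝ} (ht : t ∈ Icc 0 T) :
    ∫ x, g x ∂(μ t) = ∫ x, g x ∂(μ 0) +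
      ∫ s in (0 : ℝ)..t, ∫ x, fderiv ℝ g x (b s x) ∂(μ s) := by
  have hV := hb.V_nonneg
  have hM := hg.M_nonneg
  have key : ∀ δ : ℝ, 0 < δ → ‖(∫ x, g x ∂(μ t) - ∫ x, g x ∂(μ 0)) -
      ∫ s in (0 : ℝ)..t, ∫ x, fderiv ℝ g x (b s x) ∂(μ s)‖ ≤ (2 * A + M * V * t) * δ := by
    intro δ hδ
    obtain ⟨C, hC, hC11⟩ := C11.moll (d := d) hδ
    have hgδ := hC11 ℝ g A hg.A_nonneg hg.norm_sub_le
    have h1 := hμ.weak_of_contDiff (contDiff_moll hδ hg.diff.continuous) ht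
    have h2 : ∀ s, ‖∫ x, LeaderFollower.moll hδ g x ∂(μ s) - ∫ x, g x ∂(μ s)‖ ≤ A * δ := by
      intro s
      have := (hμ.inP1 s).prob
      rw [← integral_sub ((hμ.inP1 s).integrable_of_lipschitz hgδ.norm_sub_le)
        ((hμ.inP1 s).integrable_of_lipschitz hg.norm_sub_le)]
      exact norm_integral_le_of_prob (norm_moll_sub_self_le hδ hg.A_nonneg hg.norm_sub_le)
    have h3 : ‖(∫ s in (0 : ℝ)..t, ∫ x, fderiv ℝ (LeaderFollower.moll hδ g) x (b s x) ∂(μ s)) -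
        ∫ s in (0 : ℝ)..t, ∫ x, fderiv ℝ g x (b s x) ∂(μ s)‖ ≤ M * V * t * δ := by
      rw [← intervalIntegral.integral_sub (hμ.intervalIntegrable_rate hb hgδ _ _)
        (hμ.intervalIntegrable_rate hb hg _ _)]
      have h4 : ∀ s ∈ uIoc 0 t, ‖∫ x, fderiv ℝ (LeaderFollower.moll hδ g) x (b s x) ∂(μ s) -
          ∫ x, fderiv ℝ g x (b s x) ∂(μ s)‖ ≤ M * δ * V := by
        intro s _
        have := (hμ.inP1 s).prob
        rw [← integral_sub (hb.integrable_fderiv_apply hgδ s) (hb.integrable_fderiv_apply hg s)]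
        refine norm_integral_le_of_prob fun x => ?_
        rw [← sub_apply]
        exact (ContinuousLinearMap.le_opNorm _ _).trans
          (mul_le_mul (norm_fderiv_moll_sub_fderiv_le hδ hM hg.diff hg.lip x) (hb.bdd _ _)
            (norm_nonneg _) (by positivity))
      refine (intervalIntegral.norm_integral_le_of_norm_le_const h4).trans (le_of_eq ?_)
      rw [sub_zero, abs_of_nonneg ht.1]
      ring
    have h5 := h2 t
    have h6 := h2 0
    rw [Real.norm_eq_abs, abs_le] at *
    constructor <;> nlinarith
  have h0 : ‖(∫ x, g x ∂(μ t) - ∫ x, g x ∂(μ 0)) -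
      ∫ s in (0 : ℝ)..t, ∫ x, fderiv ℝ g x (b s x) ∂(μ s)‖ ≤ 0 := by
    have hlim : Tendsto (fun δ : ℝ => (2 * A + M * V * t) * δ) (𝓝[>] 0) (𝓝 0) := by
      have : Continuous fun δ : ℝ => (2 * A + M * V * t) * δ := by fun_prop
      simpa using (this.tendsto 0).mono_left nhdsWithin_le_nhds
    exact ge_of_tendsto hlim (eventually_nhdsWithin_of_forall key)
  have := norm_le_zero_iff.1 h0
  linarith

theorem sub_eq_of_c11 (hμ : Transported T R b μ) (hb : Field V κ b) {A M : ℝ} {g : Space d → ℝ}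
    (hg : C11 A M g) {s t : ℝ} (hs : s ∈ Icc 0 T) (ht : t ∈ Icc 0 T) :
    ∫ x, g x ∂(μ t) - ∫ x, g x ∂(μ s) =
      ∫ r in s..t, ∫ x, fderiv ℝ g x (b r x) ∂(μ r) := by
  rw [hμ.weak_of_c11 hb hg ht, hμ.weak_of_c11 hb hg hs, add_sub_add_left_eq_sub]
  exact intervalIntegral.integral_interval_sub_left (hμ.intervalIntegrable_rate hb hg _ _)
    (hμ.intervalIntegrable_rate hb hg _ _)

theorem norm_integral_moll_sub_le (hμ : Transported T R b μ) {δ : ℝ} (hδ : 0 < δ)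
    {ψ : Space d → ℝ} {Λ : ℝ} (hΛ : 0 ≤ Λ) (hψ : ∀ x y, ‖ψ x - ψ y‖ ≤ Λ * ‖x - y‖) (s : ℝ) :
    ‖∫ x, LeaderFollower.moll hδ ψ x ∂(μ s) - ∫ x, ψ x ∂(μ s)‖ ≤ Λ * δ := by
  have := (hμ.inP1 s).prob
  rw [← integral_sub
    ((hμ.inP1 s).integrable_of_lipschitz (norm_moll_sub_moll_le hδ hΛ hψ))
    ((hμ.inP1 s).integrable_of_lipschitz hψ)]
  exact norm_integral_le_of_prob (norm_moll_sub_self_le hδ hΛ hψ)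

/-- The time derivative of the integral of a test function is bounded by its gradient bound times
the speed. Mollification does not increase the Lipschitz constant, so the estimate survives for
functions that are merely Lipschitz. -/
theorem norm_integral_sub_le (hμ : Transported T R b μ) (hb : Field V κ b) {ψ : Space d → ℝ}
    {Λ : ℝ} (hΛ : 0 ≤ Λ) (hψ : ∀ x y, ‖ψ x - ψ y‖ ≤ Λ * ‖x - y‖) {s t : ℝ} (hs : s ∈ Icc 0 T)
    (ht : t ∈ Icc 0 T) : ‖∫ x, ψ x ∂(μ t) - ∫ x, ψ x ∂(μ s)‖ ≤ Λ * V * |t - s| := by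
  have key : ∀ δ : ℝ, 0 < δ → ‖∫ x, ψ x ∂(μ t) - ∫ x, ψ x ∂(μ s)‖ ≤
      Λ * V * |t - s| + 2 * Λ * δ := by
    intro δ hδ
    obtain ⟨C, hC, hC11⟩ := C11.moll (d := d) hδ
    have hgδ := hC11 ℝ ψ Λ hΛ hψ
    have h1 := hμ.sub_eq_of_c11 hb hgδ hs ht
    have h2 : ‖∫ r in s..t, ∫ x, fderiv ℝ (LeaderFollower.moll hδ ψ) x (b r x) ∂(μ r)‖ ≤
        Λ * V * |t - s| :=
      intervalIntegral.norm_integral_le_of_norm_le_const fun r _ => hμ.norm_rate_le hb hgδ r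
    have h3 := hμ.norm_integral_moll_sub_le hδ hΛ hψ s
    have h4 := hμ.norm_integral_moll_sub_le hδ hΛ hψ t
    rw [← h1] at h2
    rw [Real.norm_eq_abs, abs_le] at *
    constructor <;> linarith
  have hlim : Tendsto (fun δ : ℝ => Λ * V * |t - s| + 2 * Λ * δ) (𝓝[>] 0)
      (𝓝 (Λ * V * |t - s|)) := by
    have : Continuous fun δ : ℝ => Λ * V * |t - s| + 2 * Λ * δ := by fun_prop
    simpa using (this.tendsto 0).mono_left nhdsWithin_le_nhds
  exact ge_of_tendsto hlim (eventually_nhdsWithin_of_forall key)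

end Transported

/-- The displacement `∫_s^t c_r(x) dr` of a vector field. -/
def displacement (c : ℝ → Space d → Space d) (s t : ℝ) (x : Space d) : Space d :=
  ∫ r in s..t, c r x

section Displacement

variable {V κ : ℝ} {c : ℝ → Space d → Space d}

theorem Field.intervalIntegrable (hc : Field V κ c) (x : Space d) (s t : ℝ) :
    IntervalIntegrable (fun r => c r x) volume s t := by
  have hm : Measurable fun r => c r x := hc.meas.comp (measurable_id.prodMk measurable_const)
  rw [intervalIntegrable_iff]
  exact IntegrableOn.of_bound (by simp) hm.aestronglyMeasurable
    V (Eventually.of_forall fun r => hc.bdd r x)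

theorem Field.norm_displacement_sub_le (hc : Field V κ c) {s t : ℝ} (hst : s ≤ t)
    (x y : Space d) :
    ‖displacement c s t x - displacement c s t y‖ ≤ κ * (t - s) * ‖x - y‖ := by
  unfold displacement
  rw [← intervalIntegral.integral_sub (hc.intervalIntegrable x s t) (hc.intervalIntegrable y s t)]
  refine (intervalIntegral.norm_integral_le_of_norm_le_const fun r _ => hc.lip r x y).trans
    (le_of_eq ?_)
  rw [abs_of_nonneg (sub_nonneg.2 hst)]
  ring

theorem Field.norm_displacement_le (hc : Field V κ c) {s t : ℝ} (hst : s ≤ t)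
    (x : Space d) : ‖displacement c s t x‖ ≤ V * (t - s) := by
  refine (intervalIntegral.norm_integral_le_of_norm_le_const fun r _ => hc.bdd r x).trans
    (le_of_eq ?_)
  rw [abs_of_nonneg (sub_nonneg.2 hst)]

theorem Field.integral_fderiv_displacement (hc : Field V κ c) {s t : ℝ} (hst : s ≤ t)
    {A M : ℝ} {g : Space d → ℝ} (hg : C11 A M g) (P : Measure (Space d))
    [IsProbabilityMeasure P] :
    ∫ r in s..t, ∫ x, fderiv ℝ g x (c r x) ∂P = ∫ x, fderiv ℝ g x (displacement c s t x) ∂P := by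
  have e1 : ∀ x, fderiv ℝ g x (displacement c s t x) = ∫ r in s..t, fderiv ℝ g x (c r x) :=
    fun x => ((fderiv ℝ g x).intervalIntegral_comp_comm (hc.intervalIntegrable x s t)).symm
  simp only [e1, intervalIntegral.integral_of_le hst]
  refine integral_integral_swap ?_
  refine Integrable.of_bound ?_ (A * V) (Eventually.of_forall fun p =>
    hc.norm_fderiv_apply_le hg p.1 p.2)
  refine isBoundedBilinearMap_apply.continuous.comp_aestronglyMeasurable
    (AEStronglyMeasurable.prodMk ?_ hc.meas.aestronglyMeasurable)
  exact (hg.continuous_fderiv.comp continuous_snd).aestronglyMeasurable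

end Displacement

/-- An explicit Euler step with mollified displacement. -/
def eulerStep {δ : ℝ} (hδ : 0 < δ) (c : ℝ → Space d → Space d) (s t : ℝ) (x : Space d) : Space d :=
  x + moll hδ (displacement c s t) x

/-- The displacement is only Lipschitz in space, so without mollification the class `C11` would not
be preserved. The possibly large constant `Cδ` multiplies only the step size and the gradient bound
`A`; this triangular structure lets `Transported.iterate` absorb it. -/
theorem C11.comp_eulerStep {δ : ℝ} (hδ : 0 < δ) :
    ∃ Cδ : ℝ, 0 ≤ Cδ ∧ ∀ {V κ : ℝ} {c : ℝ → Space d → Space d}, Field V κ c →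
      ∀ {s t : ℝ}, s ≤ t → ∀ {A M : ℝ} {g : Space d → ℝ}, C11 A M g →
      C11 (A * (1 + κ * (t - s))) (M * (1 + κ * (t - s)) ^ 2 + A * (Cδ * (κ * (t - s))))
        (fun x => g (eulerStep hδ c s t x)) := by
  obtain ⟨Cδ, hCδ, hC11⟩ := C11.moll (d := d) hδ
  refine ⟨Cδ, hCδ, fun {V κ c} hc {s t} hst {A M g} hg => ?_⟩
  have hκ := hc.κ_nonneg
  have hM := hg.M_nonneg
  have hA := hg.A_nonneg
  have hh : 0 ≤ t - s := sub_nonneg.2 hst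
  have hW := hC11 (Space d) (displacement c s t) (κ * (t - s)) (by positivity)
    (hc.norm_displacement_sub_le hst)
  set W := LeaderFollower.moll hδ (displacement c s t) with hWdef
  have hE : ∀ x, HasFDerivAt (eulerStep hδ c s t)
      (ContinuousLinearMap.id ℝ (Space d) + fderiv ℝ W x) x := fun x =>
    (hasFDerivAt_id x).add (hW.diff x).hasFDerivAt
  have hD : ∀ x, HasFDerivAt (fun x => g (eulerStep hδ c s t x))
      ((fderiv ℝ g (eulerStep hδ c s t x)).comp
        (ContinuousLinearMap.id ℝ (Space d) + fderiv ℝ W x)) x := fun x =>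
    (hg.diff _).hasFDerivAt.comp x (hE x)
  have hId : ∀ x, ‖ContinuousLinearMap.id ℝ (Space d) + fderiv ℝ W x‖ ≤ 1 + κ * (t - s) :=
    fun x => (norm_add_le _ _).trans (add_le_add ContinuousLinearMap.norm_id_le (hW.bdd x))
  have hEl : ∀ x y, ‖eulerStep hδ c s t x - eulerStep hδ c s t y‖ ≤
      (1 + κ * (t - s)) * ‖x - y‖ := fun x y => by
    have h1 := hW.norm_sub_le x y
    have h2 : eulerStep hδ c s t x - eulerStep hδ c s t y = (x - y) + (W x - W y) := by
      simp only [eulerStep, ← hWdef]; abel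
    rw [h2]
    refine (norm_add_le _ _).trans ?_
    linarith
  refine ⟨fun x => (hD x).differentiableAt, fun x => ?_, fun x y => ?_, by positivity⟩
  · rw [(hD x).fderiv]
    exact (ContinuousLinearMap.opNorm_comp_le _ _).trans
      (mul_le_mul (hg.bdd _) (hId x) (norm_nonneg _) hA)
  · rw [(hD x).fderiv, (hD y).fderiv]
    set Lx := ContinuousLinearMap.id ℝ (Space d) + fderiv ℝ W x with hLx
    set Ly := ContinuousLinearMap.id ℝ (Space d) + fderiv ℝ W y with hLy
    have h1 : (fderiv ℝ g (eulerStep hδ c s t x)).comp Lx -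
        (fderiv ℝ g (eulerStep hδ c s t y)).comp Ly =
        (fderiv ℝ g (eulerStep hδ c s t x) - fderiv ℝ g (eulerStep hδ c s t y)).comp Lx +
        (fderiv ℝ g (eulerStep hδ c s t y)).comp (Lx - Ly) := by
      simp
    rw [h1]
    refine (norm_add_le _ _).trans ?_
    have h2 : ‖(fderiv ℝ g (eulerStep hδ c s t x) -
        fderiv ℝ g (eulerStep hδ c s t y)).comp Lx‖ ≤
        M * ((1 + κ * (t - s)) * ‖x - y‖) * (1 + κ * (t - s)) := by
      refine (ContinuousLinearMap.opNorm_comp_le _ _).trans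
        (mul_le_mul ((hg.lip _ _).trans ?_) (hId x) (norm_nonneg _) (by positivity))
      gcongr
      exact hEl x y
    have h3 : ‖(fderiv ℝ g (eulerStep hδ c s t y)).comp (Lx - Ly)‖ ≤
        A * (Cδ * (κ * (t - s)) * ‖x - y‖) := by
      refine (ContinuousLinearMap.opNorm_comp_le _ _).trans
        (mul_le_mul (hg.bdd _) ?_ (norm_nonneg _) hA)
      rw [hLx, hLy, add_sub_add_left_eq_sub]
      exact hW.lip x y
    refine (add_le_add h2 h3).trans (le_of_eq (by ring))

/-- Consistency of the Euler scheme for a field `c` that need not be the one transporting `μ`. The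
errors are the distance of the fields, the mollification of the displacement, and quadratic terms
from Taylor's formula and from freezing the measure at the initial time of the step. -/
theorem Transported.one_step {T R V κ : ℝ} {b c : ℝ → Space d → Space d}
    {μ : ℝ → Measure (Space d)} (hμ : Transported T R b μ) (hb : Field V κ b) (hc : Field V κ c)
    {β : ℝ → ℝ} (hβ : Continuous β) (hbc : ∀ r ∈ Icc 0 T, ∀ x, ‖b r x - c r x‖ ≤ β r)
    {δ : ℝ} (hδ : 0 < δ) {A M : ℝ} {g : Space d → ℝ} (hg : C11 A M g) {s t : ℝ}
    (hs : s ∈ Icc 0 T) (ht : t ∈ Icc 0 T) (hst : s ≤ t) :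
    ‖∫ x, g x ∂(μ t) - ∫ x, g (eulerStep hδ c s t x) ∂(μ s)‖ ≤
      A * (∫ r in s..t, β r) + A * κ * δ * (t - s) +
        (2 * M * V ^ 2 + A * κ * V) * (t - s) ^ 2 := by
  have hP := (hμ.inP1 s).prob
  have hκ := hc.κ_nonneg
  have hV := hc.V_nonneg
  have hM := hg.M_nonneg
  have hA := hg.A_nonneg
  have hh : 0 ≤ t - s := sub_nonneg.2 hst
  set w := displacement c s t with hw
  have hwl : ∀ x y, ‖w x - w y‖ ≤ κ * (t - s) * ‖x - y‖ := hc.norm_displacement_sub_le hst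
  have hwc : Continuous w := continuous_of_norm_sub_le hwl
  have hwb : ∀ x, ‖w x‖ ≤ V * (t - s) := hc.norm_displacement_le hst
  have hWb : ∀ x, ‖moll hδ w x‖ ≤ V * (t - s) := fun x =>
    norm_moll_le hδ hwc (by positivity) hwb
  have hWc : Continuous (moll hδ w) := (contDiff_moll hδ hwc).continuous
  have hEc : Continuous (eulerStep hδ c s t) := continuous_id.add hWc
  have hgc := hg.diff.continuous
  have iDc : ∀ f : Space d → Space d, Continuous f → (∀ x, ‖f x‖ ≤ V * (t - s)) →
      Integrable (fun x => fderiv ℝ g x (f x)) (μ s) := fun f hf hfb =>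
    Integrable.of_bound (hg.continuous_fderiv.clm_apply hf).aestronglyMeasurable
      (A * (V * (t - s))) (Eventually.of_forall fun x => (ContinuousLinearMap.le_opNorm _ _).trans
        (mul_le_mul (hg.bdd _) (hfb _) (norm_nonneg _) hA))
  have hgi := (hμ.inP1 s).integrable_of_lipschitz hg.norm_sub_le
  have hrem : ∀ x, ‖g (eulerStep hδ c s t x) - g x - fderiv ℝ g x (moll hδ w x)‖ ≤
      M * (V * (t - s)) ^ 2 := fun x => by
    have := hg.taylor x (eulerStep hδ c s t x)
    simp only [eulerStep, add_sub_cancel_left] at this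
    refine this.trans ?_
    gcongr
    exact hWb x
  have hgEi : Integrable (fun x => g (eulerStep hδ c s t x)) (μ s) := by
    have h1 : Integrable (fun x => g (eulerStep hδ c s t x) - g x) (μ s) := by
      refine Integrable.of_bound ((hgc.comp hEc).sub hgc).aestronglyMeasurable
        (A * (V * (t - s))) (Eventually.of_forall fun x => (hg.norm_sub_le _ _).trans ?_)
      gcongr
      simpa [eulerStep] using hWb x
    refine (h1.add hgi).congr (Eventually.of_forall fun x => ?_)
    simp
  have h1 : ‖(∫ x, g (eulerStep hδ c s t x) ∂(μ s) - ∫ x, g x ∂(μ s)) -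
      ∫ x, fderiv ℝ g x (moll hδ w x) ∂(μ s)‖ ≤ M * (V * (t - s)) ^ 2 := by
    have hsub : Integrable (fun x => g (eulerStep hδ c s t x) - g x) (μ s) := hgEi.sub hgi
    rw [← integral_sub hgEi hgi, ← integral_sub hsub (iDc _ hWc hWb)]
    exact norm_integral_le_of_prob hrem
  -- The displacement has Lipschitz constant `κ * (t - s)`, so mollifying it costs an error
  -- proportional to the step; after summation over all steps the total is of order `δ`.
  have h2 : ‖∫ x, fderiv ℝ g x (moll hδ w x) ∂(μ s) - ∫ x, fderiv ℝ g x (w x) ∂(μ s)‖ ≤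
      A * (κ * (t - s) * δ) := by
    rw [← integral_sub (iDc _ hWc hWb) (iDc _ hwc hwb)]
    refine norm_integral_le_of_prob fun x => ?_
    rw [← map_sub]
    exact (ContinuousLinearMap.le_opNorm _ _).trans (mul_le_mul (hg.bdd _)
      (norm_moll_sub_self_le hδ (by positivity) hwl x) (norm_nonneg _) hA)
  have h3 := hμ.sub_eq_of_c11 hb hg hs ht
  have h4 := hc.integral_fderiv_displacement hst hg (μ s)
  have hcm : Measurable fun r => ∫ x, fderiv ℝ g x (c r x) ∂(μ s) := by
    refine (StronglyMeasurable.integral_prod_right (f := fun r x => fderiv ℝ g x (c r x))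
      ?_).measurable
    refine isBoundedBilinearMap_apply.continuous.comp_stronglyMeasurable
      (StronglyMeasurable.prodMk ?_ hc.meas.stronglyMeasurable)
    exact (hg.continuous_fderiv.comp continuous_snd).stronglyMeasurable
  have hci : IntervalIntegrable (fun r => ∫ x, fderiv ℝ g x (c r x) ∂(μ s)) volume s t := by
    rw [intervalIntegrable_iff]
    exact IntegrableOn.of_bound (by simp) hcm.aestronglyMeasurable (A * V)
      (Eventually.of_forall fun r => norm_integral_le_of_prob (hc.norm_fderiv_apply_le hg r))
  have h5 : ‖(∫ r in s..t, ∫ x, fderiv ℝ g x (b r x) ∂(μ r)) -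
      ∫ r in s..t, ∫ x, fderiv ℝ g x (c r x) ∂(μ s)‖ ≤
      (M * V + A * κ) * V * (t - s) * (t - s) + A * ∫ r in s..t, β r := by
    rw [← intervalIntegral.integral_sub (hμ.intervalIntegrable_rate hb hg _ _) hci]
    have h6 := intervalIntegral.norm_integral_le_of_norm_le hst (μ := volume)
      (f := fun r => (∫ x, fderiv ℝ g x (b r x) ∂(μ r)) - ∫ x, fderiv ℝ g x (c r x) ∂(μ s))
      (g := fun r => (M * V + A * κ) * V * (t - s) + A * β r)
      (Eventually.of_forall fun r hr => ?_)
      ((by fun_prop : Continuous fun r =>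
        (M * V + A * κ) * V * (t - s) + A * β r).intervalIntegrable _ _)
    · refine h6.trans (le_of_eq ?_)
      rw [intervalIntegral.integral_add (by simp)
        ((hβ.const_mul A).intervalIntegrable _ _), intervalIntegral.integral_const_mul A β,
        intervalIntegral.integral_const, smul_eq_mul]
      ring
    · have hr' : r ∈ Icc 0 T := ⟨hs.1.trans hr.1.le, hr.2.trans ht.2⟩
      -- Replacing `μ r` by `μ s` uses the Lipschitz dependence on time in duality with the spatial
      -- function `x ↦ Dg(x) b_r(x)`, whose Lipschitz constant is `M * V + A * κ`.
      have h7 := hμ.norm_integral_sub_le hb (ψ := fun x => fderiv ℝ g x (b r x))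
        (Λ := M * V + A * κ) (by positivity)
        (fun x y => hg.norm_apply_sub_le (hb.bdd r) (hb.lip r) x y) hs hr'
      rw [abs_of_nonneg (sub_nonneg.2 hr.1.le)] at h7
      have h8 : ‖∫ x, fderiv ℝ g x (b r x) ∂(μ s) - ∫ x, fderiv ℝ g x (c r x) ∂(μ s)‖ ≤
          A * β r := by
        rw [← integral_sub (hb.integrable_fderiv_apply hg r) (hc.integrable_fderiv_apply hg r)]
        refine norm_integral_le_of_prob fun x => ?_
        rw [← map_sub]
        exact (ContinuousLinearMap.le_opNorm _ _).trans (mul_le_mul (hg.bdd _)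
          (hbc r hr' x) (norm_nonneg _) hA)
      have h9 : (M * V + A * κ) * V * (r - s) ≤ (M * V + A * κ) * V * (t - s) := by
        gcongr
        exact hr.2
      refine (norm_sub_le_norm_sub_add_norm_sub _ (∫ x, fderiv ℝ g x (b r x) ∂(μ s)) _).trans ?_
      linarith
  rw [h4, ← h3] at h5
  rw [Real.norm_eq_abs, abs_le] at *
  constructor <;> nlinarith

end Transport

end LeaderFollower
end

noncomputable section

namespace LeaderFollower

/-! ### Comparison of two transported curves by a common Euler scheme -/

section Comparison

variable {d : ℕ} {T R V κ : ℝ} {b b' : ℝ → Space d → Space d} {μ ν : ℝ → Measure (Space d)}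

/-- Both solutions are tested against the same Euler scheme for `b`, so `g` at time `(k + 1) h` is
traded for `g ∘ eulerStep` at time `k h` and induction applies, down to time `0` where the curves
agree. Test functions are measured by `A + M / lam`, which one step multiplies by at most `exp (3 *
κ * h)` once `lam ≥ Cδ`. The factors `2` and `4` in the error arise because each of the two
solutions contributes a consistency error, with `M ≤ lam * (A + M / lam)`. -/
theorem Transported.iterate (hμ : Transported T R b μ) (hν : Transported T R b' ν)
    (hb : Field V κ b) (hb' : Field V κ b') (h0 : μ 0 = ν 0) {β : ℝ → ℝ} (hβ : Continuous β)
    (hβ0 : ∀ r, 0 ≤ β r) (hbb : ∀ r ∈ Icc 0 T, ∀ x, ‖b' r x - b r x‖ ≤ β r)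
    {δ : ℝ} (hδ : 0 < δ) :
    ∃ Cδ : ℝ, ∀ lam h : ℝ, 0 < lam → Cδ ≤ lam → 0 ≤ h → κ * h ≤ 1 →
      ∀ k : ℕ, k * h ≤ T → ∀ (A M : ℝ) (g : Space d → ℝ), C11 A M g →
        ‖∫ x, g x ∂(μ (k * h)) - ∫ x, g x ∂(ν (k * h))‖ ≤
          (A + M / lam) * Real.exp (3 * κ * (k * h)) *
            (2 * κ * δ * (k * h) + (4 * lam * V ^ 2 + 2 * κ * V) * (k * h) * h +
              ∫ r in (0 : ℝ)..k * h, β r) := by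
  obtain ⟨Cδ, hCδ, hE⟩ := C11.comp_eulerStep (d := d) hδ
  refine ⟨Cδ, fun lam h hlam hCl hh hκh k => ?_⟩
  have hκ := hb.κ_nonneg
  have hV := hb.V_nonneg
  induction k with
  | zero => intro _ A M g _; simp [h0]
  | succ k ih =>
    intro hkT A M g hg
    push_cast at hkT ⊢
    have hA := hg.A_nonneg
    have hM := hg.M_nonneg
    set s : ℝ := k * h with hs
    have hs0 : 0 ≤ s := by positivity
    have ht : ((k : ℝ) + 1) * h = s + h := by rw [hs]; ring
    rw [ht] at hkT ⊢
    have hsI : s ∈ Icc 0 T := ⟨hs0, by linarith⟩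
    have htI : s + h ∈ Icc 0 T := ⟨by linarith, hkT⟩
    have hst : s ≤ s + h := by linarith
    have h1 := hμ.one_step hb hb (β := fun _ => 0) continuous_const (fun r _ x => by simp)
      hδ hg hsI htI hst
    have h2 := hν.one_step hb' hb hβ hbb hδ hg hsI htI hst
    have hgE := hE hb hst hg
    have h3 := ih (by linarith) _ _ _ hgE
    simp only [add_sub_cancel_left, intervalIntegral.integral_zero, mul_zero, zero_add] at h1 h2 h3
    set Q := A + M / lam with hQ
    have hMl : 0 ≤ M / lam := by positivity
    have hAQ : A ≤ Q := by linarith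
    have hMQ : M ≤ lam * Q := by
      have : M = lam * (M / lam) := by field_simp
      rw [this]; gcongr; linarith
    have hQ0 : 0 ≤ Q := by linarith
    have hI0 : 0 ≤ ∫ r in (0 : ℝ)..s, β r :=
      intervalIntegral.integral_nonneg hs0 fun r _ => hβ0 r
    have hI1 : 0 ≤ ∫ r in s..s + h, β r := intervalIntegral.integral_nonneg hst fun r _ => hβ0 r
    have hI : ∫ r in (0 : ℝ)..s + h, β r = (∫ r in (0 : ℝ)..s, β r) + ∫ r in s..s + h, β r :=
      (intervalIntegral.integral_add_adjacent_intervals (hβ.intervalIntegrable _ _)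
        (hβ.intervalIntegrable _ _)).symm
    -- Dividing by `lam ≥ Cδ` reduces the mollification term to `A * κ * h`, and `κ * h ≤ 1` gives
    -- `(1 + κ h)² ≤ 1 + 3 κ h`.
    have hQ' : A * (1 + κ * h) + (M * (1 + κ * h) ^ 2 + A * (Cδ * (κ * h))) / lam ≤
        Q * Real.exp (3 * κ * h) := by
      have e1 : A * (Cδ * (κ * h)) / lam ≤ A * (κ * h) := by
        rw [div_le_iff₀ hlam]
        have : A * (Cδ * (κ * h)) ≤ A * (lam * (κ * h)) := by gcongr
        linarith
      have e2 : (1 + κ * h) ^ 2 ≤ 1 + 3 * (κ * h) := by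
        have : 0 ≤ κ * h := by positivity
        nlinarith
      have e3 : M * (1 + κ * h) ^ 2 / lam ≤ M / lam * (1 + 3 * (κ * h)) := by
        rw [mul_div_right_comm]; gcongr
      have e4 : 3 * κ * h + 1 ≤ Real.exp (3 * κ * h) := Real.add_one_le_exp _
      have e5 : Q * (3 * κ * h + 1) ≤ Q * Real.exp (3 * κ * h) := by gcongr
      have e6 : 0 ≤ A * (κ * h) := by positivity
      rw [add_div]
      calc _ ≤ A * (1 + κ * h) + (M / lam * (1 + 3 * (κ * h)) + A * (κ * h)) := by gcongr
        _ ≤ Q * (3 * κ * h + 1) := by rw [hQ]; linarith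
        _ ≤ _ := e5
    set D := 2 * κ * δ * s + (4 * lam * V ^ 2 + 2 * κ * V) * s * h + ∫ r in (0 : ℝ)..s, β r with hD
    have hD0 : 0 ≤ D := by positivity
    have hexp : Real.exp (3 * κ * (s + h)) = Real.exp (3 * κ * h) * Real.exp (3 * κ * s) := by
      rw [← Real.exp_add]; ring_nf
    have h4 : ‖∫ x, g (eulerStep hδ b s (s + h) x) ∂(μ s) -
        ∫ x, g (eulerStep hδ b s (s + h) x) ∂(ν s)‖ ≤ Q * Real.exp (3 * κ * (s + h)) * D := by
      refine h3.trans ?_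
      rw [hexp, ← mul_assoc Q]
      gcongr
    have h5 : ‖∫ x, g x ∂(μ (s + h)) - ∫ x, g x ∂(ν (s + h))‖ ≤
        ‖∫ x, g x ∂(μ (s + h)) - ∫ x, g (eulerStep hδ b s (s + h) x) ∂(μ s)‖ +
        ‖∫ x, g (eulerStep hδ b s (s + h) x) ∂(μ s) -
          ∫ x, g (eulerStep hδ b s (s + h) x) ∂(ν s)‖ +
        ‖∫ x, g x ∂(ν (s + h)) - ∫ x, g (eulerStep hδ b s (s + h) x) ∂(ν s)‖ := by
      refine (norm_sub_le_norm_sub_add_norm_sub _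
        (∫ x, g (eulerStep hδ b s (s + h) x) ∂(ν s)) _).trans ?_
      rw [norm_sub_rev (∫ x, g (eulerStep hδ b s (s + h) x) ∂(ν s)) (∫ x, g x ∂(ν (s + h)))]
      gcongr
      exact norm_sub_le_norm_sub_add_norm_sub _ _ _
    set I := ∫ r in s..s + h, β r with hIdef
    have h6 : A * κ * δ * h + (2 * M * V ^ 2 + A * κ * V) * h ^ 2 ≤
        Q * (κ * δ * h + (2 * lam * V ^ 2 + κ * V) * h ^ 2) := by
      have e1 : A * (κ * δ * h) ≤ Q * (κ * δ * h) := by gcongr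
      have e2 : M * (2 * V ^ 2 * h ^ 2) ≤ lam * Q * (2 * V ^ 2 * h ^ 2) := by gcongr
      have e3 : A * (κ * V * h ^ 2) ≤ Q * (κ * V * h ^ 2) := by gcongr
      linarith
    have h7 : A * I ≤ Q * I := by gcongr
    set inc := 2 * κ * δ * h + (4 * lam * V ^ 2 + 2 * κ * V) * h ^ 2 + I with hinc
    have hinc0 : 0 ≤ inc := by positivity
    have h8 : Q * inc ≤ Q * Real.exp (3 * κ * (s + h)) * inc := by
      have : 1 ≤ Real.exp (3 * κ * (s + h)) := Real.one_le_exp (by positivity)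
      have e1 : Q * 1 ≤ Q * Real.exp (3 * κ * (s + h)) := by gcongr
      rw [mul_one] at e1
      gcongr
    have h9 : D + inc ≤ 2 * κ * δ * (s + h) + (4 * lam * V ^ 2 + 2 * κ * V) * (s + h) * h +
        ∫ r in (0 : ℝ)..s + h, β r := by
      rw [hI, hD, hinc]; linarith
    calc _ ≤ Q * Real.exp (3 * κ * (s + h)) * D + Q * inc := by
          rw [hinc]; linarith
      _ ≤ Q * Real.exp (3 * κ * (s + h)) * (D + inc) := by
          linarith [mul_add (Q * Real.exp (3 * κ * (s + h))) D inc]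
      _ ≤ _ := by gcongr

/-- Three limits in a forced order: the step `h = t / n` tends to `0` with `lam` fixed, because the
quadratic error carries `lam`; then `lam → ∞`, which removes `M`; finally `δ → 0`, since `lam` must
dominate `Cδ`. Only the gradient bound `A` remains in the result. -/
theorem Transported.norm_integral_sub_le_of_c11 (hμ : Transported T R b μ)
    (hν : Transported T R b' ν) (hb : Field V κ b) (hb' : Field V κ b') (h0 : μ 0 = ν 0)
    {β : ℝ → ℝ} (hβ : Continuous β) (hβ0 : ∀ r, 0 ≤ β r)
    (hbb : ∀ r ∈ Icc 0 T, ∀ x, ‖b' r x - b r x‖ ≤ β r) {A M : ℝ} {g : Space d → ℝ}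
    (hg : C11 A M g) {t : ℝ} (ht : t ∈ Icc 0 T) :
    ‖∫ x, g x ∂(μ t) - ∫ x, g x ∂(ν t)‖ ≤
      A * Real.exp (3 * κ * t) * ∫ r in (0 : ℝ)..t, β r := by
  have ht0 := ht.1
  have hκ := hb.κ_nonneg
  have key : ∀ δ : ℝ, 0 < δ → ‖∫ x, g x ∂(μ t) - ∫ x, g x ∂(ν t)‖ ≤
      A * Real.exp (3 * κ * t) * (2 * κ * δ * t + ∫ r in (0 : ℝ)..t, β r) := by
    intro δ hδ
    obtain ⟨Cδ, hit⟩ := hμ.iterate hν hb hb' h0 hβ hβ0 hbb hδ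
    have key1 : ∀ lam : ℝ, 0 < lam → Cδ ≤ lam → ‖∫ x, g x ∂(μ t) - ∫ x, g x ∂(ν t)‖ ≤
        (A + M / lam) * Real.exp (3 * κ * t) * (2 * κ * δ * t + ∫ r in (0 : ℝ)..t, β r) := by
      intro lam hlam hCl
      have hlim : Tendsto (fun n : ℕ => (A + M / lam) * Real.exp (3 * κ * t) *
          (2 * κ * δ * t + (4 * lam * V ^ 2 + 2 * κ * V) * t * (t / n) +
            ∫ r in (0 : ℝ)..t, β r)) atTop
          (𝓝 ((A + M / lam) * Real.exp (3 * κ * t) *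
          (2 * κ * δ * t + (4 * lam * V ^ 2 + 2 * κ * V) * t * 0 +
            ∫ r in (0 : ℝ)..t, β r))) :=
        (((tendsto_const_div_atTop_nhds_zero_nat t).const_mul _).const_add _
          |>.add_const _).const_mul _
      rw [mul_zero, add_zero] at hlim
      refine ge_of_tendsto hlim ?_
      obtain ⟨n0, hn0⟩ := exists_nat_ge (κ * t)
      filter_upwards [eventually_ge_atTop (max n0 1)] with n hn
      have hn1 : 1 ≤ n := (le_max_right _ _).trans hn
      have hn2 : (n0 : ℝ) ≤ n := by exact_mod_cast (le_max_left _ _).trans hn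
      have hnpos : (0 : ℝ) < n := by exact_mod_cast hn1
      have hnt : (n : ℝ) * (t / n) = t := by field_simp
      have := hit lam (t / n) hlam hCl (by positivity)
        (by rw [← mul_div_assoc, div_le_one hnpos]; linarith) n (by rw [hnt]; exact ht.2) A M g hg
      rwa [hnt] at this
    have hlim : Tendsto (fun lam : ℝ => (A + M / lam) * Real.exp (3 * κ * t) *
        (2 * κ * δ * t + ∫ r in (0 : ℝ)..t, β r)) atTop
        (𝓝 ((A + 0) * Real.exp (3 * κ * t) * (2 * κ * δ * t + ∫ r in (0 : ℝ)..t, β r))) :=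
      ((((tendsto_const_nhds (x := M)).div_atTop tendsto_id).const_add A).mul_const _).mul_const _
    rw [add_zero] at hlim
    refine ge_of_tendsto hlim ?_
    filter_upwards [eventually_gt_atTop 0, eventually_ge_atTop Cδ] with lam h1 h2
    exact key1 lam h1 h2
  have hlim : Tendsto (fun δ : ℝ => A * Real.exp (3 * κ * t) *
      (2 * κ * δ * t + ∫ r in (0 : ℝ)..t, β r)) (𝓝[>] 0)
      (𝓝 (A * Real.exp (3 * κ * t) * (2 * κ * 0 * t + ∫ r in (0 : ℝ)..t, β r))) := by
    have : Continuous fun δ : ℝ => A * Real.exp (3 * κ * t) *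
      (2 * κ * δ * t + ∫ r in (0 : ℝ)..t, β r) := by fun_prop
    exact (this.tendsto 0).mono_left nhdsWithin_le_nhds
  have := ge_of_tendsto hlim (eventually_nhdsWithin_of_forall key)
  simpa using this

/-- The bound for `C11` functions no longer contains the second-order constant, so it passes from
mollified functions to Lipschitz ones. -/
theorem Transported.norm_integral_sub_le_of_lipschitz (hμ : Transported T R b μ)
    (hν : Transported T R b' ν) (hb : Field V κ b) (hb' : Field V κ b') (h0 : μ 0 = ν 0)
    {β : ℝ → ℝ} (hβ : Continuous β) (hβ0 : ∀ r, 0 ≤ β r)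
    (hbb : ∀ r ∈ Icc 0 T, ∀ x, ‖b' r x - b r x‖ ≤ β r) {ψ : Space d → ℝ} {Λ : ℝ} (hΛ : 0 ≤ Λ)
    (hψ : ∀ x y, ‖ψ x - ψ y‖ ≤ Λ * ‖x - y‖) {t : ℝ} (ht : t ∈ Icc 0 T) :
    ‖∫ x, ψ x ∂(μ t) - ∫ x, ψ x ∂(ν t)‖ ≤
      Λ * Real.exp (3 * κ * t) * ∫ r in (0 : ℝ)..t, β r := by
  have key : ∀ δ : ℝ, 0 < δ → ‖∫ x, ψ x ∂(μ t) - ∫ x, ψ x ∂(ν t)‖ ≤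
      Λ * Real.exp (3 * κ * t) * (∫ r in (0 : ℝ)..t, β r) + 2 * Λ * δ := by
    intro δ hδ
    obtain ⟨C, hC, hC11⟩ := C11.moll (d := d) hδ
    have hgδ := hC11 ℝ ψ Λ hΛ hψ
    have h1 := hμ.norm_integral_sub_le_of_c11 hν hb hb' h0 hβ hβ0 hbb hgδ ht
    have h2 := hμ.norm_integral_moll_sub_le hδ hΛ hψ t
    have h3 := hν.norm_integral_moll_sub_le hδ hΛ hψ t
    rw [Real.norm_eq_abs, abs_le] at *
    constructor <;> linarith
  have hlim : Tendsto (fun δ : ℝ => Λ * Real.exp (3 * κ * t) * (∫ r in (0 : ℝ)..t, β r) +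
      2 * Λ * δ) (𝓝[>] 0) (𝓝 (Λ * Real.exp (3 * κ * t) * (∫ r in (0 : ℝ)..t, β r))) := by
    have : Continuous fun δ : ℝ => Λ * Real.exp (3 * κ * t) * (∫ r in (0 : ℝ)..t, β r) +
      2 * Λ * δ := by fun_prop
    simpa using (this.tendsto 0).mono_left nhdsWithin_le_nhds
  exact ge_of_tendsto hlim (eventually_nhdsWithin_of_forall key)

theorem measure_eq_of_lipschitz {P P' : Measure (Space d)} [IsProbabilityMeasure P]
    [IsProbabilityMeasure P'] (h : ∀ (ψ : Space d → ℝ) (Λ : ℝ), 0 ≤ Λ →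
      (∀ x y, ‖ψ x - ψ y‖ ≤ Λ * ‖x - y‖) → ∫ x, ψ x ∂P = ∫ x, ψ x ∂P') : P = P' := by
  let p : ProbabilityMeasure (Space d) := ⟨P, inferInstance⟩
  let p' : ProbabilityMeasure (Space d) := ⟨P', inferInstance⟩
  -- Bounded Lipschitz functions determine narrow convergence, so the constant sequence `p`
  -- converges to `p'`; uniqueness of limits then identifies the measures.
  have h1 : Tendsto (fun _ : ℕ => p) atTop (𝓝 p') := by
    rw [tendsto_iff_forall_lipschitz_integral_tendsto]
    intro f hfb hfl
    obtain ⟨Λ, hΛ⟩ := hfl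
    have := h f Λ Λ.2 fun x y => by simpa [dist_eq_norm] using hΛ.dist_le_mul x y
    change Tendsto (fun _ : ℕ => ∫ x, f x ∂P) atTop (𝓝 (∫ x, f x ∂P'))
    rw [this]
    exact tendsto_const_nhds
  have h2 := tendsto_nhds_unique tendsto_const_nhds h1
  exact congrArg (fun Q : ProbabilityMeasure (Space d) => (Q : Measure (Space d))) h2

end Comparison

end LeaderFollower
end

noncomputable section

namespace LeaderFollower

/-! ### Uniqueness for the mean-field system -/

section Uniqueness

variable {m d : ℕ} {B K C T : ℝ} {H : Space d → Space d} {G : Fin d → Space d → Space d}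

theorem tendsto_integral_of_W1 {F : Type*} [NormedAddCommGroup F] [NormedSpace ℝ F]
    [CompleteSpace F] {ν : ℝ → Measure (Space d)} (hP : ∀ s, InP1 (ν s)) {s : ℝ}
    (hW : Tendsto (fun r => W1 (ν r) (ν s)) (𝓝 s) (𝓝 0)) {ψ : ℝ → Space d → F} {Λ : ℝ}
    (hψ : ∀ r x y, ‖ψ r x - ψ r y‖ ≤ Λ * ‖x - y‖) {η : ℝ → ℝ} (hη : Tendsto η (𝓝 s) (𝓝 0))
    (hψη : ∀ᶠ r in 𝓝 s, ∀ x, ‖ψ r x - ψ s x‖ ≤ η r) :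
    Tendsto (fun r => ∫ x, ψ r x ∂(ν r)) (𝓝 s) (𝓝 (∫ x, ψ s x ∂(ν s))) := by
  have h1 : ∀ r, ENNReal.ofReal ‖∫ x, ψ s x ∂(ν r) - ∫ x, ψ s x ∂(ν s)‖ ≤
      ENNReal.ofReal Λ * W1 (ν r) (ν s) := fun r =>
    norm_integral_sub_le_W1 (hP r) (hP s) (hψ s)
  have h2 : Tendsto (fun r => ENNReal.ofReal Λ * W1 (ν r) (ν s)) (𝓝 s) (𝓝 0) := by
    have := ENNReal.Tendsto.const_mul hW (Or.inr (ENNReal.ofReal_ne_top (r := Λ)))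
    rwa [mul_zero] at this
  have h3 : Tendsto (fun r => ENNReal.ofReal ‖∫ x, ψ s x ∂(ν r) - ∫ x, ψ s x ∂(ν s)‖) (𝓝 s)
      (𝓝 0) := tendsto_of_tendsto_of_tendsto_of_le_of_le tendsto_const_nhds h2
        (fun _ => zero_le) h1
  have h4 : Tendsto (fun r => ‖∫ x, ψ s x ∂(ν r) - ∫ x, ψ s x ∂(ν s)‖) (𝓝 s) (𝓝 0) := by
    have := (ENNReal.tendsto_toReal ENNReal.zero_ne_top).comp h3
    simpa [Function.comp_def, ENNReal.toReal_ofReal (norm_nonneg _)] using this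
  rw [tendsto_iff_norm_sub_tendsto_zero]
  refine squeeze_zero' (Eventually.of_forall fun _ => norm_nonneg _) ?_
    (by simpa using hη.add h4)
  filter_upwards [hψη] with r hr
  have := (hP r).prob
  refine (norm_sub_le_norm_sub_add_norm_sub _ (∫ x, ψ s x ∂(ν r)) _).trans ?_
  gcongr
  rw [← integral_sub ((hP r).integrable_of_lipschitz (hψ r))
    ((hP r).integrable_of_lipschitz (hψ s))]
  exact norm_integral_le_of_prob hr

theorem Interactions.tendsto_conv (h : Interactions B K H G) {ν : ℝ → Measure (Space d)}
    (hP : ∀ s, InP1 (ν s)) {s : ℝ} (hW : Tendsto (fun r => W1 (ν r) (ν s)) (𝓝 s) (𝓝 0)) :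
    ∃ η : ℝ → ℝ, Tendsto η (𝓝 s) (𝓝 0) ∧ ∀ᶠ r in 𝓝 s, ∀ x,
      ‖(∫ ξ, H (x - ξ) ∂(ν r)) - ∫ ξ, H (x - ξ) ∂(ν s)‖ ≤ η r := by
  refine ⟨fun r => (ENNReal.ofReal K * W1 (ν r) (ν s)).toReal, ?_, ?_⟩
  · have := ENNReal.Tendsto.const_mul hW (Or.inr (ENNReal.ofReal_ne_top (r := K)))
    rw [mul_zero] at this
    exact (ENNReal.tendsto_toReal ENNReal.zero_ne_top).comp this
  · filter_upwards [hW.eventually (gt_mem_nhds ENNReal.zero_lt_top)] with r hr x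
    have := norm_integral_sub_le_W1 (hP r) (hP s) (ψ := fun ξ => H (x - ξ)) (Λ := K)
      fun y z => h.H.lip_sub' y z x
    exact (ENNReal.ofReal_le_iff_le_toReal (ENNReal.mul_ne_top ENNReal.ofReal_ne_top hr.ne)).1 this

/-- The retraction of `ℝ` onto `[0, T]`. -/
def clampIcc (T s : ℝ) : ℝ := max 0 (min s T)

theorem continuous_clampIcc (T : ℝ) : Continuous (clampIcc T) := by
  unfold clampIcc; fun_prop

theorem clampIcc_mem (hT : 0 ≤ T) (s : ℝ) : clampIcc T s ∈ Icc 0 T :=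
  ⟨le_max_left _ _, max_le hT (min_le_right _ _)⟩

theorem clampIcc_of_mem {s : ℝ} (hs : s ∈ Icc 0 T) : clampIcc T s = s := by
  rw [clampIcc, min_eq_left hs.2, max_eq_right hs.1]

variable {u Y : ℝ → Leaders m d} {Y0 : Leaders m d} {μ0 : Measure (Space d)}
  {μ : ℝ → Measure (Space d)}

theorem IsMeanFieldSol.eq_leaderPath (hs : IsMeanFieldSol T H G u Y0 μ0 Y μ) {t : ℝ}
    (ht : t ∈ Icc 0 T) : Y t = leaderPath u Y0 t := funext fun k => hs.leaders t ht k

theorem field_of_curve (h : Interactions B K H G) (hu : Measurable u) (hC : ∀ t, ‖u t‖ ≤ C)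
    (hY : Continuous Y) (hP : ∀ s, InP1 (μ s))
    (hW : ∀ s, Tendsto (fun r => W1 (μ r) (μ s)) (𝓝 s) (𝓝 0)) :
    Field (velBound d B C) (velLip d K C) fun s x => velocity H G (μ s) (Y s) (u s) x := by
  have hC0 : 0 ≤ C := (norm_nonneg _).trans (hC 0)
  refine ⟨?_, fun s x => ?_, fun s x y => ?_, h.velBound_nonneg hC0, h.velLip_nonneg hC0⟩
  · refine Measurable.add ?_ (measurable_leaderField h (hu.comp measurable_fst)
      (hY.measurable.comp measurable_fst) measurable_snd)
    -- The convolution is a Carathéodory function: Lipschitz in `x`, and continuous in `s` because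
    -- the curve is continuous in `W1`.
    refine (stronglyMeasurable_uncurry_of_continuous_of_stronglyMeasurable
      (u := fun (x : Space d) (s : ℝ) => ∫ ξ, H (x - ξ) ∂(μ s)) (fun s => ?_) fun x => ?_).measurable.comp
      measurable_swap
    · have := (hP s).prob
      exact continuous_of_norm_sub_le (h.norm_conv_sub_le (μ s))
    · refine (continuous_iff_continuousAt.2 fun s => ?_).stronglyMeasurable
      exact tendsto_integral_of_W1 hP (hW s) (ψ := fun _ ξ => H (x - ξ)) (Λ := K) (η := fun _ => 0)
        (fun _ y z => h.H.lip_sub' y z x) tendsto_const_nhds (Eventually.of_forall fun r ξ => by simp)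
  · have := (hP s).prob
    exact h.norm_velocity_le _ (hC s) _ _
  · have := (hP s).prob
    exact h.norm_velocity_sub_le _ (hC s) _ _ _

/-- The control is only measurable in time but enters linearly. The rate is therefore a continuous
function plus a finite sum of coordinates of the control times continuous functions of time. -/
theorem measurable_rate (h : Interactions B K H G) (hu : Measurable u)
    (hY : Continuous Y) (hP : ∀ s, InP1 (μ s))
    (hW : ∀ s, Tendsto (fun r => W1 (μ r) (μ s)) (𝓝 s) (𝓝 0)) {A M : ℝ} {g : Space d → ℝ}
    (hg : C11 A M g) :
    Measurable fun s => ∫ x, fderiv ℝ g x (velocity H G (μ s) (Y s) (u s) x) ∂(μ s) := by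
  have hA := hg.A_nonneg
  have hcb : ∀ s x, ‖∫ ξ, H (x - ξ) ∂(μ s)‖ ≤ B := fun s x => by
    have := (hP s).prob
    exact h.norm_conv_le _ _
  have hcl : ∀ s x y, ‖(∫ ξ, H (x - ξ) ∂(μ s)) - ∫ ξ, H (y - ξ) ∂(μ s)‖ ≤ K * ‖x - y‖ :=
    fun s x y => by
      have := (hP s).prob
      exact h.norm_conv_sub_le _ _ _
  have hGl : ∀ s ℓ k (x y : Space d), ‖fderiv ℝ g x (G ℓ (x - Y s k)) -
      fderiv ℝ g y (G ℓ (y - Y s k))‖ ≤ (M * B + A * K) * ‖x - y‖ := fun s ℓ k x y =>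
    hg.norm_apply_sub_le (b := fun x => G ℓ (x - Y s k)) (fun x => (h.G ℓ).bdd _)
      (fun x y => (h.G ℓ).lip_sub _ _ _) x y
  have hHl : ∀ s (x y : Space d), ‖fderiv ℝ g x (∫ ξ, H (x - ξ) ∂(μ s)) -
      fderiv ℝ g y (∫ ξ, H (y - ξ) ∂(μ s))‖ ≤ (M * B + A * K) * ‖x - y‖ := fun s x y =>
    hg.norm_apply_sub_le (b := fun x => ∫ ξ, H (x - ξ) ∂(μ s)) (hcb s) (hcl s) x y
  have e : ∀ s, ∫ x, fderiv ℝ g x (velocity H G (μ s) (Y s) (u s) x) ∂(μ s) =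
      (∫ x, fderiv ℝ g x (∫ ξ, H (x - ξ) ∂(μ s)) ∂(μ s)) +
      ∑ ℓ : Fin d, (m : ℝ)⁻¹ * ∑ k : Fin m, u s k ℓ *
        ∫ x, fderiv ℝ g x (G ℓ (x - Y s k)) ∂(μ s) := by
    intro s
    have := (hP s).prob
    have i1 : Integrable (fun x => fderiv ℝ g x (∫ ξ, H (x - ξ) ∂(μ s))) (μ s) :=
      (hP s).integrable_of_lipschitz (hHl s)
    have i2 : ∀ ℓ k, Integrable (fun x => fderiv ℝ g x (G ℓ (x - Y s k))) (μ s) := fun ℓ k =>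
      (hP s).integrable_of_lipschitz (hGl s ℓ k)
    simp only [velocity_eq, map_add, leaderField, map_sum, map_smul, smul_eq_mul]
    rw [integral_add i1 (integrable_finsetSum _ fun ℓ _ => (integrable_finsetSum _ fun k _ =>
      (i2 ℓ k).const_mul _).const_mul _), integral_finsetSum _ fun ℓ _ =>
      (integrable_finsetSum _ fun k _ => (i2 ℓ k).const_mul _).const_mul _]
    congr 1
    refine Finset.sum_congr rfl fun ℓ _ => ?_
    rw [integral_const_mul, integral_finsetSum _ fun k _ => (i2 ℓ k).const_mul _]
    congr 1
    refine Finset.sum_congr rfl fun k _ => ?_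
    rw [integral_const_mul]
  simp only [e]
  refine Measurable.add ?_ (Finset.measurable_fun_sum _ fun ℓ _ => Measurable.const_mul
    (Finset.measurable_fun_sum _ fun k _ => (measurable_coord hu k ℓ).mul ?_) _)
  · refine (continuous_iff_continuousAt.2 fun s => ?_).measurable
    obtain ⟨η, hη, hη'⟩ := h.tendsto_conv hP (hW s)
    refine tendsto_integral_of_W1 hP (hW s) (η := fun r => A * η r)
      (ψ := fun s x => fderiv ℝ g x (∫ ξ, H (x - ξ) ∂(μ s))) hHl ?_ ?_
    · simpa using hη.const_mul A
    · filter_upwards [hη'] with r hr x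
      rw [← map_sub]
      exact (ContinuousLinearMap.le_opNorm _ _).trans
        (mul_le_mul (hg.bdd _) (hr x) (norm_nonneg _) hA)
  · refine (continuous_iff_continuousAt.2 fun s => ?_).measurable
    refine tendsto_integral_of_W1 hP (hW s) (η := fun r => A * (K * ‖Y r - Y s‖))
      (ψ := fun s x => fderiv ℝ g x (G ℓ (x - Y s k))) (fun s => hGl s ℓ k) ?_
      (Eventually.of_forall fun r x => ?_)
    · have : Continuous fun r => A * (K * ‖Y r - Y s‖) := by fun_prop
      simpa using this.tendsto s
    · rw [← map_sub]
      refine (ContinuousLinearMap.le_opNorm _ _).trans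
        (mul_le_mul (hg.bdd _) ?_ (norm_nonneg _) hA)
      refine ((h.G ℓ).lip_sub' _ _ _).trans ?_
      have := h.K_nonneg
      gcongr
      exact norm_le_pi_norm (Y r - Y s) k

theorem IsMeanFieldSol.tendsto_W1_clamp (hs : IsMeanFieldSol T H G u Y0 μ0 Y μ) (hT : 0 ≤ T)
    (s : ℝ) : Tendsto (fun r => W1 (μ (clampIcc T r)) (μ (clampIcc T s))) (𝓝 s) (𝓝 0) :=
  (hs.continuousμ _ (clampIcc_mem hT s)).comp (tendsto_nhdsWithin_iff.2
    ⟨(continuous_clampIcc T).tendsto s, Eventually.of_forall fun r => clampIcc_mem hT r⟩)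

/-- The velocity field of a solution, extended in time by its end values. -/
def solField (H : Space d → Space d) (G : Fin d → Space d → Space d) (T : ℝ)
    (u : ℝ → Leaders m d) (Y0 : Leaders m d) (μ : ℝ → Measure (Space d)) (s : ℝ) (x : Space d) :
    Space d :=
  velocity H G (μ (clampIcc T s)) (leaderPath u Y0 s) (u s) x

theorem IsMeanFieldSol.field (hs : IsMeanFieldSol T H G u Y0 μ0 Y μ) (h : Interactions B K H G)
    (hT : 0 ≤ T) (hu : Measurable u) (hC : ∀ t, ‖u t‖ ≤ C) :
    Field (velBound d B C) (velLip d K C) (solField H G T u Y0 μ) :=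
  field_of_curve h hu hC (continuous_leaderPath hu hC Y0)
    (fun s => hs.inP1 _ (clampIcc_mem hT s)) (hs.tendsto_W1_clamp hT)

theorem IsMeanFieldSol.transported (hs : IsMeanFieldSol T H G u Y0 μ0 Y μ)
    (h : Interactions B K H G) (hT : 0 ≤ T) (hu : Measurable u) (hC : ∀ t, ‖u t‖ ≤ C) {R : ℝ}
    (hR : ∀ t ∈ Icc 0 T, SuppIn R (μ t)) :
    Transported T R (solField H G T u Y0 μ) fun s => μ (clampIcc T s) := by
  have hP : ∀ s, InP1 (μ (clampIcc T s)) := fun s => hs.inP1 _ (clampIcc_mem hT s)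
  refine ⟨hP, fun s => hR _ (clampIcc_mem hT s), fun A M g hg => ?_, fun φ hφ hφc t ht => ?_⟩
  · exact measurable_rate h hu (continuous_leaderPath hu hC Y0) hP (hs.tendsto_W1_clamp hT) hg
  · have h0 : clampIcc T 0 = 0 := clampIcc_of_mem ⟨le_rfl, hT⟩
    rw [clampIcc_of_mem ht, h0, hs.initial, hs.followers φ hφ hφc t ht]
    congr 1
    refine intervalIntegral.integral_congr fun s hs' => ?_
    rw [uIcc_of_le ht.1] at hs'
    have hs2 : s ∈ Icc 0 T := ⟨hs'.1, hs'.2.trans ht.2⟩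
    simp only [solField, clampIcc_of_mem hs2, hs.eq_leaderPath hs2]

/-- The vector-valued difference `D` of the integrals is tested with the scalar function `⟨D, F⟩`,
so passing from scalar to vector-valued functions costs no dimensional constant. -/
theorem norm_integral_sub_le_of_scalar {P P' : Measure (Space d)} (hP : InP1 P) (hP' : InP1 P')
    {S : ℝ} (hS : ∀ (ψ : Space d → ℝ) (Λ : ℝ), 0 ≤ Λ →
      (∀ x y, ‖ψ x - ψ y‖ ≤ Λ * ‖x - y‖) → ‖∫ x, ψ x ∂P - ∫ x, ψ x ∂P'‖ ≤ Λ * S)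
    {F : Space d → Space d} {K : ℝ} (hK : 0 ≤ K) (hF : ∀ x y, ‖F x - F y‖ ≤ K * ‖x - y‖) :
    ‖∫ x, F x ∂P - ∫ x, F x ∂P'‖ ≤ K * S := by
  set D := ∫ x, F x ∂P - ∫ x, F x ∂P' with hD
  have h1 := hS (fun x => inner ℝ D (F x)) (K * ‖D‖) (by positivity) fun x y => by
    rw [← inner_sub_right]
    refine (norm_inner_le_norm _ _).trans ?_
    calc ‖D‖ * ‖F x - F y‖ ≤ ‖D‖ * (K * ‖x - y‖) := by gcongr; exact hF x y
      _ = _ := by ring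
  rw [integral_inner (hP.integrable_of_lipschitz hF), integral_inner (hP'.integrable_of_lipschitz hF),
    ← inner_sub_right, ← hD, real_inner_self_eq_norm_sq, norm_pow, norm_norm] at h1
  rcases eq_or_ne D 0 with h0 | h0
  · rw [h0, norm_zero]
    -- No sign of `S` is assumed; the zero function with Lipschitz constant `K` supplies `0 ≤ K *
    -- S`.
    have h2 := hS (fun _ => 0) K hK fun x y => by simp; positivity
    simpa using h2
  · have h2 : 0 < ‖D‖ := norm_pos_iff.2 h0
    nlinarith

/-- A bound on the dual Lipschitz distance bounds the difference of the two velocity fields, because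
the convolution kernel is Lipschitz and the leaders' forces coincide. The comparison of transported
curves feeds this back into the distance with a gain of `1 / 2` in the weight `exp (η * r)`, and
iteration drives the distance to zero. -/
theorem IsMeanFieldSol.unique {Z : ℝ → Leaders m d} {ν : ℝ → Measure (Space d)}
    (h : Interactions B K H G) (hT : 0 ≤ T) (hu : Measurable u) (hC : ∀ t, ‖u t‖ ≤ C)
    (hs : IsMeanFieldSol T H G u Y0 μ0 Y μ) (hs' : IsMeanFieldSol T H G u Y0 μ0 Z ν)
    {t : ℝ} (ht : t ∈ Icc 0 T) : μ t = ν t := by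
  obtain ⟨R1, hR1⟩ := hs.compactSupport
  obtain ⟨R2, hR2⟩ := hs'.compactSupport
  set R := max (max R1 R2) 0 with hR
  have hR0 : 0 ≤ R := le_max_right _ _
  have hμR : ∀ t ∈ Icc 0 T, SuppIn R (μ t) := fun t ht =>
    (hR1 t ht).mono ((le_max_left _ _).trans (le_max_left _ _))
  have hνR : ∀ t ∈ Icc 0 T, SuppIn R (ν t) := fun t ht =>
    (hR2 t ht).mono ((le_max_right _ _).trans (le_max_left _ _))
  have hC0 : 0 ≤ C := (norm_nonneg _).trans (hC 0)
  have hK := h.K_nonneg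
  have tμ := hs.transported h hT hu hC hμR
  have tν := hs'.transported h hT hu hC hνR
  have fμ := hs.field h hT hu hC
  have fν := hs'.field h hT hu hC
  set κ := velLip d K C with hκdef
  have hκ : 0 ≤ κ := h.velLip_nonneg hC0
  set E := Real.exp (3 * κ * T) with hE
  have hE0 : 0 < E := Real.exp_pos _
  -- Integrating the weight in time yields a factor `1 / η`, and this choice makes `E * K / η ≤ 1 /
  -- 2`.
  set η := 2 * (E * K) + 1 with hη
  have hη0 : 0 < η := by positivity
  let Close (S : ℝ) : Prop := ∀ r ∈ Icc 0 T, ∀ (ψ : Space d → ℝ) (Λ : ℝ), 0 ≤ Λ →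
    (∀ x y, ‖ψ x - ψ y‖ ≤ Λ * ‖x - y‖) →
    ‖∫ x, ψ x ∂(μ r) - ∫ x, ψ x ∂(ν r)‖ ≤ Λ * (S * Real.exp (η * r))
  -- Both measures live in the ball of radius `R`, so each integral differs from `ψ 0` by at most `Λ
  -- * R`.
  have hbase : Close (2 * R) := by
    intro r hr ψ Λ hΛ hψ
    have hone : 1 ≤ Real.exp (η * r) := Real.one_le_exp (mul_nonneg hη0.le hr.1)
    have hb : ∀ (P : Measure (Space d)), InP1 P → SuppIn R P → ‖∫ x, ψ x ∂P - ψ 0‖ ≤ Λ * R := by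
      intro P hP hPR
      have := hP.prob
      have e1 : ∫ x, ψ x ∂P - ψ 0 = ∫ x, (ψ x - ψ 0) ∂P := by
        rw [integral_sub (hP.integrable_of_lipschitz hψ) (integrable_const _)]; simp
      rw [e1]
      have := norm_integral_le_of_norm_le_const (μ := P) (f := fun x => ψ x - ψ 0) (C := Λ * R)
        (hPR.ae_norm_le.mono fun x hx => (hψ x 0).trans (by rw [sub_zero]; gcongr))
      simpa using this
    have h1 := hb _ (hs.inP1 r hr) (hμR r hr)
    have h2 := hb _ (hs'.inP1 r hr) (hνR r hr)
    have h3 : Λ * (2 * R) * 1 ≤ Λ * (2 * R) * Real.exp (η * r) := by gcongr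
    refine (norm_sub_le_norm_sub_add_norm_sub _ (ψ 0) _).trans ?_
    rw [norm_sub_rev (ψ 0)]
    linarith
  have hstep : ∀ S, 0 ≤ S → Close S → Close (S / 2) := by
    intro S hS hcl r hr ψ Λ hΛ hψ
    have h0 : (fun s => μ (clampIcc T s)) 0 = (fun s => ν (clampIcc T s)) 0 := by
      simp only [clampIcc_of_mem (T := T) ⟨le_rfl, hT⟩, hs.initial, hs'.initial]
    have hβ : Continuous fun r => K * (S * Real.exp (η * r)) := by fun_prop
    have h1 := tμ.norm_integral_sub_le_of_lipschitz tν fμ fν h0 hβ (fun r => by positivity)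
      (fun q hq x => ?_) hΛ hψ hr
    · simp only [clampIcc_of_mem hr] at h1
      refine h1.trans ?_
      have h2 : ∫ q in (0 : ℝ)..r, K * (S * Real.exp (η * q)) ≤
          K * (S * (η⁻¹ * Real.exp (η * r))) := by
        rw [intervalIntegral.integral_const_mul, intervalIntegral.integral_const_mul,
          intervalIntegral.integral_comp_mul_left (fun s => Real.exp s) hη0.ne', integral_exp,
          smul_eq_mul]
        gcongr
        have := Real.exp_pos (η * 0)
        linarith
      have h3 : Real.exp (3 * κ * r) ≤ E := by
        rw [hE]; gcongr; exact hr.2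
      have h4 : E * K * η⁻¹ ≤ 1 / 2 := by
        rw [← div_eq_mul_inv, div_le_iff₀ hη0]; linarith
      calc _ ≤ Λ * E * (K * (S * (η⁻¹ * Real.exp (η * r)))) := by
            have : 0 ≤ ∫ q in (0 : ℝ)..r, K * (S * Real.exp (η * q)) :=
              intervalIntegral.integral_nonneg hr.1 fun _ _ => by positivity
            gcongr
        _ = (E * K * η⁻¹) * (Λ * (S * Real.exp (η * r))) := by ring
        _ ≤ (1 / 2) * (Λ * (S * Real.exp (η * r))) := by gcongr
        _ = _ := by ring
    · simp only [solField, velocity_eq, clampIcc_of_mem hq, add_sub_add_right_eq_sub]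
      rw [norm_sub_rev]
      exact norm_integral_sub_le_of_scalar (hs.inP1 q hq) (hs'.inP1 q hq)
        (hcl q hq) hK fun y z => h.H.lip_sub' y z x
  have hall : ∀ n : ℕ, Close (2 * R / 2 ^ n) := by
    intro n
    induction n with
    | zero => simpa using hbase
    | succ n ih =>
      have := hstep _ (by positivity) ih
      rwa [div_div, ← pow_succ] at this
  have := (hs.inP1 t ht).prob
  have := (hs'.inP1 t ht).prob
  refine measure_eq_of_lipschitz fun ψ Λ hΛ hψ => ?_
  have hlim : Tendsto (fun n : ℕ => Λ * (2 * R / 2 ^ n * Real.exp (η * t))) atTop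
      (𝓝 (Λ * (0 * Real.exp (η * t)))) :=
    ((tendsto_const_nhds.div_atTop (tendsto_pow_atTop_atTop_of_one_lt one_lt_two)).mul_const
      _).const_mul _
  rw [zero_mul, mul_zero] at hlim
  have h1 := ge_of_tendsto hlim (Eventually.of_forall fun n => hall n t ht ψ Λ hΛ hψ)
  exact sub_eq_zero.1 (norm_le_zero_iff.1 h1)

end Uniqueness

end LeaderFollower
end

noncomputable section

namespace LeaderFollower

/-- The integral form of Grönwall's inequality. -/
theorem gronwall_integral {e : ℝ → ℝ} {a Λ T : ℝ} (he : Continuous e) (he0 : ∀ t, 0 ≤ e t)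
    (ha : 0 ≤ a) (hΛ : 0 ≤ Λ) (h : ∀ t ∈ Icc 0 T, e t ≤ a + Λ * ∫ s in (0 : ℝ)..t, e s) {t : ℝ}
    (ht : t ∈ Icc 0 T) : e t ≤ a * Real.exp (Λ * t) := by
  -- The differential inequality is applied to the right-hand side, which is differentiable, since
  -- `e` is only continuous.
  have hd : ∀ t, HasDerivAt (fun t => a + Λ * ∫ s in (0 : ℝ)..t, e s) (Λ * e t) t := fun t =>
    ((intervalIntegral.integral_hasDerivAt_right (he.intervalIntegrable _ _)
      (he.stronglyMeasurableAtFilter _ _) he.continuousAt).const_mul Λ).const_add a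
  have hnn : ∀ t, 0 ≤ t → 0 ≤ a + Λ * ∫ s in (0 : ℝ)..t, e s := fun t ht => by
    have : 0 ≤ ∫ s in (0 : ℝ)..t, e s := intervalIntegral.integral_nonneg ht fun s _ => he0 s
    positivity
  have := norm_le_gronwallBound_of_norm_deriv_right_le (a := 0) (b := T) (δ := a) (K := Λ) (ε := 0)
    (fun t _ => (hd t).continuousAt.continuousWithinAt) (fun t _ => (hd t).hasDerivWithinAt)
    (by simp [abs_of_nonneg ha]) (fun t ht => by
      rw [Real.norm_of_nonneg (mul_nonneg hΛ (he0 t)), Real.norm_of_nonneg (hnn t ht.1), add_zero]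
      exact mul_le_mul_of_nonneg_left (h t ⟨ht.1, ht.2.le⟩) hΛ) t ht
  rw [gronwallBound_ε0, sub_zero, Real.norm_of_nonneg (hnn t ht.1)] at this
  exact (h t ht).trans this

/-! ### Modifications of controls on null sets -/

section Modification

variable {m d N : ℕ} {T : ℝ} {U : Set (Leaders m d)} {H : Space d → Space d}
  {G : Fin d → Space d → Space d} {u v Y : ℝ → Leaders m d} {Y0 : Leaders m d}

/-- Null sets of times affect neither the equations nor the cost. A Borel representative with values
in `U` at every time lets later estimates use bounds that hold for all `t`. -/
theorem Admissible.exists_measurable (hU : IsClosed U) (hne : U.Nonempty) (hu : Admissible T U u) :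
    ∃ v : ℝ → Leaders m d, Measurable v ∧ (∀ t, v t ∈ U) ∧
      u =ᵐ[volume.restrict (Icc 0 T)] v := by
  obtain ⟨u0, hu0⟩ := hne
  set w := hu.measurable.mk u with hw
  have hwm : Measurable w := hu.measurable.stronglyMeasurable_mk.measurable
  classical
  refine ⟨fun t => if w t ∈ U then w t else u0, ?_, fun t => ?_, ?_⟩
  · exact Measurable.ite (hwm hU.measurableSet) hwm measurable_const
  · beta_reduce
    split_ifs with h
    exacts [h, hu0]
  · filter_upwards [hu.measurable.ae_eq_mk, hu.mem] with t h1 h2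
    rw [if_pos (by rw [hw, ← h1]; exact h2), h1]

theorem admissible_of_forall_mem (hv : Measurable v) (hvU : ∀ t, v t ∈ U) : Admissible T U v :=
  ⟨hv.aestronglyMeasurable, Eventually.of_forall hvU⟩

theorem intervalIntegral_congr_control {F : Type*} [NormedAddCommGroup F] [NormedSpace ℝ F]
    (huv : u =ᵐ[volume.restrict (Icc 0 T)] v) {t : ℝ} (ht : t ∈ Icc 0 T)
    {f : ℝ → Leaders m d → F} :
    ∫ s in (0 : ℝ)..t, f s (u s) = ∫ s in (0 : ℝ)..t, f s (v s) := by
  refine intervalIntegral.integral_congr_ae ?_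
  have := (ae_restrict_iff' measurableSet_Icc).1 huv
  filter_upwards [this] with s hs hst
  rw [uIoc_of_le ht.1] at hst
  rw [hs ⟨hst.1.le, hst.2.trans ht.2⟩]

theorem IsLeaderPath.congr (huv : u =ᵐ[volume.restrict (Icc 0 T)] v)
    (h : IsLeaderPath T u Y0 Y) : IsLeaderPath T v Y0 Y := fun t ht k => by
  rw [h t ht k, intervalIntegral_congr_control huv ht (f := fun _ w => w k)]

theorem IsMeanFieldSol.congr {μ0 : Measure (Space d)} {μ : ℝ → Measure (Space d)}
    (huv : u =ᵐ[volume.restrict (Icc 0 T)] v) (h : IsMeanFieldSol T H G u Y0 μ0 Y μ) :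
    IsMeanFieldSol T H G v Y0 μ0 Y μ :=
  { h with
    leaders := h.leaders.congr huv
    followers := fun φ hφ hφc t ht => by
      rw [h.followers φ hφ hφc t ht, intervalIntegral_congr_control huv ht
        (f := fun s w => ∫ x, fderiv ℝ φ x (velocity H G (μ s) (Y s) w x) ∂(μ s))] }

theorem IsFiniteSol.congr {X0 : Fin N → Space d} {X : ℝ → Fin N → Space d}
    (huv : u =ᵐ[volume.restrict (Icc 0 T)] v) (h : IsFiniteSol T H G u Y0 X0 Y X) :
    IsFiniteSol T H G v Y0 X0 Y X :=
  { h with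
    leaders := h.leaders.congr huv
    followers := fun t ht i => by
      rw [h.followers t ht i, intervalIntegral_congr_control huv ht
        (f := fun s w => velocity H G (empirical (X s)) (Y s) w (X s i))] }

theorem cost_congr {L : Leaders m d → Measure (Space d) → ℝ} {Z : ℝ → Leaders m d}
    {μ ν : ℝ → Measure (Space d)} (hT : 0 ≤ T)
    (huv : u =ᵐ[volume.restrict (Icc 0 T)] v) (hYZ : ∀ t ∈ Icc 0 T, Y t = Z t)
    (hμν : ∀ t ∈ Icc 0 T, μ t = ν t) : cost T L u Y μ = cost T L v Z ν := by
  unfold cost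
  rw [intervalIntegral_congr_control huv ⟨hT, le_rfl⟩
    (f := fun t w => L (Y t) (μ t) + ∑ k, ‖w k‖ ^ 2)]
  refine intervalIntegral.integral_congr fun t ht => ?_
  rw [uIcc_of_le hT] at ht
  simp only [hYZ t ht, hμν t ht]

end Modification

/-! ### Truncation of the interactions -/

section Truncation

variable {m d N : ℕ}

/-- Local Lipschitz continuity is uniform on a compact ball, and a 1-Lipschitz cutoff with values in
`[0, 1]` extends it globally. The sup bound `B` is unchanged; this matters because the ball that
contains the trajectories is computed from `B` before the truncation radius is chosen. -/
theorem HypHFun.exists_bddLip {F : Space d → Space d} (hF : HypHFun F) {B : ℝ}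
    (hB : ∀ ξ, ‖F ξ‖ ≤ B) (R : ℝ) :
    ∃ (F' : Space d → Space d) (K : ℝ), 0 ≤ K ∧ BddLip B K F' ∧ ∀ ξ, ‖ξ‖ ≤ R → F' ξ = F ξ := by
  have hB0 : 0 ≤ B := (norm_nonneg _).trans (hB 0)
  obtain ⟨K1, hK1⟩ := LocallyLipschitzOn.exists_lipschitzOnWith_of_compact
    (isCompact_closedBall (0 : Space d) (R + 1)) hF.locallyLipschitz.locallyLipschitzOn
  set χ : Space d → ℝ := fun ξ => max 0 (min 1 (R + 1 - ‖ξ‖)) with hχ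
  have hχ0 : ∀ ξ, 0 ≤ χ ξ := fun ξ => le_max_left _ _
  have hχ1 : ∀ ξ, χ ξ ≤ 1 := fun ξ => max_le zero_le_one (min_le_left _ _)
  have hχl : ∀ x y, |χ x - χ y| ≤ ‖x - y‖ := fun x y => by
    simp only [hχ]
    rw [max_comm 0, max_comm 0]
    refine (abs_max_sub_max_le_abs _ _ 0).trans ?_
    rw [min_comm 1, min_comm 1]
    refine (abs_min_sub_min_le_max _ _ _ _).trans ?_
    rw [sub_self, abs_zero, sub_sub_sub_cancel_left, max_eq_left (abs_nonneg _), norm_sub_rev]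
    exact abs_norm_sub_norm_le _ _
  have hχout : ∀ x, x ∉ Metric.closedBall (0 : Space d) (R + 1) → χ x = 0 := fun x hx => by
    have : R + 1 < ‖x‖ := by simpa using hx
    simp only [hχ]
    exact max_eq_left ((min_le_right _ _).trans (by linarith))
  -- The function `F` is controlled only on the ball; when one point lies outside, the cutoff at the
  -- other is at most the distance of the two points, and the sup bound suffices.
  have hout : ∀ x y, y ∉ Metric.closedBall (0 : Space d) (R + 1) →
      ‖χ x • F x - χ y • F y‖ ≤ (K1 + B) * ‖x - y‖ := fun x y hy => by
    have h1 := hχl x y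
    rw [hχout y hy, sub_zero, abs_of_nonneg (hχ0 x)] at h1
    rw [hχout y hy, zero_smul, sub_zero, norm_smul, Real.norm_of_nonneg (hχ0 x)]
    calc χ x * ‖F x‖ ≤ ‖x - y‖ * B := by gcongr; exact hB x
      _ ≤ (K1 + B) * ‖x - y‖ := by
        have : 0 ≤ (K1 : ℝ) * ‖x - y‖ := by positivity
        linarith
  refine ⟨fun ξ => χ ξ • F ξ, K1 + B, by positivity, ⟨fun ξ => ?_, fun x y => ?_⟩, fun ξ hξ => ?_⟩
  · rw [norm_smul, Real.norm_of_nonneg (hχ0 ξ)]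
    calc χ ξ * ‖F ξ‖ ≤ 1 * B := by gcongr; exacts [hχ1 ξ, hB ξ]
      _ = B := one_mul B
  · by_cases hy : y ∈ Metric.closedBall (0 : Space d) (R + 1)
    · by_cases hx : x ∈ Metric.closedBall (0 : Space d) (R + 1)
      · have h1 := hK1.dist_le_mul x hx y hy
        rw [dist_eq_norm, dist_eq_norm] at h1
        have h2 : χ x • F x - χ y • F y = χ x • (F x - F y) + (χ x - χ y) • F y := by
          rw [smul_sub, sub_smul]; abel
        rw [h2]
        refine (norm_add_le _ _).trans ?_
        rw [norm_smul, norm_smul, Real.norm_of_nonneg (hχ0 x), Real.norm_eq_abs]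
        have h3 : χ x * ‖F x - F y‖ ≤ 1 * (K1 * ‖x - y‖) := by gcongr; exact hχ1 x
        have h4 : |χ x - χ y| * ‖F y‖ ≤ ‖x - y‖ * B := by
          gcongr
          exacts [hχl x y, hB y]
        linarith
      · have := hout y x hx
        rwa [norm_sub_rev, norm_sub_rev y x] at this
    · exact hout x y hy
  · have : χ ξ = 1 := by
      simp only [hχ]
      rw [min_eq_left (by linarith), max_eq_right zero_le_one]
    simp [this]

/-- Two families of interactions that agree on the ball of radius `R`. -/
structure AgreeOn (R : ℝ) (H H' : Space d → Space d) (G G' : Fin d → Space d → Space d) :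
    Prop where
  H : ∀ ξ, ‖ξ‖ ≤ R → H ξ = H' ξ
  G : ∀ ℓ ξ, ‖ξ‖ ≤ R → G ℓ ξ = G' ℓ ξ

theorem AgreeOn.symm {R : ℝ} {H H' : Space d → Space d} {G G' : Fin d → Space d → Space d}
    (h : AgreeOn R H H' G G') : AgreeOn R H' H G' G :=
  ⟨fun ξ hξ => (h.H ξ hξ).symm, fun ℓ ξ hξ => (h.G ℓ ξ hξ).symm⟩

theorem HypH.exists_bound {H : Space d → Space d} {G : Fin d → Space d → Space d}
    (h : HypH H G) : ∃ B : ℝ, 0 ≤ B ∧ (∀ ξ, ‖H ξ‖ ≤ B) ∧ ∀ ℓ ξ, ‖G ℓ ξ‖ ≤ B := by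
  obtain ⟨B1, hB1⟩ := h.hypH.bounded
  choose B2 hB2 using fun ℓ => (h.hypG ℓ).bounded
  have hB20 : ∀ ℓ, 0 ≤ B2 ℓ := fun ℓ => (norm_nonneg _).trans (hB2 ℓ 0)
  have hB10 : 0 ≤ B1 := (norm_nonneg _).trans (hB1 0)
  refine ⟨B1 + ∑ ℓ, B2 ℓ, add_nonneg hB10 (Finset.sum_nonneg fun ℓ _ => hB20 ℓ),
    fun ξ => (hB1 ξ).trans (le_add_of_nonneg_right (Finset.sum_nonneg fun ℓ _ => hB20 ℓ)),
    fun ℓ ξ => (hB2 ℓ ξ).trans ?_⟩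
  exact (Finset.single_le_sum (fun ℓ _ => hB20 ℓ) (Finset.mem_univ ℓ)).trans
    (le_add_of_nonneg_left hB10)

theorem HypH.exists_interactions {H : Space d → Space d} {G : Fin d → Space d → Space d}
    (h : HypH H G) {B : ℝ} (hB0 : 0 ≤ B) (hH : ∀ ξ, ‖H ξ‖ ≤ B) (hG : ∀ ℓ ξ, ‖G ℓ ξ‖ ≤ B) (R : ℝ) :
    ∃ H' G' K, Interactions B K H' G' ∧ AgreeOn R H H' G G' := by
  obtain ⟨H', K1, hK1, hH', hHR⟩ := h.hypH.exists_bddLip hH R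
  choose G' K2 hK2 hG' hGR using fun ℓ => (h.hypG ℓ).exists_bddLip (hG ℓ) R
  have hs : 0 ≤ ∑ ℓ, K2 ℓ := Finset.sum_nonneg fun ℓ _ => hK2 ℓ
  refine ⟨H', G', K1 + ∑ ℓ, K2 ℓ, ⟨hB0, by positivity, ⟨hH'.bdd, fun x y => ?_⟩,
    fun ℓ => ⟨(hG' ℓ).bdd, fun x y => ?_⟩⟩, fun ξ hξ => (hHR ξ hξ).symm,
    fun ℓ ξ hξ => (hGR ℓ ξ hξ).symm⟩
  · refine (hH'.lip x y).trans ?_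
    gcongr
    linarith
  · refine ((hG' ℓ).lip x y).trans ?_
    gcongr
    exact (Finset.single_le_sum (fun ℓ _ => hK2 ℓ) (Finset.mem_univ ℓ)).trans
      (le_add_of_nonneg_left hK1)

variable {H H' : Space d → Space d} {G G' : Fin d → Space d → Space d} {R T : ℝ}

/-- Interactions are evaluated at differences of two points of the ball of radius `R`, hence
agreement on radius `2 * R`. -/
theorem AgreeOn.velocity_eq (h : AgreeOn (2 * R) H H' G G') {μ : Measure (Space d)}
    (hμ : SuppIn R μ) {Y : Leaders m d} (hY : ‖Y‖ ≤ R) (u : Leaders m d) {x : Space d}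
    (hx : ‖x‖ ≤ R) : velocity H G μ Y u x = velocity H' G' μ Y u x := by
  unfold velocity
  congr 1
  · refine integral_congr_ae (hμ.ae_norm_le.mono fun ξ hξ => h.H _ ?_)
    exact (norm_sub_le _ _).trans (by linarith)
  · refine Finset.sum_congr rfl fun ℓ _ => ?_
    congr 1
    refine Finset.sum_congr rfl fun k _ => ?_
    rw [h.G]
    have := norm_le_pi_norm Y k
    exact (norm_sub_le _ _).trans (by linarith)

theorem AgreeOn.isMeanFieldSol (h : AgreeOn (2 * R) H H' G G') {u Y : ℝ → Leaders m d}
    {Y0 : Leaders m d} {μ0 : Measure (Space d)} {μ : ℝ → Measure (Space d)}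
    (hμ : ∀ t ∈ Icc 0 T, SuppIn R (μ t)) (hY : ∀ t ∈ Icc 0 T, ‖Y t‖ ≤ R)
    (hs : IsMeanFieldSol T H G u Y0 μ0 Y μ) : IsMeanFieldSol T H' G' u Y0 μ0 Y μ :=
  { hs with
    followers := fun φ hφ hφc t ht => by
      rw [hs.followers φ hφ hφc t ht]
      congr 1
      refine intervalIntegral.integral_congr fun s hst => ?_
      rw [uIcc_of_le ht.1] at hst
      have hsT : s ∈ Icc 0 T := ⟨hst.1, hst.2.trans ht.2⟩
      refine integral_congr_ae ((hμ s hsT).ae_norm_le.mono fun x hx => ?_)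
      simp only [h.velocity_eq (hμ s hsT) (hY s hsT) _ hx] }

theorem isProbabilityMeasure_empirical (hN : 1 ≤ N) (X : Fin N → Space d) :
    IsProbabilityMeasure (empirical X) := by
  refine ⟨?_⟩
  have : (N : ℝ≥0∞) ≠ 0 := by exact_mod_cast (by omega : N ≠ 0)
  simp [empirical, ENNReal.inv_mul_cancel this]

theorem suppIn_empirical {X : Fin N → Space d} (hX : ∀ i, ‖X i‖ ≤ R) :
    SuppIn R (empirical X) := by
  unfold SuppIn empirical
  have : ∀ i, X i ∉ (Metric.closedBall (0 : Space d) R)ᶜ := fun i => by simpa using hX i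
  simp [this]

theorem map_empirical (X : Fin N → Space d) {f : Space d → Space d} (hf : Measurable f) :
    (empirical X).map f = empirical fun i => f (X i) := by
  unfold empirical
  rw [Measure.map_smul, Measure.map_finset_sum]
  · congr 1
    refine Finset.sum_congr rfl fun i _ => Measure.map_dirac' hf _
  · exact hf.aemeasurable

theorem integral_empirical {F : Type*} [NormedAddCommGroup F] [NormedSpace ℝ F] [CompleteSpace F]
    (X : Fin N → Space d) (f : Space d → F) :
    ∫ x, f x ∂(empirical X) = (N : ℝ)⁻¹ • ∑ i, f (X i) := by
  unfold empirical
  rw [integral_smul_measure, integral_finsetSum_measure]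
  · simp
  · exact fun i _ => integrable_dirac (by simp)

theorem AgreeOn.isFiniteSol (h : AgreeOn (2 * R) H H' G G') {u Y : ℝ → Leaders m d}
    {Y0 : Leaders m d} {X0 : Fin N → Space d} {X : ℝ → Fin N → Space d}
    (hX : ∀ t ∈ Icc 0 T, ∀ i, ‖X t i‖ ≤ R) (hY : ∀ t ∈ Icc 0 T, ‖Y t‖ ≤ R)
    (hs : IsFiniteSol T H G u Y0 X0 Y X) : IsFiniteSol T H' G' u Y0 X0 Y X :=
  { hs with
    followers := fun t ht i => by
      rw [hs.followers t ht i]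
      congr 1
      refine intervalIntegral.integral_congr fun s hst => ?_
      rw [uIcc_of_le ht.1] at hst
      have hsT : s ∈ Icc 0 T := ⟨hst.1, hst.2.trans ht.2⟩
      exact h.velocity_eq (suppIn_empirical (hX s hsT)) (hY s hsT) _ (hX s hsT i) }

end Truncation

end LeaderFollower
end

noncomputable section

namespace LeaderFollower

/-! ### Well-posedness of both systems for locally Lipschitz interactions -/

section WellPosed

variable {m d N : ℕ} {B K C T R : ℝ} {H H' : Space d → Space d} {G G' : Fin d → Space d → Space d}
  {u Y Z : ℝ → Leaders m d} {Y0 : Leaders m d} {μ0 : Measure (Space d)}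
  {μ : ℝ → Measure (Space d)} {X0 : Fin N → Space d} {X W : ℝ → Fin N → Space d}

theorem Interactions.exists_isFlow (h : Interactions B K H G) (hu : Measurable u)
    (hC : ∀ t, ‖u t‖ ≤ C) (Y0 : Leaders m d) (hμ0 : InP1 μ0) :
    ∃ Φ, IsFlow H G u (leaderPath u Y0) μ0 Φ := by
  have := hμ0.prob
  exact LeaderFollower.exists_isFlow h hu hC (continuous_leaderPath hu hC Y0)

theorem norm_leaderPath_le (hu : Measurable u) (hC : ∀ t, ‖u t‖ ≤ C) (Y0 : Leaders m d) {t : ℝ}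
    (ht : t ∈ Icc 0 T) : ‖leaderPath u Y0 t‖ ≤ ‖Y0‖ + C * T := by
  have hC0 : 0 ≤ C := (norm_nonneg _).trans (hC 0)
  have h1 := norm_leaderPath_sub_le hu hC Y0 0 t
  have h0 : leaderPath u Y0 0 = Y0 := by
    funext k; simp [leaderPath]
  rw [h0, sub_zero, abs_of_nonneg ht.1] at h1
  have h2 := norm_le_norm_add_norm_sub Y0 (leaderPath u Y0 t)
  rw [norm_sub_rev] at h2
  have : C * t ≤ C * T := by gcongr; exact ht.2
  linarith

/-- Through this identification, bounds and stability proved for flows hold for arbitrary weak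
solutions. -/
theorem IsMeanFieldSol.eq_map_flow {Φ : ℝ → Space d → Space d} (h : Interactions B K H G)
    (hT : 0 ≤ T) (hu : Measurable u) (hC : ∀ t, ‖u t‖ ≤ C) (hμ0 : InP1 μ0) (hR : SuppIn R μ0)
    (hΦ : IsFlow H G u (leaderPath u Y0) μ0 Φ) (hs : IsMeanFieldSol T H G u Y0 μ0 Y μ) {t : ℝ}
    (ht : t ∈ Icc 0 T) : μ t = μ0.map (Φ t) := by
  have := hμ0.prob
  exact hs.unique h hT hu hC (hΦ.isMeanFieldSol h hu hC hR) ht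

theorem IsMeanFieldSol.suppIn (h : Interactions B K H G)
    (hT : 0 ≤ T) (hu : Measurable u) (hC : ∀ t, ‖u t‖ ≤ C) (hμ0 : InP1 μ0) (hR : SuppIn R μ0)
    (hs : IsMeanFieldSol T H G u Y0 μ0 Y μ) {t : ℝ} (ht : t ∈ Icc 0 T) :
    SuppIn (R + velBound d B C * T) (μ t) := by
  obtain ⟨Φ, hΦ⟩ := h.exists_isFlow hu hC Y0 hμ0
  have := hμ0.prob
  rw [hs.eq_map_flow h hT hu hC hμ0 hR hΦ ht]
  exact hΦ.suppIn h hu hC (continuous_leaderPath hu hC Y0) ht hR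

theorem norm_velocity_le_of_bdd (hB : 0 ≤ B) (hH : ∀ ξ, ‖H ξ‖ ≤ B) (hG : ∀ ℓ ξ, ‖G ℓ ξ‖ ≤ B)
    (μ : Measure (Space d)) [IsProbabilityMeasure μ] {w : Leaders m d} (hw : ‖w‖ ≤ C)
    (Y : Leaders m d) (x : Space d) : ‖velocity H G μ Y w x‖ ≤ velBound d B C :=
  (norm_add_le _ _).trans (add_le_add (norm_integral_le_of_prob fun _ => hH _)
    (norm_leaderSum_le hw hB fun ℓ _ => hG ℓ _))

theorem IsFiniteSol.norm_le (hB : 0 ≤ B) (hH : ∀ ξ, ‖H ξ‖ ≤ B) (hG : ∀ ℓ ξ, ‖G ℓ ξ‖ ≤ B)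
    (hN : 1 ≤ N) (hC : ∀ t, ‖u t‖ ≤ C) (hX0 : ∀ i, ‖X0 i‖ ≤ R)
    (hs : IsFiniteSol T H G u Y0 X0 Y X) {t : ℝ} (ht : t ∈ Icc 0 T) (i : Fin N) :
    ‖X t i‖ ≤ R + velBound d B C * T := by
  have hC0 : 0 ≤ C := (norm_nonneg _).trans (hC 0)
  have hV : 0 ≤ velBound d B C := by unfold velBound; positivity
  rw [hs.followers t ht i]
  have h1 := intervalIntegral.norm_integral_le_of_norm_le_const (a := 0) (b := t)
    (f := fun s => velocity H G (empirical (X s)) (Y s) (u s) (X s i)) (C := velBound d B C)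
    fun s _ => by
      have := isProbabilityMeasure_empirical hN (X s)
      exact norm_velocity_le_of_bdd hB hH hG _ (hC s) _ _
  rw [sub_zero, abs_of_nonneg ht.1] at h1
  have h2 : velBound d B C * t ≤ velBound d B C * T := by gcongr; exact ht.2
  exact (norm_add_le _ _).trans (add_le_add (hX0 i) (h1.trans h2))

theorem IsFiniteSol.eq_leaderPath (hs : IsFiniteSol T H G u Y0 X0 Y X) {t : ℝ}
    (ht : t ∈ Icc 0 T) : Y t = leaderPath u Y0 t := funext fun k => hs.leaders t ht k

/-- The flow moves the atoms of an empirical datum, and the image measure is the empirical measure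
of the moved atoms. Existence for the finite system is thus a special case of the existence of
flows. -/
theorem IsFlow.isFiniteSol {Φ : ℝ → Space d → Space d}
    (hΦ : IsFlow H G u (leaderPath u Y0) (empirical X0) Φ) :
    IsFiniteSol T H G u Y0 X0 (leaderPath u Y0) fun t i => Φ t (X0 i) := by
  refine ⟨fun t _ k => rfl, ?_, fun t ht i => ?_⟩
  · exact (continuous_pi fun i => hΦ.continuous_left (X0 i)).continuousOn
  · rw [hΦ.eq t ht.1]
    congr 1
    refine intervalIntegral.integral_congr fun s _ => ?_
    simp only [map_empirical X0 (hΦ.continuous s).measurable]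

theorem Interactions.norm_conv_empirical_sub_le (h : Interactions B K H G) (hN : 1 ≤ N)
    (x y : Fin N → Space d) (i : Fin N) :
    ‖(∫ ξ, H (x i - ξ) ∂(empirical x)) - ∫ ξ, H (y i - ξ) ∂(empirical y)‖ ≤
      2 * K * ‖x - y‖ := by
  have hN' : (0 : ℝ) < N := by exact_mod_cast hN
  have hK := h.K_nonneg
  rw [integral_empirical, integral_empirical, ← smul_sub, ← Finset.sum_sub_distrib, norm_smul,
    norm_inv, Real.norm_natCast, inv_mul_le_iff₀ hN']
  refine (norm_sum_le_of_le _ (n := fun _ => 2 * K * ‖x - y‖) fun j _ => ?_).trans (by simp)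
  refine (h.H.lip _ _).trans ?_
  rw [sub_sub_sub_comm]
  have h1 := norm_le_pi_norm (x - y) i
  have h2 := norm_le_pi_norm (x - y) j
  have h3 : ‖x i - y i - (x j - y j)‖ ≤ 2 * ‖x - y‖ := (norm_sub_le _ _).trans (by
    simp only [Pi.sub_apply] at h1 h2; linarith)
  calc _ ≤ K * (2 * ‖x - y‖) := by gcongr
    _ = _ := by ring

theorem IsFiniteSol.unique (h : Interactions B K H G) (hT : 0 ≤ T) (hN : 1 ≤ N)
    (hu : Measurable u) (hC : ∀ t, ‖u t‖ ≤ C) (hs : IsFiniteSol T H G u Y0 X0 Y X)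
    (hs' : IsFiniteSol T H G u Y0 X0 Z W) {t : ℝ} (ht : t ∈ Icc 0 T) : X t = W t := by
  have hC0 : 0 ≤ C := (norm_nonneg _).trans (hC 0)
  have hK := h.K_nonneg
  have hYc := continuous_leaderPath hu hC Y0
  -- Continuity of a solution is known on `[0, T]` only; freezing time outside the interval makes
  -- the integrands measurable on the whole line.
  set V : (ℝ → Fin N → Space d) → Fin N → ℝ → Space d := fun X i s =>
    velocity H G (empirical (X (clampIcc T s))) (leaderPath u Y0 s) (u s) (X (clampIcc T s) i)
    with hV
  have hcont : ∀ {Y X}, IsFiniteSol T H G u Y0 X0 Y X →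
      Continuous fun s => X (clampIcc T s) := fun {Y X} hs =>
    hs.continuous.comp_continuous (continuous_clampIcc T) (clampIcc_mem hT)
  have hVi : ∀ {Y X}, IsFiniteSol T H G u Y0 X0 Y X → ∀ i a b,
      IntervalIntegrable (V X i) volume a b := by
    intro Y X hs i a b
    have hXc := hcont hs
    have hm : Measurable (V X i) := by
      have hxi : Continuous fun s => X (clampIcc T s) i := (continuous_apply i).comp hXc
      refine Measurable.add (Continuous.measurable ?_)
        (measurable_leaderField h hu hYc.measurable hxi.measurable)
      simp only [integral_empirical]
      have hj : ∀ j, Continuous fun s => H (X (clampIcc T s) i - X (clampIcc T s) j) := fun j => by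
        have hxj : Continuous fun s => X (clampIcc T s) j := (continuous_apply j).comp hXc
        exact h.H.cont.comp (hxi.sub hxj)
      have hsum : Continuous fun s => ∑ j, H (X (clampIcc T s) i - X (clampIcc T s) j) :=
        continuous_finsetSum _ fun j _ => hj j
      exact hsum.const_smul ((N : ℝ)⁻¹)
    rw [intervalIntegrable_iff]
    refine IntegrableOn.of_bound (by simp) hm.aestronglyMeasurable (velBound d B C)
      (Eventually.of_forall fun s => ?_)
    have := isProbabilityMeasure_empirical hN (X (clampIcc T s))
    exact h.norm_velocity_le _ (hC s) _ _
  have heq : ∀ {Y X}, IsFiniteSol T H G u Y0 X0 Y X → ∀ t ∈ Icc 0 T, ∀ i,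
      X t i = X0 i + ∫ s in (0 : ℝ)..t, V X i s := by
    intro Y X hs t ht i
    rw [hs.followers t ht i]
    congr 1
    refine intervalIntegral.integral_congr fun s hst => ?_
    rw [uIcc_of_le ht.1] at hst
    have hsT : s ∈ Icc 0 T := ⟨hst.1, hst.2.trans ht.2⟩
    simp only [hV, clampIcc_of_mem hsT, hs.eq_leaderPath hsT]
  set e : ℝ → ℝ := fun s => ‖X (clampIcc T s) - W (clampIcc T s)‖ with he
  have hec : Continuous e := ((hcont hs).sub (hcont hs')).norm
  set Λ := 2 * K + d * (C * K) with hΛ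
  have hVd : ∀ i s, ‖V X i s - V W i s‖ ≤ Λ * e s := by
    intro i s
    simp only [hV, velocity_eq]
    rw [add_sub_add_comm]
    refine (norm_add_le _ _).trans ?_
    have h1 := h.norm_conv_empirical_sub_le hN (X (clampIcc T s)) (W (clampIcc T s)) i
    have h2 := h.norm_leaderField_sub_le (hC s) (leaderPath u Y0 s) (leaderPath u Y0 s)
      (X (clampIcc T s) i) (W (clampIcc T s) i)
    rw [sub_self, norm_zero, add_zero] at h2
    have h3 : d * (C * (K * ‖X (clampIcc T s) i - W (clampIcc T s) i‖)) ≤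
        d * (C * (K * e s)) := by
      gcongr
      exact norm_le_pi_norm (X (clampIcc T s) - W (clampIcc T s)) i
    have h4 : e s = ‖X (clampIcc T s) - W (clampIcc T s)‖ := rfl
    rw [← h4] at h1
    linarith
  have hgr := gronwall_integral (a := 0) (Λ := Λ) (T := T) hec (fun _ => norm_nonneg _) le_rfl
    (by positivity) (fun t ht => ?_) ht
  · rw [zero_mul] at hgr
    simp only [he, clampIcc_of_mem ht] at hgr
    exact sub_eq_zero.1 (norm_le_zero_iff.1 hgr)
  · have hI0 : 0 ≤ ∫ s in (0 : ℝ)..t, e s :=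
      intervalIntegral.integral_nonneg ht.1 fun _ _ => norm_nonneg _
    simp only [he, clampIcc_of_mem ht, zero_add]
    refine (pi_norm_le_iff_of_nonneg (by positivity)).2 fun i => ?_
    rw [Pi.sub_apply, heq hs t ht i, heq hs' t ht i, add_sub_add_left_eq_sub,
      ← intervalIntegral.integral_sub (hVi hs i _ _) (hVi hs' i _ _),
      ← intervalIntegral.integral_const_mul]
    exact intervalIntegral.norm_integral_le_of_norm_le ht.1
      (Eventually.of_forall fun s _ => hVd i s) ((hec.const_mul Λ).intervalIntegrable _ _)

/-- A radius containing all trajectories that start in the ball of radius `R`. -/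
def trajRadius (d : ℕ) (B C T R : ℝ) (Y0 : Leaders m d) : ℝ :=
  (R + velBound d B C * T) + (‖Y0‖ + C * T)

/-- The two sets of interactions agree on the ball that contains the trajectories, so what has to be
shown is that every solution, for either set, has its support there. -/
theorem HypH.isMeanFieldSol_iff (hHG : HypH H G) (hB : 0 ≤ B) (hH : ∀ ξ, ‖H ξ‖ ≤ B)
    (hG : ∀ ℓ ξ, ‖G ℓ ξ‖ ≤ B) (h : Interactions B K H' G') (hT : 0 ≤ T) (hR0 : 0 ≤ R)
    (hag : AgreeOn (2 * trajRadius d B C T R Y0) H H' G G') (hu : Measurable u)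
    (hC : ∀ t, ‖u t‖ ≤ C) (hμ0 : InP1 μ0) (hR : SuppIn R μ0) :
    IsMeanFieldSol T H G u Y0 μ0 Y μ ↔ IsMeanFieldSol T H' G' u Y0 μ0 Y μ := by
  have hC0 : 0 ≤ C := (norm_nonneg _).trans (hC 0)
  have hV := h.velBound_nonneg hC0
  have hr1 : R + velBound d B C * T ≤ trajRadius d B C T R Y0 := by
    unfold trajRadius; exact le_add_of_nonneg_right (by positivity)
  have hr2 : ‖Y0‖ + C * T ≤ trajRadius d B C T R Y0 := by
    unfold trajRadius; exact le_add_of_nonneg_left (by positivity)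
  constructor
  · intro hs
    obtain ⟨R2, hR2⟩ := hs.compactSupport
    -- A weak solution has some supporting ball, with no bound on its radius. An auxiliary
    -- truncation adapted to this solution makes uniqueness available and shows that it is the image
    -- of the datum under a flow. Since the truncation keeps the bound `B`, the support then lies in
    -- the ball fixed in advance.
    set R3 := max R2 (trajRadius d B C T R Y0) with hR3
    obtain ⟨H2, G2, K2, h2, hag2⟩ := hHG.exists_interactions hB hH hG (2 * R3)
    have hY : ∀ t ∈ Icc 0 T, ‖Y t‖ ≤ trajRadius d B C T R Y0 := fun t ht => by
      rw [hs.eq_leaderPath ht]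
      exact (norm_leaderPath_le hu hC Y0 ht).trans hr2
    have hs2 := hag2.isMeanFieldSol (fun t ht => (hR2 t ht).mono (le_max_left _ _))
      (fun t ht => (hY t ht).trans (le_max_right _ _)) hs
    exact hag.isMeanFieldSol
      (fun t ht => (hs2.suppIn h2 hT hu hC hμ0 hR ht).mono hr1) hY hs
  · intro hs
    have hY : ∀ t ∈ Icc 0 T, ‖Y t‖ ≤ trajRadius d B C T R Y0 := fun t ht => by
      rw [hs.eq_leaderPath ht]
      exact (norm_leaderPath_le hu hC Y0 ht).trans hr2
    exact hag.symm.isMeanFieldSol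
      (fun t ht => (hs.suppIn h hT hu hC hμ0 hR ht).mono hr1) hY hs

theorem isFiniteSol_iff (hB : 0 ≤ B) (hH : ∀ ξ, ‖H ξ‖ ≤ B)
    (hG : ∀ ℓ ξ, ‖G ℓ ξ‖ ≤ B) (h : Interactions B K H' G') (hT : 0 ≤ T) (hR0 : 0 ≤ R) (hN : 1 ≤ N)
    (hag : AgreeOn (2 * trajRadius d B C T R Y0) H H' G G') (hu : Measurable u)
    (hC : ∀ t, ‖u t‖ ≤ C) (hX0 : ∀ i, ‖X0 i‖ ≤ R) :
    IsFiniteSol T H G u Y0 X0 Y X ↔ IsFiniteSol T H' G' u Y0 X0 Y X := by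
  have hC0 : 0 ≤ C := (norm_nonneg _).trans (hC 0)
  have hV := h.velBound_nonneg hC0
  have hr1 : R + velBound d B C * T ≤ trajRadius d B C T R Y0 := by
    unfold trajRadius; exact le_add_of_nonneg_right (by positivity)
  have hr2 : ‖Y0‖ + C * T ≤ trajRadius d B C T R Y0 := by
    unfold trajRadius; exact le_add_of_nonneg_left (by positivity)
  constructor <;> intro hs
  · exact hag.isFiniteSol
      (fun t ht i => (hs.norm_le hB hH hG hN hC hX0 ht i).trans hr1) (fun t ht => by
        rw [hs.eq_leaderPath ht]
        exact (norm_leaderPath_le hu hC Y0 ht).trans hr2) hs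
  · exact hag.symm.isFiniteSol
      (fun t ht i => (hs.norm_le hB h.H.bdd (fun ℓ => (h.G ℓ).bdd) hN hC hX0 ht i).trans hr1)
      (fun t ht => by
        rw [hs.eq_leaderPath ht]
        exact (norm_leaderPath_le hu hC Y0 ht).trans hr2) hs

variable {U : Set (Leaders m d)}

/-- On data in a fixed ball, locally Lipschitz interactions may be replaced by globally Lipschitz
ones. -/
theorem HypH.exists_globalization (hHG : HypH H G) (hT : 0 ≤ T) (hU : IsClosed U)
    (hne : U.Nonempty) (hUC : ∀ w ∈ U, ‖w‖ ≤ C) (Y0 : Leaders m d) (R : ℝ) :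
    ∃ (H' : Space d → Space d) (G' : Fin d → Space d → Space d) (B K : ℝ),
      Interactions B K H' G' ∧
      (∀ u, Admissible T U u → ∀ μ0, InP1 μ0 → SuppIn R μ0 → ∀ Y μ,
        IsMeanFieldSol T H G u Y0 μ0 Y μ ↔ IsMeanFieldSol T H' G' u Y0 μ0 Y μ) ∧
      (∀ u, Admissible T U u → ∀ N, 1 ≤ N → ∀ X0 : Fin N → Space d, (∀ i, ‖X0 i‖ ≤ R) → ∀ Y X,
        IsFiniteSol T H G u Y0 X0 Y X ↔ IsFiniteSol T H' G' u Y0 X0 Y X) := by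
  obtain ⟨B, hB, hH, hG⟩ := hHG.exists_bound
  obtain ⟨H', G', K, h, hag⟩ := hHG.exists_interactions hB hH hG
    (2 * trajRadius d B C T (max R 0) Y0)
  refine ⟨H', G', B, K, h, fun u hu μ0 hμ0 hR Y μ => ?_, fun u hu N hN X0 hX0 Y X => ?_⟩
  · obtain ⟨v, hvm, hvU, huv⟩ := hu.exists_measurable hU hne
    have := hHG.isMeanFieldSol_iff (u := v) (Y := Y) (μ := μ) hB hH hG h hT (le_max_right _ _) hag
      hvm (fun t => hUC _ (hvU t)) hμ0 (hR.mono (le_max_left _ _))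
    exact ⟨fun hs => (this.1 (hs.congr huv)).congr huv.symm,
      fun hs => (this.2 (hs.congr huv)).congr huv.symm⟩
  · obtain ⟨v, hvm, hvU, huv⟩ := hu.exists_measurable hU hne
    have := isFiniteSol_iff (u := v) (Y := Y) (X := X) hB hH hG h hT (le_max_right R 0) hN hag
      hvm (fun t => hUC _ (hvU t)) fun i => (hX0 i).trans (le_max_left _ _)
    exact ⟨fun hs => (this.1 (hs.congr huv)).congr huv.symm,
      fun hs => (this.2 (hs.congr huv)).congr huv.symm⟩

/-- Well-posedness of the mean-field system for globally Lipschitz interactions. -/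
theorem Interactions.meanField_wellPosed (h : Interactions B K H G) (hT : 0 ≤ T) (hU : IsClosed U)
    (hne : U.Nonempty) (hUC : ∀ w ∈ U, ‖w‖ ≤ C) (Y0 : Leaders m d) (hμ0 : InP1 μ0)
    (hR : SuppIn R μ0) (hu : Admissible T U u) :
    (∃ Y μ, IsMeanFieldSol T H G u Y0 μ0 Y μ) ∧
      (∀ Y μ Z ν, IsMeanFieldSol T H G u Y0 μ0 Y μ → IsMeanFieldSol T H G u Y0 μ0 Z ν →
        ∀ t ∈ Icc 0 T, Y t = Z t ∧ μ t = ν t) := by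
  obtain ⟨v, hvm, hvU, huv⟩ := hu.exists_measurable hU hne
  have hvC : ∀ t, ‖v t‖ ≤ C := fun t => hUC _ (hvU t)
  constructor
  · obtain ⟨Φ, hΦ⟩ := h.exists_isFlow hvm hvC Y0 hμ0
    have := hμ0.prob
    exact ⟨_, _, (hΦ.isMeanFieldSol h hvm hvC hR).congr huv.symm⟩
  · intro Y μ Z ν h1 h2 t ht
    exact ⟨(h1.eq_leaderPath ht).trans (h2.eq_leaderPath ht).symm,
      (h1.congr huv).unique h hT hvm hvC (h2.congr huv) ht⟩

/-- Well-posedness of the finite system for globally Lipschitz interactions. -/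
theorem Interactions.finite_wellPosed (h : Interactions B K H G) (hT : 0 ≤ T) (hU : IsClosed U)
    (hne : U.Nonempty) (hUC : ∀ w ∈ U, ‖w‖ ≤ C) (Y0 : Leaders m d) (hN : 1 ≤ N)
    (X0 : Fin N → Space d) (hX0 : ∀ i, ‖X0 i‖ ≤ R) (hu : Admissible T U u) :
    (∃ Y X, IsFiniteSol T H G u Y0 X0 Y X) ∧
      (∀ Y X Z W, IsFiniteSol T H G u Y0 X0 Y X → IsFiniteSol T H G u Y0 X0 Z W →
        ∀ t ∈ Icc 0 T, Y t = Z t ∧ X t = W t) := by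
  obtain ⟨v, hvm, hvU, huv⟩ := hu.exists_measurable hU hne
  have hvC : ∀ t, ‖v t‖ ≤ C := fun t => hUC _ (hvU t)
  have := isProbabilityMeasure_empirical hN X0
  constructor
  · obtain ⟨Φ, hΦ⟩ := h.exists_isFlow hvm hvC Y0 (InP1.of_suppIn (suppIn_empirical hX0))
    exact ⟨_, _, hΦ.isFiniteSol.congr huv.symm⟩
  · intro Y X Z W h1 h2 t ht
    exact ⟨(h1.eq_leaderPath ht).trans (h2.eq_leaderPath ht).symm,
      (h1.congr huv).unique h hT hN hvm hvC (h2.congr huv) ht⟩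

/-- The empirical measures of a finite system solve the mean-field system up to values outside
the time interval. -/
theorem IsFiniteSol.exists_isMeanFieldSol (h : Interactions B K H G) (hT : 0 ≤ T)
    (hU : IsClosed U) (hne : U.Nonempty) (hUC : ∀ w ∈ U, ‖w‖ ≤ C) (hN : 1 ≤ N)
    (hX0 : ∀ i, ‖X0 i‖ ≤ R) (hu : Admissible T U u) (hs : IsFiniteSol T H G u Y0 X0 Y X) :
    ∃ Z ν, IsMeanFieldSol T H G u Y0 (empirical X0) Z ν ∧
      ∀ t ∈ Icc 0 T, Y t = Z t ∧ empirical (X t) = ν t := by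
  obtain ⟨v, hvm, hvU, huv⟩ := hu.exists_measurable hU hne
  have hvC : ∀ t, ‖v t‖ ≤ C := fun t => hUC _ (hvU t)
  have := isProbabilityMeasure_empirical hN X0
  obtain ⟨Φ, hΦ⟩ := h.exists_isFlow hvm hvC Y0 (InP1.of_suppIn (suppIn_empirical hX0))
  refine ⟨_, _, (hΦ.isMeanFieldSol h hvm hvC (suppIn_empirical hX0)).congr huv.symm,
    fun t ht => ⟨(hs.congr huv).eq_leaderPath ht, ?_⟩⟩
  rw [(hs.congr huv).unique h hT hN hvm hvC hΦ.isFiniteSol ht,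
    map_empirical X0 (hΦ.continuous t).measurable]

end WellPosed

end LeaderFollower
end

noncomputable section

namespace LeaderFollower

/-! ### Weak compactness in Hilbert spaces -/

section Hilbert

variable {V : Type*} [NormedAddCommGroup V] [InnerProductSpace ℝ V] [CompleteSpace V]

/-- Sequential Banach–Alaoglu in the dual of a separable space, carried back by the Riesz
isomorphism. -/
theorem exists_weak_subseq [TopologicalSpace.SeparableSpace V] {f : ℕ → V} {r : ℝ}
    (hf : ∀ n, ‖f n‖ ≤ r) : ∃ (a : V) (σ : ℕ → ℕ), StrictMono σ ∧
      ∀ g, Tendsto (fun j => inner ℝ (f (σ j)) g) atTop (𝓝 (inner ℝ a g)) := by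
  have hc := WeakDual.isSeqCompact_closedBall ℝ V 0 r
  obtain ⟨x, -, σ, hσ, hx⟩ := hc
    (x := fun n => StrongDual.toWeakDual (InnerProductSpace.toDual ℝ V (f n))) (fun n => by
      simpa using hf n)
  refine ⟨(InnerProductSpace.toDual ℝ V).symm (WeakDual.toStrongDual x), σ, hσ, fun g => ?_⟩
  rw [InnerProductSpace.toDual_symm_apply]
  exact (WeakDual.eval_continuous g).continuousAt.tendsto.comp hx

/-- With `p` the projection of `a` onto `S`, the variational inequality `⟨a - p, f j - p⟩ ≤ 0`
passes to the weak limit and gives `‖a - p‖² ≤ 0`. -/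
theorem mem_of_tendsto_weak {S : Set V} (hS : IsClosed S) (hconv : Convex ℝ S) {f : ℕ → V} {a : V}
    (hf : ∀ n, f n ∈ S) (h : ∀ g, Tendsto (fun j => inner ℝ (f j) g) atTop (𝓝 (inner ℝ a g))) :
    a ∈ S := by
  obtain ⟨p, hp, hmin⟩ := exists_norm_eq_iInf_of_complete_convex ⟨f 0, hf 0⟩ hS.isComplete hconv a
  have hle := (norm_eq_iInf_iff_real_inner_le_zero hconv hp).1 hmin
  have hlim : Tendsto (fun j => inner ℝ (a - p) (f j - p)) atTop (𝓝 (inner ℝ (a - p) (a - p))) := by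
    have := (h (a - p)).sub_const (inner ℝ p (a - p))
    simpa only [← inner_sub_left, real_inner_comm] using this
  have h0 : inner ℝ (a - p) (a - p) ≤ 0 := le_of_tendsto' hlim fun j => hle _ (hf j)
  rw [real_inner_self_eq_norm_sq] at h0
  have : a - p = 0 := norm_eq_zero.1 (pow_eq_zero_iff two_ne_zero |>.1 (h0.antisymm (sq_nonneg _)))
  rwa [sub_eq_zero.1 this]

end Hilbert

theorem isClosed_ae_mem {α E : Type*} [MeasurableSpace α] {ν : Measure α} [NormedAddCommGroup E]
    {S : Set E} (hS : IsClosed S) : IsClosed {f : Lp E 2 ν | ∀ᵐ t ∂ν, f t ∈ S} := by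
  refine IsSeqClosed.isClosed fun f g hf hfg => ?_
  obtain ⟨ns, -, hns⟩ := (tendstoInMeasure_of_tendsto_Lp hfg).exists_seq_tendsto_ae
  have hall : ∀ᵐ t ∂ν, ∀ n, f n t ∈ S := ae_all_iff.2 hf
  filter_upwards [hns, hall] with t h1 h2
  exact hS.mem_of_tendsto h1 (Eventually.of_forall fun i => h2 _)

theorem convex_ae_mem {α E : Type*} [MeasurableSpace α] {ν : Measure α} [NormedAddCommGroup E]
    [NormedSpace ℝ E] {S : Set E} (hS : Convex ℝ S) :
    Convex ℝ {f : Lp E 2 ν | ∀ᵐ t ∂ν, f t ∈ S} := by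
  intro f hf g hg a b ha hb hab
  have h1 := Lp.coeFn_add (a • f) (b • g)
  change ∀ᵐ t ∂ν, (a • f + b • g : Lp E 2 ν) t ∈ S
  filter_upwards [h1, Lp.coeFn_smul a f, Lp.coeFn_smul b g, hf, hg] with t h1 h2 h3 h4 h5
  rw [h1, Pi.add_apply, h2, h3]
  exact hS h4 h5 ha hb hab

/-! ### Weak compactness of controls -/

section Controls

variable {m d : ℕ}

/-- The leaders with the given coordinates; the inverse of `toCoords`. -/
def ofCoords (x : EuclideanSpace ℝ (Fin m × Fin d)) : Leaders m d :=
  fun k => WithLp.toLp 2 fun ℓ => x (k, ℓ)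

/-- The coordinates of the leaders as one Euclidean vector. -/
def toCoords (w : Leaders m d) : EuclideanSpace ℝ (Fin m × Fin d) :=
  WithLp.toLp 2 fun p => w p.1 p.2

theorem ofCoords_toCoords (w : Leaders m d) : ofCoords (toCoords w) = w := rfl

theorem continuous_ofCoords : Continuous (ofCoords : _ → Leaders m d) := by
  unfold ofCoords; fun_prop

theorem continuous_toCoords : Continuous (toCoords : Leaders m d → _) := by
  unfold toCoords; fun_prop

theorem ofCoords_add_smul (a b : ℝ) (x y : EuclideanSpace ℝ (Fin m × Fin d)) :
    ofCoords (a • x + b • y) = a • ofCoords x + b • ofCoords y := by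
  funext k; ext ℓ; simp [ofCoords]

theorem norm_toCoords_le (w : Leaders m d) : ‖toCoords w‖ ≤ (m * d : ℕ) * ‖w‖ := by
  have h1 : ‖toCoords w‖ ≤ ∑ p : Fin m × Fin d, |w p.1 p.2| := by
    have : toCoords w = ∑ p : Fin m × Fin d, EuclideanSpace.single p (w p.1 p.2) := by
      ext q; simp [toCoords, Finset.sum_apply]
    rw [this]
    refine (norm_sum_le _ _).trans (le_of_eq (Finset.sum_congr rfl fun p _ => ?_))
    simp
  refine h1.trans ((Finset.sum_le_card_nsmul _ _ _ fun p _ => abs_coord_le w p.1 p.2).trans ?_)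
  simp

/-- Weak convergence of controls, tested coordinatewise with bounded functions. -/
def WeakTendsto (T : ℝ) (us : ℕ → ℝ → Leaders m d) (u : ℝ → Leaders m d) : Prop :=
  ∀ (g : ℝ → ℝ) (c : ℝ), Measurable g → (∀ s, |g s| ≤ c) → ∀ k ℓ,
    Tendsto (fun j => ∫ s in Icc 0 T, g s * us j s k ℓ) atTop
      (𝓝 (∫ s in Icc 0 T, g s * u s k ℓ))

/-- The space of leaders carries a sup norm over `k` and is not an inner product space, so
compactness is obtained in `L²` of the coordinates. Convexity and closedness of `U` keep the values
of the weak limit in `U`. -/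
theorem exists_weakTendsto {T C : ℝ} {U : Set (Leaders m d)} (hU : IsClosed U)
    (hconv : Convex ℝ U) (hUC : ∀ w ∈ U, ‖w‖ ≤ C) {us : ℕ → ℝ → Leaders m d}
    (hm : ∀ j, Measurable (us j)) (hus : ∀ j t, us j t ∈ U) :
    ∃ (σ : ℕ → ℕ) (u : ℝ → Leaders m d), StrictMono σ ∧ Measurable u ∧ (∀ t, u t ∈ U) ∧
      WeakTendsto T (fun j => us (σ j)) u := by
  set ν : Measure ℝ := volume.restrict (Icc 0 T) with hν
  have hC0 : 0 ≤ C := (norm_nonneg _).trans (hUC _ (hus 0 0))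
  have : Fact ((2 : ℝ≥0∞) ≠ ⊤) := ⟨by simp⟩
  set E := EuclideanSpace ℝ (Fin m × Fin d)
  have hmc : ∀ j, Measurable fun t => toCoords (us j t) := fun j =>
    continuous_toCoords.measurable.comp (hm j)
  have hb : ∀ j t, ‖toCoords (us j t)‖ ≤ (m * d : ℕ) * C := fun j t =>
    (norm_toCoords_le _).trans (by gcongr; exact hUC _ (hus j t))
  have hL : ∀ j, MemLp (fun t => toCoords (us j t)) 2 ν := fun j =>
    MemLp.of_bound (hmc j).aestronglyMeasurable _ (Eventually.of_forall (hb j))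
  set f : ℕ → Lp E 2 ν := fun j => (hL j).toLp _ with hf
  have hfc : ∀ j, f j =ᵐ[ν] fun t => toCoords (us j t) := fun j => (hL j).coeFn_toLp
  have hfb : ∃ r, ∀ j, ‖f j‖ ≤ r := by
    refine ⟨_, fun j => Lp.norm_le_of_ae_bound (C := (m * d : ℕ) * C) (by positivity) ?_⟩
    filter_upwards [hfc j] with t ht
    rw [ht]; exact hb j t
  obtain ⟨r, hr⟩ := hfb
  obtain ⟨a, σ, hσ, ha⟩ := exists_weak_subseq hr
  have hmem : a ∈ {f : Lp E 2 ν | ∀ᵐ t ∂ν, f t ∈ ofCoords ⁻¹' U} := by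
    refine mem_of_tendsto_weak (isClosed_ae_mem (hU.preimage continuous_ofCoords))
      (convex_ae_mem fun x hx y hy s t hs ht hst => ?_) (fun n => ?_) ha
    · rw [mem_preimage, ofCoords_add_smul]
      exact hconv hx hy hs ht hst
    · filter_upwards [hfc (σ n)] with t ht
      rw [ht, mem_preimage, ofCoords_toCoords]
      exact hus _ t
  have hadm : Admissible T U fun t => ofCoords (a t) :=
    ⟨continuous_ofCoords.comp_aestronglyMeasurable (Lp.aestronglyMeasurable a), hmem⟩
  obtain ⟨u, hum, huU, hu⟩ := hadm.exists_measurable hU ⟨_, hus 0 0⟩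
  refine ⟨σ, u, hσ, hum, huU, fun g c hg hc k ℓ => ?_⟩
  -- Pairing with `g` times a basis vector extracts one coordinate of the control.
  have hgL : MemLp (fun s => g s • (EuclideanSpace.single (k, ℓ) 1 : E)) 2 ν := by
    refine MemLp.of_bound (hg.smul_const _).aestronglyMeasurable c (Eventually.of_forall fun s => ?_)
    rw [norm_smul]
    simpa using hc s
  have hin : ∀ x : Lp E 2 ν, inner ℝ x (hgL.toLp _) = ∫ s in Icc 0 T, g s * x s (k, ℓ) := by
    intro x
    rw [L2.inner_def]
    refine integral_congr_ae ?_
    filter_upwards [hgL.coeFn_toLp] with s hs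
    rw [hs, inner_smul_right, EuclideanSpace.inner_single_right]
    simp
  have h1 := ha (hgL.toLp _)
  simp only [hin] at h1
  have h2 : ∫ s in Icc 0 T, g s * u s k ℓ = ∫ s in Icc 0 T, g s * a s (k, ℓ) := by
    refine integral_congr_ae ?_
    filter_upwards [hu] with s hs
    rw [← hs]; rfl
  rw [h2]
  refine h1.congr fun j => integral_congr_ae ?_
  filter_upwards [hfc (σ j)] with s hs
  rw [hs]; rfl

/-- The control energy `∫_0^T ∑_k |u_k|²`. -/
def energy (T : ℝ) (u : ℝ → Leaders m d) : ℝ := ∫ s in Icc 0 T, ∑ k, ‖u s k‖ ^ 2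

theorem sum_norm_sq_le {w : Leaders m d} {C : ℝ} (hw : ‖w‖ ≤ C) : ∑ k, ‖w k‖ ^ 2 ≤ m * C ^ 2 := by
  refine (Finset.sum_le_card_nsmul _ _ (C ^ 2) fun k _ => ?_).trans (by simp)
  gcongr
  exact (norm_le_pi_norm w k).trans hw

theorem integrable_sum_norm_sq {T C : ℝ} {u : ℝ → Leaders m d} (hu : Measurable u)
    (hC : ∀ t, ‖u t‖ ≤ C) : IntegrableOn (fun s => ∑ k, ‖u s k‖ ^ 2) (Icc 0 T) := by
  refine IntegrableOn.of_bound (by simp) ?_ (m * C ^ 2) (Eventually.of_forall fun s => ?_)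
  · have : Continuous fun w : Leaders m d => ∑ k, ‖w k‖ ^ 2 := by fun_prop
    exact (this.measurable.comp hu).aestronglyMeasurable
  · rw [Real.norm_of_nonneg (by positivity)]
    exact sum_norm_sq_le (hC s)

theorem integrable_mul_coord {T C c : ℝ} {u : ℝ → Leaders m d} (hu : Measurable u)
    (hC : ∀ t, ‖u t‖ ≤ C) {g : ℝ → ℝ} (hg : Measurable g) (hgc : ∀ s, |g s| ≤ c) (k : Fin m)
    (ℓ : Fin d) : IntegrableOn (fun s => g s * u s k ℓ) (Icc 0 T) := by
  refine IntegrableOn.of_bound (by simp) (hg.mul (measurable_coord hu k ℓ)).aestronglyMeasurable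
    (c * C) (Eventually.of_forall fun s => ?_)
  rw [norm_mul]
  exact mul_le_mul (hgc s) ((abs_coord_le _ k ℓ).trans (hC s)) (norm_nonneg _)
    ((abs_nonneg _).trans (hgc s))

/-- From `|a|² - |b|² - |a - b|² = 2 ⟨b, a - b⟩`, where the cross term is a weak pairing with the
fixed bounded control `u`. Consequently an upper bound on the limit of the energies forces strong
convergence. -/
theorem WeakTendsto.tendsto_energy {T C : ℝ} {us : ℕ → ℝ → Leaders m d} {u : ℝ → Leaders m d}
    (h : WeakTendsto T us u) (hm : ∀ j, Measurable (us j)) (hC : ∀ j t, ‖us j t‖ ≤ C)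
    (hu : Measurable u) (huC : ∀ t, ‖u t‖ ≤ C) :
    Tendsto (fun j => energy T (us j) - energy T u - energy T fun s => us j s - u s) atTop
      (𝓝 0) := by
  have hcoord : ∀ (k : Fin m) (ℓ : Fin d) s, |u s k ℓ| ≤ C := fun k ℓ s =>
    (abs_coord_le _ k ℓ).trans (huC s)
  have hcross : ∀ j, energy T (us j) - energy T u - energy T (fun s => us j s - u s) =
      2 * ∑ k : Fin m, ∑ ℓ : Fin d, ((∫ s in Icc 0 T, u s k ℓ * us j s k ℓ) -
        ∫ s in Icc 0 T, u s k ℓ * u s k ℓ) := by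
    intro j
    have hi1 := fun (k : Fin m) (ℓ : Fin d) => integrable_mul_coord (T := T) (hm j) (hC j)
      (measurable_coord hu k ℓ) (hcoord k ℓ) k ℓ
    have hi2 := fun (k : Fin m) (ℓ : Fin d) => integrable_mul_coord (T := T) hu huC
      (measurable_coord hu k ℓ) (hcoord k ℓ) k ℓ
    have hd : IntegrableOn (fun s => ∑ k, ‖(us j s - u s) k‖ ^ 2) (Icc 0 T) :=
      integrable_sum_norm_sq (C := C + C) ((hm j).sub hu) fun s =>
        (norm_sub_le _ _).trans (add_le_add (hC j s) (huC s))
    have e1 : ∀ k ℓ, (∫ s in Icc 0 T, u s k ℓ * us j s k ℓ) - ∫ s in Icc 0 T, u s k ℓ * u s k ℓ =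
        ∫ s in Icc 0 T, (u s k ℓ * us j s k ℓ - u s k ℓ * u s k ℓ) := fun k ℓ =>
      (integral_sub (hi1 k ℓ) (hi2 k ℓ)).symm
    simp only [e1]
    have e2 : ∑ k : Fin m, ∑ ℓ : Fin d, ∫ s in Icc 0 T,
        (u s k ℓ * us j s k ℓ - u s k ℓ * u s k ℓ) = ∫ s in Icc 0 T, ∑ k : Fin m, ∑ ℓ : Fin d,
        (u s k ℓ * us j s k ℓ - u s k ℓ * u s k ℓ) := by
      have hi : ∀ k ℓ, IntegrableOn (fun s => u s k ℓ * us j s k ℓ - u s k ℓ * u s k ℓ)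
          (Icc 0 T) := fun k ℓ => (hi1 k ℓ).sub (hi2 k ℓ)
      rw [integral_finsetSum _ fun k _ => integrable_finsetSum _ fun ℓ _ => hi k ℓ]
      exact Finset.sum_congr rfl fun k _ => (integral_finsetSum _ fun ℓ _ => hi k ℓ).symm
    rw [e2, ← integral_const_mul]
    unfold energy
    have hds : IntegrableOn (fun s => ∑ k, ‖us j s k‖ ^ 2 - ∑ k, ‖u s k‖ ^ 2) (Icc 0 T) :=
      (integrable_sum_norm_sq (hm j) (hC j)).sub (integrable_sum_norm_sq hu huC)
    rw [← integral_sub (integrable_sum_norm_sq (hm j) (hC j)) (integrable_sum_norm_sq hu huC),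
      ← integral_sub hds hd]
    refine integral_congr_ae (Eventually.of_forall fun s => ?_)
    beta_reduce
    rw [← Finset.sum_sub_distrib, ← Finset.sum_sub_distrib, Finset.mul_sum]
    refine Finset.sum_congr rfl fun k _ => ?_
    rw [EuclideanSpace.real_norm_sq_eq, EuclideanSpace.real_norm_sq_eq,
      EuclideanSpace.real_norm_sq_eq, ← Finset.sum_sub_distrib, ← Finset.sum_sub_distrib,
      Finset.mul_sum]
    refine Finset.sum_congr rfl fun ℓ _ => ?_
    simp only [Pi.sub_apply, PiLp.sub_apply]
    ring
  simp only [hcross]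
  have : Tendsto (fun j => 2 * ∑ k : Fin m, ∑ ℓ : Fin d,
      ((∫ s in Icc 0 T, u s k ℓ * us j s k ℓ) - ∫ s in Icc 0 T, u s k ℓ * u s k ℓ)) atTop
      (𝓝 (2 * ∑ k : Fin m, ∑ ℓ : Fin d, (0 : ℝ))) := by
    refine (tendsto_finsetSum _ fun k _ => tendsto_finsetSum _ fun ℓ _ => ?_).const_mul 2
    exact tendsto_sub_nhds_zero_iff.2 (h _ C (measurable_coord hu k ℓ) (hcoord k ℓ) k ℓ)
  simpa using this

theorem controlsTendsto_of_energy {T C : ℝ} {us : ℕ → ℝ → Leaders m d} {u : ℝ → Leaders m d}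
    (hm : ∀ j, Measurable (us j)) (hC : ∀ j t, ‖us j t‖ ≤ C) (hu : Measurable u)
    (huC : ∀ t, ‖u t‖ ≤ C) (h : Tendsto (fun j => energy T fun s => us j s - u s) atTop (𝓝 0)) :
    ControlsTendsto T us u := by
  unfold ControlsTendsto
  have hle : ∀ j, eLpNorm (fun t => us j t - u t) 2 (volume.restrict (Icc 0 T)) ≤
      ENNReal.ofReal (energy T fun s => us j s - u s) ^ (1 / 2 : ℝ) := by
    intro j
    rw [eLpNorm_eq_lintegral_rpow_enorm_toReal (by simp) (by simp)]
    simp only [ENNReal.toReal_ofNat]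
    gcongr
    have hd : IntegrableOn (fun s => ∑ k, ‖(us j s - u s) k‖ ^ 2) (Icc 0 T) :=
      integrable_sum_norm_sq (C := C + C) ((hm j).sub hu) fun s =>
        (norm_sub_le _ _).trans (add_le_add (hC j s) (huC s))
    unfold energy
    rw [ofReal_integral_eq_lintegral_ofReal hd (Eventually.of_forall fun s => by positivity)]
    refine lintegral_mono fun s => ?_
    rw [← ofReal_norm, ENNReal.ofReal_rpow_of_nonneg (norm_nonneg _) (by norm_num)]
    refine ENNReal.ofReal_le_ofReal ?_
    rw [Real.rpow_two]
    -- The `L²` seminorm is built on the sup norm over the leaders, which the Euclidean norm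
    -- dominates.
    have hs : ‖us j s - u s‖ ≤ Real.sqrt (∑ k, ‖(us j s - u s) k‖ ^ 2) := by
      refine (pi_norm_le_iff_of_nonneg (Real.sqrt_nonneg _)).2 fun k => Real.le_sqrt_of_sq_le ?_
      exact Finset.single_le_sum (f := fun k => ‖(us j s - u s) k‖ ^ 2)
        (fun i _ => by positivity) (Finset.mem_univ k)
    calc _ ≤ Real.sqrt (∑ k, ‖(us j s - u s) k‖ ^ 2) ^ 2 := by gcongr
      _ = _ := Real.sq_sqrt (by positivity)
  have h0 : Tendsto (fun j => ENNReal.ofReal (energy T fun s => us j s - u s) ^ (1 / 2 : ℝ)) atTop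
      (𝓝 0) := by
    have h1 := (ENNReal.continuous_ofReal.tendsto 0).comp h
    have h2 := ((ENNReal.continuous_rpow_const (y := (1 / 2 : ℝ))).tendsto _).comp h1
    simpa [Function.comp_def] using h2
  exact tendsto_of_tendsto_of_tendsto_of_le_of_le tendsto_const_nhds h0 (fun _ => zero_le) hle

end Controls

end LeaderFollower
end

noncomputable section

namespace LeaderFollower

/-! ### Distance between two flows -/

section Distance

variable {m d : ℕ} {B K C T : ℝ} {H : Space d → Space d} {G : Fin d → Space d → Space d}
  {u u' : ℝ → Leaders m d} {Y0 : Leaders m d} {μ0 μ0' : Measure (Space d)}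
  [IsProbabilityMeasure μ0] [IsProbabilityMeasure μ0'] {Φ Φ' : ℝ → Space d → Space d}
  {π : Measure (Space d × Space d)}

/-- The mean distance at time `s` of the trajectories of two flows started from the coupling `π`. -/
def flowDist (T : ℝ) (π : Measure (Space d × Space d)) (Φ' Φ : ℝ → Space d → Space d) (s : ℝ) : ℝ :=
  ∫ p, ‖Φ' (clampIcc T s) p.1 - Φ (clampIcc T s) p.2‖ ∂π

/-- The displacement along the flow `Φ` caused by a variation `w` of the control. -/
def controlDrift (G : Fin d → Space d → Space d) (Y w : ℝ → Leaders m d)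
    (Φ : ℝ → Space d → Space d) (t : ℝ) (y : Space d) : Space d :=
  ∫ s in (0 : ℝ)..t, leaderField G (Y s) (w s) (Φ s y)

omit [IsProbabilityMeasure μ0] in
theorem measurable_leaderField_flow (h : Interactions B K H G) (hΦ : IsFlow H G u Y μ0 Φ)
    {w Z : ℝ → Leaders m d} (hw : Measurable w) (hZ : Continuous Z) :
    Measurable fun p : Space d × ℝ => leaderField G (Z p.2) (w p.2) (Φ p.2 p.1) :=
  measurable_leaderField h (hw.comp measurable_snd) (hZ.measurable.comp measurable_snd)
    (hΦ.cont.comp continuous_swap).measurable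

omit [IsProbabilityMeasure μ0] in
theorem intervalIntegrable_leaderField_flow (h : Interactions B K H G) (hΦ : IsFlow H G u Y μ0 Φ)
    {w Z : ℝ → Leaders m d} (hw : Measurable w) (hwC : ∀ t, ‖w t‖ ≤ C) (hZ : Continuous Z)
    (y : Space d) (a b : ℝ) :
    IntervalIntegrable (fun s => leaderField G (Z s) (w s) (Φ s y)) volume a b := by
  rw [intervalIntegrable_iff]
  refine IntegrableOn.of_bound (by simp) ?_ (d * (C * B))
    (Eventually.of_forall fun s => h.norm_leaderField_le (hwC s) _ _)
  exact ((measurable_leaderField_flow h hΦ hw hZ).comp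
    (measurable_const.prodMk measurable_id : Measurable fun s : ℝ => (y, s))).aestronglyMeasurable

omit [IsProbabilityMeasure μ0] in
theorem norm_controlDrift_sub_le (h : Interactions B K H G) (hΦ : IsFlow H G u Y μ0 Φ)
    {w Z : ℝ → Leaders m d} (hw : Measurable w) (hwC : ∀ t, ‖w t‖ ≤ C) (hZ : Continuous Z)
    (s t : ℝ) (y : Space d) :
    ‖controlDrift G Z w Φ t y - controlDrift G Z w Φ s y‖ ≤ d * (C * B) * |t - s| := by
  unfold controlDrift
  rw [intervalIntegral.integral_interval_sub_left
    (intervalIntegrable_leaderField_flow h hΦ hw hwC hZ y _ _)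
    (intervalIntegrable_leaderField_flow h hΦ hw hwC hZ y _ _)]
  exact intervalIntegral.norm_integral_le_of_norm_le_const fun s _ =>
    h.norm_leaderField_le (hwC s) _ _

theorem norm_controlDrift_le (h : Interactions B K H G) 
    {w Z : ℝ → Leaders m d} (hwC : ∀ t, ‖w t‖ ≤ C)
    {t : ℝ} (ht : 0 ≤ t) (y : Space d) :
    ‖controlDrift G Z w Φ t y‖ ≤ d * (C * B) * t := by
  have := intervalIntegral.norm_integral_le_of_norm_le_const (a := 0) (b := t)
    (f := fun s => leaderField G (Z s) (w s) (Φ s y)) (C := d * (C * B)) fun s _ =>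
    h.norm_leaderField_le (hwC s) _ _
  rwa [sub_zero, abs_of_nonneg ht] at this

omit [IsProbabilityMeasure μ0] in
theorem stronglyMeasurable_controlDrift (h : Interactions B K H G) (hΦ : IsFlow H G u Y μ0 Φ)
    {w Z : ℝ → Leaders m d} (hw : Measurable w) (hZ : Continuous Z) {t : ℝ} (ht : 0 ≤ t) :
    StronglyMeasurable (controlDrift G Z w Φ t) := by
  unfold controlDrift
  simp only [intervalIntegral.integral_of_le ht]
  exact (measurable_leaderField_flow h hΦ hw hZ).stronglyMeasurable.integral_prod_right
    (ν := volume.restrict (Ioc 0 t))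

theorem integrable_norm_controlDrift (h : Interactions B K H G) (hΦ : IsFlow H G u Y μ0 Φ)
    {w Z : ℝ → Leaders m d} (hw : Measurable w) (hwC : ∀ t, ‖w t‖ ≤ C) (hZ : Continuous Z)
    {t : ℝ} (ht : 0 ≤ t) : Integrable (fun y => ‖controlDrift G Z w Φ t y‖) μ0 :=
  Integrable.of_bound (C := d * (C * B) * t)
    (stronglyMeasurable_controlDrift h hΦ hw hZ ht).norm.aestronglyMeasurable
    (Eventually.of_forall fun y => by
      rw [norm_norm]; exact norm_controlDrift_le h hwC ht y)

theorem norm_flow_sub_flow_le (h : Interactions B K H G) (hu : Measurable u)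
    (hC : ∀ t, ‖u t‖ ≤ C) (hu' : Measurable u') (hC' : ∀ t, ‖u' t‖ ≤ C)
    {Y Y' : ℝ → Leaders m d} (hY : Continuous Y) (hY' : Continuous Y')
    (hΦ : IsFlow H G u Y μ0 Φ) (hΦ' : IsFlow H G u' Y' μ0' Φ') {s : ℝ} (hs : s ∈ Icc 0 T)
    (p : Space d × Space d) :
    ‖Φ' s p.1 - Φ s p.2‖ ≤ ‖p.1 - p.2‖ + 2 * velBound d B C * T := by
  have hV := h.velBound_nonneg ((norm_nonneg _).trans (hC 0))
  have h1 := hΦ.norm_sub_le h hu hC hY le_rfl hs.1 p.2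
  have h2 := hΦ'.norm_sub_le h hu' hC' hY' le_rfl hs.1 p.1
  rw [hΦ.zero, sub_zero, abs_of_nonneg hs.1] at h1
  rw [hΦ'.zero, sub_zero, abs_of_nonneg hs.1] at h2
  have h3 : velBound d B C * s ≤ velBound d B C * T := by gcongr; exact hs.2
  have h4 : Φ' s p.1 - Φ s p.2 = (Φ' s p.1 - p.1) + (p.1 - p.2) - (Φ s p.2 - p.2) := by abel
  rw [h4]
  have h5 := norm_sub_le ((Φ' s p.1 - p.1) + (p.1 - p.2)) (Φ s p.2 - p.2)
  have h6 := norm_add_le (Φ' s p.1 - p.1) (p.1 - p.2)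
  linarith

/-- Integration of an integral inequality over a parameter. -/
theorem integral_le_of_forall_le {P : Type*} [TopologicalSpace P] [SecondCountableTopology P]
    [MeasurableSpace P] [BorelSpace P] {π : Measure P} [IsProbabilityMeasure π] {D : ℝ → P → ℝ}
    {b ρ : P → ℝ} {e : ℝ → ℝ} {c₁ c₂ c₃ t : ℝ}
    (hDc : Continuous fun q : ℝ × P => D q.1 q.2) (hD0 : ∀ s p, 0 ≤ D s p)
    (hDb : ∀ s p, D s p ≤ b p) (hb : Integrable b π) (hρ : Integrable ρ π) (hec : Continuous e)
    (he : ∀ s, e s = ∫ p, D s p ∂π) (ht : 0 ≤ t)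
    (h : ∀ p, D t p ≤ ρ p + ∫ s in (0 : ℝ)..t, (c₁ * D s p + (c₂ * e s + c₃))) :
    e t ≤ ∫ p, ρ p ∂π + ((c₁ + c₂) * (∫ s in (0 : ℝ)..t, e s) + c₃ * t) := by
  have hDs : ∀ s, Continuous (D s) := fun s => hDc.comp (Continuous.prodMk_right s)
  have hDi : ∀ s, Integrable (D s) π := fun s =>
    hb.mono' (hDs s).aestronglyMeasurable (Eventually.of_forall fun p => by
      rw [Real.norm_of_nonneg (hD0 _ _)]; exact hDb s p)
  have hDi2 : Integrable (fun q : P × ℝ => D q.2 q.1) (π.prod (volume.restrict (Ioc 0 t))) := by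
    refine (hb.comp_fst _).mono' (hDc.comp continuous_swap).aestronglyMeasurable
      (Eventually.of_forall fun q => ?_)
    rw [Real.norm_of_nonneg (hD0 _ _)]; exact hDb q.2 q.1
  have hei : Integrable (fun s => c₂ * e s + c₃) (volume.restrict (Ioc 0 t)) :=
    (Continuous.integrableOn_Icc (by fun_prop)).mono_set Ioc_subset_Icc_self
  have hFi : Integrable (Function.uncurry fun (p : P) s => c₁ * D s p + (c₂ * e s + c₃))
      (π.prod (volume.restrict (Ioc 0 t))) :=
    (hDi2.const_mul c₁).add (hei.comp_snd _)
  have hsw : ∫ p, (∫ s in (0 : ℝ)..t, (c₁ * D s p + (c₂ * e s + c₃))) ∂π =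
      ∫ s in (0 : ℝ)..t, (c₁ * e s + (c₂ * e s + c₃)) := by
    simp only [intervalIntegral.integral_of_le ht]
    rw [integral_integral_swap hFi]
    refine integral_congr_ae (Eventually.of_forall fun s => ?_)
    beta_reduce
    rw [integral_add ((hDi s).const_mul _) (integrable_const _), integral_const_mul, he s]
    simp
  have hFi' : Integrable (fun p => ∫ s in (0 : ℝ)..t, (c₁ * D s p + (c₂ * e s + c₃))) π := by
    simp only [intervalIntegral.integral_of_le ht]
    exact hFi.integral_prod_left
  have hle := integral_mono (hDi t) (hρ.add hFi') h
  rw [← he t, integral_add' hρ hFi', hsw] at hle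
  have hs2 : ∫ s in (0 : ℝ)..t, (c₁ * e s + (c₂ * e s + c₃)) =
      (c₁ + c₂) * (∫ s in (0 : ℝ)..t, e s) + c₃ * t := by
    have : (fun s => c₁ * e s + (c₂ * e s + c₃)) = fun s => (c₁ + c₂) * e s + c₃ := by
      funext s; ring
    rw [this, intervalIntegral.integral_add ((hec.const_mul _).intervalIntegrable _ _)
      intervalIntegrable_const, intervalIntegral.integral_const_mul,
      intervalIntegral.integral_const, sub_zero, smul_eq_mul, mul_comm t]
  rwa [hs2] at hle

variable [IsProbabilityMeasure π]

omit [IsProbabilityMeasure μ0] [IsProbabilityMeasure μ0'] in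
-- Under weak convergence the variation of the control is not small at fixed times. Its force along
-- the unperturbed flow is therefore subtracted exactly, and the remainder is Lipschitz in the
-- positions, in the measures (through the coupling) and in the leaders.
theorem norm_velocity_flow_sub_le (h : Interactions B K H G) {v v' Z Z' : Leaders m d}
    (hv' : ‖v'‖ ≤ C) {f f' : Space d → Space d} (hf : Measurable f) (hf' : Measurable f')
    (hπ1 : π.map Prod.fst = μ0') (hπ2 : π.map Prod.snd = μ0) {δ : ℝ} (hδ : ‖Z' - Z‖ ≤ δ)
    (hi : Integrable (fun q : Space d × Space d => ‖f' q.1 - f q.2‖) π) (hC : 0 ≤ C)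
    (p : Space d × Space d) :
    ‖velocity H G (μ0'.map f') Z' v' (f' p.1) - velocity H G (μ0.map f) Z v (f p.2) -
        leaderField G Z (v' - v) (f p.2)‖ ≤
      (K + d * (C * K)) * ‖f' p.1 - f p.2‖ +
        (K * (∫ q, ‖f' q.1 - f q.2‖ ∂π) + d * (C * K) * δ) := by
  have hK := h.K_nonneg
  have e1 : μ0'.map f' = π.map fun q => f' q.1 := by
    rw [← hπ1, Measure.map_map hf' measurable_fst]; rfl
  have e2 : μ0.map f = π.map fun q => f q.2 := by
    rw [← hπ2, Measure.map_map hf measurable_snd]; rfl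
  have h1 := h.norm_conv_map_sub_le (hf'.comp measurable_fst) (hf.comp measurable_snd) hi
    (f' p.1) (f p.2)
  have h2 := h.norm_leaderField_sub_le hv' Z' Z (f' p.1) (f p.2)
  have h3 : velocity H G (μ0'.map f') Z' v' (f' p.1) - velocity H G (μ0.map f) Z v (f p.2) -
        leaderField G Z (v' - v) (f p.2) =
      ((∫ ξ, H (f' p.1 - ξ) ∂(π.map (f' ∘ Prod.fst))) -
        ∫ ξ, H (f p.2 - ξ) ∂(π.map (f ∘ Prod.snd))) +
      (leaderField G Z' v' (f' p.1) - leaderField G Z v' (f p.2)) := by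
    simp only [velocity_eq, leaderField_sub, e1, e2, Function.comp_def]; abel
  rw [h3]
  refine (norm_add_le _ _).trans ((add_le_add h1 h2).trans ?_)
  have h6 : (d : ℝ) * (C * (K * ‖Z' - Z‖)) ≤ d * (C * (K * δ)) := by gcongr
  simp only [Function.comp_apply]
  linarith

/-- Grönwall's inequality for the mean distance of coupled trajectories. The control variation is
kept as the time-integrated drift `controlDrift`, with its norm taken only after integration in
time; this is the quantity that weak convergence makes small. -/
theorem flowDist_le (h : Interactions B K H G) (hT : 0 ≤ T) (hu : Measurable u)
    (hC : ∀ t, ‖u t‖ ≤ C) (hu' : Measurable u') (hC' : ∀ t, ‖u' t‖ ≤ C)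
    {Y Y' : ℝ → Leaders m d} (hY : Continuous Y) (hY' : Continuous Y')
    (hΦ : IsFlow H G u Y μ0 Φ) (hΦ' : IsFlow H G u' Y' μ0' Φ')
    (hπ1 : π.map Prod.fst = μ0') (hπ2 : π.map Prod.snd = μ0)
    (hπi : Integrable (fun p => ‖p.1 - p.2‖) π) {a δ r : ℝ} (ha : ∫ p, ‖p.1 - p.2‖ ∂π ≤ a)
    (hδ : ∀ s ∈ Icc 0 T, ‖Y' s - Y s‖ ≤ δ)
    (hr : ∀ t ∈ Icc 0 T, ∫ y, ‖controlDrift G Y (fun s => u' s - u s) Φ t y‖ ∂μ0 ≤ r)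
    {t : ℝ} (ht : t ∈ Icc 0 T) :
    flowDist T π Φ' Φ t ≤ (a + d * (C * K) * δ * T + r) * Real.exp ((2 * K + d * (C * K)) * T) := by
  have hC0 : 0 ≤ C := (norm_nonneg _).trans (hC 0)
  have hK := h.K_nonneg
  have hδ0 : 0 ≤ δ := (norm_nonneg _).trans (hδ 0 ⟨le_rfl, hT⟩)
  have ha0 : 0 ≤ a := (integral_nonneg fun _ => norm_nonneg _).trans ha
  have hr0 : 0 ≤ r := (integral_nonneg fun _ => norm_nonneg _).trans (hr 0 ⟨le_rfl, hT⟩)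
  have hwm : Measurable fun s => u' s - u s := hu'.sub hu
  have hwC : ∀ s, ‖u' s - u s‖ ≤ C + C := fun s =>
    (norm_sub_le _ _).trans (add_le_add (hC' s) (hC s))
  have hDc : Continuous fun q : ℝ × (Space d × Space d) =>
      ‖Φ' (clampIcc T q.1) q.2.1 - Φ (clampIcc T q.1) q.2.2‖ := by
    have h1 : Continuous fun q : ℝ × (Space d × Space d) => Φ' (clampIcc T q.1) q.2.1 :=
      hΦ'.cont.comp (((continuous_clampIcc T).comp continuous_fst).prodMk
        (continuous_fst.comp continuous_snd))
    have h2 : Continuous fun q : ℝ × (Space d × Space d) => Φ (clampIcc T q.1) q.2.2 :=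
      hΦ.cont.comp (((continuous_clampIcc T).comp continuous_fst).prodMk
        (continuous_snd.comp continuous_snd))
    exact (h1.sub h2).norm
  have hDb : ∀ s (p : Space d × Space d), ‖Φ' (clampIcc T s) p.1 - Φ (clampIcc T s) p.2‖ ≤
      ‖p.1 - p.2‖ + 2 * velBound d B C * T := fun s p =>
    norm_flow_sub_flow_le h hu hC hu' hC' hY hY' hΦ hΦ' (clampIcc_mem hT s) p
  have hbi : Integrable (fun p : Space d × Space d => ‖p.1 - p.2‖ + 2 * velBound d B C * T) π :=
    hπi.add (integrable_const _)
  have hDs : ∀ s, Continuous fun p : Space d × Space d =>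
      ‖Φ' (clampIcc T s) p.1 - Φ (clampIcc T s) p.2‖ := fun s =>
    (((hΦ'.continuous _).comp continuous_fst).sub ((hΦ.continuous _).comp continuous_snd)).norm
  have hDp : ∀ p : Space d × Space d, Continuous fun s =>
      ‖Φ' (clampIcc T s) p.1 - Φ (clampIcc T s) p.2‖ := fun p =>
    (((hΦ'.continuous_left p.1).comp (continuous_clampIcc T)).sub
      ((hΦ.continuous_left p.2).comp (continuous_clampIcc T))).norm
  have hDi : ∀ s, Integrable (fun p : Space d × Space d =>
      ‖Φ' (clampIcc T s) p.1 - Φ (clampIcc T s) p.2‖) π := fun s =>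
    hbi.mono' (hDs s).aestronglyMeasurable (Eventually.of_forall fun p => by
      rw [norm_norm]; exact hDb s p)
  have hec : Continuous (flowDist T π Φ' Φ) := by
    unfold flowDist
    refine continuous_of_dominated (fun s => (hDs s).aestronglyMeasurable)
      (fun s => Eventually.of_forall fun p => ?_) hbi (Eventually.of_forall hDp)
    rw [norm_norm]; exact hDb s p
  have hpt : ∀ t ∈ Icc 0 T, ∀ p : Space d × Space d,
      ‖Φ' (clampIcc T t) p.1 - Φ (clampIcc T t) p.2‖ ≤
      (‖p.1 - p.2‖ + ‖controlDrift G Y (fun s => u' s - u s) Φ t p.2‖) +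
      ∫ s in (0 : ℝ)..t, ((K + d * (C * K)) * ‖Φ' (clampIcc T s) p.1 - Φ (clampIcc T s) p.2‖ +
        (K * flowDist T π Φ' Φ s + d * (C * K) * δ)) := by
    intro t ht p
    have i1 := hΦ'.intervalIntegrable_vel h hu' hC' hY' p.1 0 t
    have i2 := hΦ.intervalIntegrable_vel h hu hC hY p.2 0 t
    have i3 := intervalIntegrable_leaderField_flow h hΦ hwm hwC hY p.2 0 t
    have h1 : Φ' t p.1 - Φ t p.2 = ((p.1 - p.2) +
        controlDrift G Y (fun s => u' s - u s) Φ t p.2) +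
        ∫ s in (0 : ℝ)..t, (velocity H G (μ0'.map (Φ' s)) (Y' s) (u' s) (Φ' s p.1) -
        velocity H G (μ0.map (Φ s)) (Y s) (u s) (Φ s p.2) -
        leaderField G (Y s) (u' s - u s) (Φ s p.2)) := by
      rw [intervalIntegral.integral_sub (i1.sub i2) i3, intervalIntegral.integral_sub i1 i2,
        hΦ'.eq t ht.1, hΦ.eq t ht.1]
      unfold controlDrift
      abel
    rw [clampIcc_of_mem ht, h1]
    refine (norm_add_le _ _).trans (add_le_add (norm_add_le _ _) ?_)
    have hc : Continuous fun s =>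
        (K + d * (C * K)) * ‖Φ' (clampIcc T s) p.1 - Φ (clampIcc T s) p.2‖ +
        (K * flowDist T π Φ' Φ s + d * (C * K) * δ) :=
      ((hDp p).const_mul _).add ((hec.const_mul _).add continuous_const)
    refine intervalIntegral.norm_integral_le_of_norm_le ht.1
      (Eventually.of_forall fun s hs => ?_) (hc.intervalIntegrable _ _)
    have hsT : s ∈ Icc 0 T := ⟨hs.1.le, hs.2.trans ht.2⟩
    have hi := hDi s
    unfold flowDist
    rw [clampIcc_of_mem hsT] at hi ⊢
    exact norm_velocity_flow_sub_le h (hC' s) (hΦ.continuous s).measurable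
      (hΦ'.continuous s).measurable hπ1 hπ2 (hδ s hsT) hi hC0 p
  have hint : ∀ t ∈ Icc 0 T, flowDist T π Φ' Φ t ≤ (a + d * (C * K) * δ * T + r) +
      (2 * K + d * (C * K)) * ∫ s in (0 : ℝ)..t, flowDist T π Φ' Φ s := by
    intro t ht
    have hdr := integrable_norm_controlDrift h hΦ hwm hwC hY ht.1
    have hdr' : Integrable (fun p : Space d × Space d =>
        ‖controlDrift G Y (fun s => u' s - u s) Φ t p.2‖) π := by
      rw [← hπ2] at hdr
      exact hdr.comp_measurable measurable_snd
    have hdr2 : ∫ p, ‖controlDrift G Y (fun s => u' s - u s) Φ t p.2‖ ∂π ≤ r := by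
      refine le_trans (le_of_eq ?_) (hr t ht)
      conv_rhs => rw [← hπ2]
      rw [integral_map measurable_snd.aemeasurable
        (stronglyMeasurable_controlDrift h hΦ hwm hY ht.1).norm.aestronglyMeasurable]
    have hle := integral_le_of_forall_le hDc (fun _ _ => norm_nonneg _) hDb hbi (hπi.add hdr') hec
      (fun _ => rfl) ht.1 (hpt t ht)
    rw [integral_add' hπi hdr'] at hle
    have h1 : d * (C * K) * δ * t ≤ d * (C * K) * δ * T := by gcongr; exact ht.2
    have h2 : K + d * (C * K) + K = 2 * K + d * (C * K) := by ring
    rw [h2] at hle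
    linarith
  refine (gronwall_integral hec (fun s => integral_nonneg fun _ => norm_nonneg _) (by positivity)
    (by positivity) hint ht).trans ?_
  gcongr
  exact ht.2

/-- The coupling of the data, moved by the two flows, is a coupling of the evolved measures; the
speed bound pays for the difference of times. -/
theorem W1_flow_le (h : Interactions B K H G) (hu : Measurable u)
    (hC : ∀ t, ‖u t‖ ≤ C) (hu' : Measurable u') (hC' : ∀ t, ‖u' t‖ ≤ C) {Y Y' : ℝ → Leaders m d}
    (hY : Continuous Y) (hY' : Continuous Y')
    (hΦ : IsFlow H G u Y μ0 Φ) (hΦ' : IsFlow H G u' Y' μ0' Φ')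
    (hπ1 : π.map Prod.fst = μ0') (hπ2 : π.map Prod.snd = μ0)
    (hπi : Integrable (fun p => ‖p.1 - p.2‖) π) {s t : ℝ} (hs : s ∈ Icc 0 T) (ht : t ∈ Icc 0 T) :
    W1 (μ0'.map (Φ' s)) (μ0.map (Φ t)) ≤
      ENNReal.ofReal (flowDist T π Φ' Φ s + velBound d B C * |t - s|) := by
  have hm1 : Measurable fun q : Space d × Space d => Φ' s q.1 :=
    (hΦ'.continuous s).measurable.comp measurable_fst
  have hm2 : ∀ t, Measurable fun q : Space d × Space d => Φ t q.2 := fun t =>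
    (hΦ.continuous t).measurable.comp measurable_snd
  have e1 : μ0'.map (Φ' s) = π.map fun q => Φ' s q.1 := by
    rw [← hπ1, Measure.map_map (hΦ'.continuous s).measurable measurable_fst]; rfl
  have e2 : μ0.map (Φ t) = π.map fun q => Φ t q.2 := by
    rw [← hπ2, Measure.map_map (hΦ.continuous t).measurable measurable_snd]; rfl
  have hi : Integrable (fun q : Space d × Space d => ‖Φ' s q.1 - Φ s q.2‖) π := by
    refine (hπi.add (integrable_const (2 * velBound d B C * T))).mono'
      (hm1.sub (hm2 s)).norm.aestronglyMeasurable (Eventually.of_forall fun p => ?_)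
    rw [norm_norm]
    exact norm_flow_sub_flow_le h hu hC hu' hC' hY hY' hΦ hΦ' hs p
  rw [e1, e2]
  refine (W1_map_le π hm1 (hm2 t)).trans ?_
  have hfd : flowDist T π Φ' Φ s + velBound d B C * |t - s| =
      ∫ q, (‖Φ' s q.1 - Φ s q.2‖ + velBound d B C * |t - s|) ∂π := by
    rw [integral_add hi (integrable_const _)]
    simp [flowDist, clampIcc_of_mem hs]
  have hV := h.velBound_nonneg ((norm_nonneg _).trans (hC 0))
  have hi' : Integrable (fun q : Space d × Space d => ‖Φ' s q.1 - Φ s q.2‖ +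
      velBound d B C * |t - s|) π := hi.add (integrable_const _)
  rw [hfd, ofReal_integral_eq_lintegral_ofReal hi' (Eventually.of_forall fun q => by positivity)]
  refine lintegral_mono fun q => ENNReal.ofReal_le_ofReal ?_
  have h1 := hΦ.norm_sub_le h hu hC hY hs.1 ht.1 q.2
  have h2 := norm_sub_le (Φ' s q.1 - Φ s q.2) (Φ t q.2 - Φ s q.2)
  rw [sub_sub_sub_cancel_right] at h2
  linarith

end Distance

end LeaderFollower
end

noncomputable section

namespace LeaderFollower

/-- A sequence of functions tends to zero uniformly on a compact interval if it does so along
convergent sequences of points. -/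
theorem eventually_forall_le_of_seq {f : ℕ → ℝ → ℝ} {T : ℝ}
    (h : ∀ ψ : ℕ → ℕ, StrictMono ψ → ∀ ts : ℕ → ℝ, (∀ j, ts j ∈ Icc 0 T) → ∀ t ∈ Icc 0 T,
      Tendsto ts atTop (𝓝 t) → Tendsto (fun j => f (ψ j) (ts j)) atTop (𝓝 0))
    {ε : ℝ} (hε : 0 < ε) : ∀ᶠ j in atTop, ∀ t ∈ Icc 0 T, f j t ≤ ε := by
  by_contra hcon
  obtain ⟨φ, hφ, hφt⟩ := extraction_of_frequently_atTop (not_eventually.1 hcon)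
  push Not at hφt
  choose ts hts hlt using hφt
  obtain ⟨t, ht, ψ, hψ, hlim⟩ := isCompact_Icc.tendsto_subseq hts
  have h0 := h (φ ∘ ψ) (hφ.comp hψ) (ts ∘ ψ) (fun j => hts _) t ht hlim
  exact (ge_of_tendsto' h0 fun j => (hlt (ψ j)).le).not_gt hε

theorem eventually_forall_le_of_lipschitz {f : ℕ → ℝ → ℝ} {T M : ℝ}
    (hlip : ∀ j, ∀ s ∈ Icc 0 T, ∀ t ∈ Icc 0 T, f j s ≤ f j t + M * |s - t|)
    (hf0 : ∀ j, ∀ t ∈ Icc 0 T, 0 ≤ f j t)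
    (hlim : ∀ t ∈ Icc 0 T, Tendsto (fun j => f j t) atTop (𝓝 0)) {ε : ℝ} (hε : 0 < ε) :
    ∀ᶠ j in atTop, ∀ t ∈ Icc 0 T, f j t ≤ ε := by
  refine eventually_forall_le_of_seq (fun ψ hψ ts hts t ht hlt => ?_) hε
  have h1 : Tendsto (fun j => f (ψ j) t + M * |ts j - t|) atTop (𝓝 (0 + M * |t - t|)) :=
    ((hlim t ht).comp hψ.tendsto_atTop).add (((hlt.sub_const t).abs).const_mul M)
  simp only [sub_self, abs_zero, mul_zero, add_zero] at h1
  exact squeeze_zero (fun j => hf0 _ _ (hts j)) (fun j => hlip _ _ (hts j) t ht) h1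

/-! ### Continuity of leaders, drift and flow under weak convergence of controls -/

section Weak

variable {m d : ℕ} {B K C T : ℝ} {H : Space d → Space d} {G : Fin d → Space d → Space d}
  {us : ℕ → ℝ → Leaders m d} {u : ℝ → Leaders m d} {Y0 : Leaders m d}

theorem WeakTendsto.subseq (h : WeakTendsto T us u) {ψ : ℕ → ℕ} (hψ : StrictMono ψ) :
    WeakTendsto T (fun j => us (ψ j)) u := fun g c hg hc k ℓ =>
  (h g c hg hc k ℓ).comp hψ.tendsto_atTop

theorem weakTendsto_const (T : ℝ) (u : ℝ → Leaders m d) : WeakTendsto T (fun _ => u) u :=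
  fun _ _ _ _ _ _ => tendsto_const_nhds

theorem intervalIntegrable_coord_smul {w : ℝ → Leaders m d} (hw : Measurable w)
    (hwC : ∀ t, ‖w t‖ ≤ C) {F : ℝ → Space d} {c : ℝ} (hF : Measurable F) (hFc : ∀ s, ‖F s‖ ≤ c)
    (k : Fin m) (ℓ : Fin d) (a b : ℝ) :
    IntervalIntegrable (fun s => (w s k ℓ) • F s) volume a b := by
  rw [intervalIntegrable_iff]
  refine IntegrableOn.of_bound (by simp) ((measurable_coord hw k ℓ).smul hF).aestronglyMeasurable
    (C * c) (Eventually.of_forall fun s => ?_)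
  rw [norm_smul]
  exact mul_le_mul ((abs_coord_le _ k ℓ).trans (hwC s)) (hFc s) (norm_nonneg _)
    ((norm_nonneg _).trans (hwC s))

theorem WeakTendsto.tendsto_integral_smul (h : WeakTendsto T us u) (hm : ∀ j, Measurable (us j))
    (hC : ∀ j t, ‖us j t‖ ≤ C) (hu : Measurable u) (huC : ∀ t, ‖u t‖ ≤ C) {F : ℝ → Space d}
    {c : ℝ} (hF : Measurable F) (hFc : ∀ s, ‖F s‖ ≤ c) (k : Fin m) (ℓ : Fin d) {t : ℝ}
    (ht : t ∈ Icc 0 T) :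
    Tendsto (fun j => ∫ s in (0 : ℝ)..t, ((us j s - u s) k ℓ) • F s) atTop (𝓝 0) := by
  have hcoord : ∀ i : Fin d, Tendsto (fun j => (∫ s in (0 : ℝ)..t, ((us j s - u s) k ℓ) • F s) i)
      atTop (𝓝 0) := by
    intro i
    -- The restriction to times before `t` is absorbed into the scalar test function, one coordinate
    -- of `F` at a time.
    set g : ℝ → ℝ := (Ioc 0 t).indicator fun s => F s i with hg
    have hFi : Measurable fun s => F s i :=
      (EuclideanSpace.proj (𝕜 := ℝ) i).continuous.measurable.comp hF
    have hgm : Measurable g := hFi.indicator measurableSet_Ioc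
    have hgc : ∀ s, |g s| ≤ c := fun s => by
      rw [hg, ← Real.norm_eq_abs]
      exact (norm_indicator_le_norm_self _ _).trans ((PiLp.norm_apply_le (F s) i).trans (hFc s))
    have h1 := h g c hgm hgc k ℓ
    rw [← tendsto_sub_nhds_zero_iff] at h1
    refine h1.congr fun j => ?_
    have hwm : Measurable fun s => us j s - u s := (hm j).sub hu
    have hi := intervalIntegrable_coord_smul hwm (C := C + C)
      (fun s => (norm_sub_le _ _).trans (add_le_add (hC j s) (huC s))) hF hFc k ℓ 0 t
    have h2 := (EuclideanSpace.proj i : Space d →L[ℝ] ℝ).intervalIntegral_comp_comm hi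
    rw [PiLp.proj_apply] at h2
    rw [← h2, ← integral_sub (integrable_mul_coord (hm j) (hC j) hgm hgc k ℓ)
      (integrable_mul_coord hu huC hgm hgc k ℓ), intervalIntegral.integral_of_le ht.1]
    have h3 : (fun s => g s * us j s k ℓ - g s * u s k ℓ) = (Ioc 0 t).indicator fun s =>
        (EuclideanSpace.proj i : Space d →L[ℝ] ℝ) (((us j s - u s) k ℓ) • F s) := by
      funext s
      by_cases hs : s ∈ Ioc 0 t
      · simp only [hg, indicator_of_mem hs, Pi.sub_apply, PiLp.sub_apply, PiLp.proj_apply,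
          PiLp.smul_apply, smul_eq_mul]
        ring
      · simp only [hg, indicator_of_notMem hs]; ring
    rw [h3, setIntegral_indicator measurableSet_Ioc]
    congr 2
    refine inter_eq_right.2 fun s hs => ⟨hs.1.le, hs.2.trans ht.2⟩
  have hpi : Tendsto (fun j => WithLp.ofLp (∫ s in (0 : ℝ)..t, ((us j s - u s) k ℓ) • F s)) atTop
      (𝓝 (0 : Fin d → ℝ)) := tendsto_pi_nhds.2 hcoord
  exact ((PiLp.continuous_toLp 2 _).tendsto _).comp hpi

/-- The forces `G ℓ (Φ s y - Y s k)` are taken along the unperturbed trajectory, so they are bounded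
test functions independent of `j`. -/
theorem WeakTendsto.tendsto_controlDrift (h : WeakTendsto T us u) (hI : Interactions B K H G)
    (hm : ∀ j, Measurable (us j)) (hC : ∀ j t, ‖us j t‖ ≤ C) (hu : Measurable u)
    (huC : ∀ t, ‖u t‖ ≤ C) {Y : ℝ → Leaders m d} (hY : Continuous Y) {Φ : ℝ → Space d → Space d}
    (y : Space d) (hΦ : Continuous fun t => Φ t y) {t : ℝ} (ht : t ∈ Icc 0 T) :
    Tendsto (fun j => controlDrift G Y (fun s => us j s - u s) Φ t y) atTop (𝓝 0) := by
  have hF : ∀ (k : Fin m) (ℓ : Fin d), Measurable fun s => G ℓ (Φ s y - Y s k) := fun k ℓ => by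
    have hYk : Continuous fun s => Y s k := (continuous_apply k).comp hY
    exact ((hI.G ℓ).cont.comp (hΦ.sub hYk)).measurable
  have hFc : ∀ (k : Fin m) (ℓ : Fin d) s, ‖G ℓ (Φ s y - Y s k)‖ ≤ B := fun k ℓ s => (hI.G ℓ).bdd _
  have heq : ∀ j, controlDrift G Y (fun s => us j s - u s) Φ t y = ∑ ℓ : Fin d, (m : ℝ)⁻¹ •
      ∑ k : Fin m, ∫ s in (0 : ℝ)..t, ((us j s - u s) k ℓ) • G ℓ (Φ s y - Y s k) := by
    intro j
    have hi : ∀ (k : Fin m) (ℓ : Fin d), IntervalIntegrable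
        (fun s => ((us j s - u s) k ℓ) • G ℓ (Φ s y - Y s k)) volume 0 t := fun k ℓ =>
      intervalIntegrable_coord_smul ((hm j).sub hu) (C := C + C) (fun s => (norm_sub_le _ _).trans (add_le_add (hC j s) (huC s))) (hF k ℓ)
      (hFc k ℓ) k ℓ 0 t
    unfold controlDrift leaderField
    rw [intervalIntegral.integral_finsetSum]
    · refine Finset.sum_congr rfl fun ℓ _ => ?_
      rw [intervalIntegral.integral_smul, intervalIntegral.integral_finsetSum]
      exact fun k _ => hi k ℓ
    · intro ℓ _
      rw [intervalIntegrable_iff]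
      have hsum : IntegrableOn (fun s => ∑ k : Fin m, ((us j s - u s) k ℓ) • G ℓ (Φ s y - Y s k))
          (uIoc 0 t) := integrable_finsetSum _ fun k _ => intervalIntegrable_iff.1 (hi k ℓ)
      exact hsum.smul ((m : ℝ)⁻¹)
  simp only [heq]
  have : Tendsto (fun j => ∑ ℓ : Fin d, (m : ℝ)⁻¹ • ∑ k : Fin m,
      ∫ s in (0 : ℝ)..t, ((us j s - u s) k ℓ) • G ℓ (Φ s y - Y s k)) atTop
      (𝓝 (∑ ℓ : Fin d, (m : ℝ)⁻¹ • ∑ k : Fin m, (0 : Space d))) :=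
    tendsto_finsetSum _ fun ℓ _ => (tendsto_finsetSum _ fun k _ =>
      h.tendsto_integral_smul hm hC hu huC (hF k ℓ) (hFc k ℓ) k ℓ ht).const_smul _
  simpa using this

theorem intervalIntegrable_control {w : ℝ → Leaders m d} (hw : Measurable w)
    (hwC : ∀ t, ‖w t‖ ≤ C) (k : Fin m) (a b : ℝ) :
    IntervalIntegrable (fun s => w s k) volume a b := by
  rw [intervalIntegrable_iff]
  exact IntegrableOn.of_bound (by simp) ((measurable_pi_apply k).comp hw).aestronglyMeasurable C
    (Eventually.of_forall fun s => (norm_le_pi_norm (w s) k).trans (hwC s))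

theorem WeakTendsto.tendsto_leaderPath (h : WeakTendsto T us u)
    (hm : ∀ j, Measurable (us j)) (hC : ∀ j t, ‖us j t‖ ≤ C) (hu : Measurable u)
    (huC : ∀ t, ‖u t‖ ≤ C) (Y0 : Leaders m d) {t : ℝ} (ht : t ∈ Icc 0 T) :
    Tendsto (fun j => leaderPath (us j) Y0 t) atTop (𝓝 (leaderPath u Y0 t)) := by
  rw [← tendsto_sub_nhds_zero_iff]
  refine tendsto_pi_nhds.2 fun k => ?_
  have heq : ∀ j, (leaderPath (us j) Y0 t - leaderPath u Y0 t) k =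
      ∑ ℓ : Fin d, ∫ s in (0 : ℝ)..t, ((us j s - u s) k ℓ) • (EuclideanSpace.single ℓ (1 : ℝ)) := by
    intro j
    have hi : ∀ ℓ : Fin d, IntervalIntegrable (fun s => ((us j s - u s) k ℓ) •
        (EuclideanSpace.single ℓ (1 : ℝ) : Space d)) volume 0 t := fun ℓ =>
      intervalIntegrable_coord_smul ((hm j).sub hu) (C := C + C) (c := ‖(EuclideanSpace.single ℓ (1 : ℝ) : Space d)‖)
        (fun s => (norm_sub_le _ _).trans (add_le_add (hC j s) (huC s)))
        (measurable_const (a := (EuclideanSpace.single ℓ (1 : ℝ) : Space d)))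
      (fun _ => le_rfl) k ℓ 0 t
    rw [← intervalIntegral.integral_finsetSum fun ℓ _ => hi ℓ, Pi.sub_apply]
    unfold leaderPath
    rw [add_sub_add_left_eq_sub, ← intervalIntegral.integral_sub
      (intervalIntegrable_control (hm j) (hC j) k _ _) (intervalIntegrable_control hu huC k _ _)]
    refine intervalIntegral.integral_congr fun s _ => ?_
    ext i
    simp [Finset.sum_apply, Pi.single_apply]
  simp only [heq]
  have : Tendsto (fun j => ∑ ℓ : Fin d, ∫ s in (0 : ℝ)..t,
      ((us j s - u s) k ℓ) • (EuclideanSpace.single ℓ (1 : ℝ) : Space d)) atTop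
      (𝓝 (∑ ℓ : Fin d, (0 : Space d))) :=
    tendsto_finsetSum _ fun ℓ _ => h.tendsto_integral_smul hm hC hu huC measurable_const
      (fun _ => le_rfl) k ℓ ht
  simpa using this

theorem WeakTendsto.eventually_leaderPath_le (h : WeakTendsto T us u)
    (hm : ∀ j, Measurable (us j)) (hC : ∀ j t, ‖us j t‖ ≤ C) (hu : Measurable u)
    (huC : ∀ t, ‖u t‖ ≤ C) (Y0 : Leaders m d) {ε : ℝ} (hε : 0 < ε) :
    ∀ᶠ j in atTop, ∀ t ∈ Icc 0 T, ‖leaderPath (us j) Y0 t - leaderPath u Y0 t‖ ≤ ε := by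
  refine eventually_forall_le_of_lipschitz (M := C + C) (fun j s _ t _ => ?_)
    (fun _ _ _ => norm_nonneg _) (fun t ht => ?_) hε
  · have h1 := norm_leaderPath_sub_le (hm j) (hC j) Y0 t s
    have h2 := norm_leaderPath_sub_le hu huC Y0 t s
    have h3 : leaderPath (us j) Y0 s - leaderPath u Y0 s =
      (leaderPath (us j) Y0 t - leaderPath u Y0 t) +
      ((leaderPath (us j) Y0 s - leaderPath (us j) Y0 t) -
        (leaderPath u Y0 s - leaderPath u Y0 t)) := by abel
    rw [h3]
    refine (norm_add_le _ _).trans ?_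
    have h4 := norm_sub_le (leaderPath (us j) Y0 s - leaderPath (us j) Y0 t)
      (leaderPath u Y0 s - leaderPath u Y0 t)
    linarith
  · exact tendsto_zero_iff_norm_tendsto_zero.1
      (tendsto_sub_nhds_zero_iff.2 (h.tendsto_leaderPath hm hC hu huC Y0 ht))

/-- Dominated convergence handles the starting point `y`; the common Lipschitz bound in `t` turns
convergence at each time into uniform convergence. -/
theorem WeakTendsto.eventually_controlDrift_le (h : WeakTendsto T us u) (hI : Interactions B K H G)
    (hm : ∀ j, Measurable (us j)) (hC : ∀ j t, ‖us j t‖ ≤ C) (hu : Measurable u)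
    (huC : ∀ t, ‖u t‖ ≤ C) {Y : ℝ → Leaders m d} (hY : Continuous Y) {Φ : ℝ → Space d → Space d}
    {μ0 : Measure (Space d)} [IsProbabilityMeasure μ0] (hΦ : IsFlow H G u Y μ0 Φ) {ε : ℝ}
    (hε : 0 < ε) :
    ∀ᶠ j in atTop, ∀ t ∈ Icc 0 T,
      ∫ y, ‖controlDrift G Y (fun s => us j s - u s) Φ t y‖ ∂μ0 ≤ ε := by
  have hwm : ∀ j, Measurable fun s => us j s - u s := fun j => (hm j).sub hu
  have hwC : ∀ j s, ‖us j s - u s‖ ≤ C + C := fun j s =>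
    (norm_sub_le _ _).trans (add_le_add (hC j s) (huC s))
  refine eventually_forall_le_of_lipschitz (M := d * ((C + C) * B)) (fun j s hs t ht => ?_)
    (fun _ _ _ => integral_nonneg fun _ => norm_nonneg _) (fun t ht => ?_) hε
  · have i1 := integrable_norm_controlDrift hI hΦ (hwm j) (hwC j) hY hs.1
    have i2 := integrable_norm_controlDrift hI hΦ (hwm j) (hwC j) hY ht.1
    have hc : Integrable (fun _ : Space d => d * ((C + C) * B) * |s - t|) μ0 := integrable_const _
    have hle := integral_mono i1 (i2.add hc) fun y => by
      have h1 := norm_controlDrift_sub_le hI hΦ (hwm j) (hwC j) hY t s y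
      have h2 := norm_le_norm_add_norm_sub' (controlDrift G Y (fun s => us j s - u s) Φ s y)
        (controlDrift G Y (fun s => us j s - u s) Φ t y)
      exact h2.trans (add_le_add_right h1 _)
    rw [integral_add' i2 hc] at hle
    simpa using hle
  · have := tendsto_integral_of_dominated_convergence (μ := μ0)
      (F := fun j y => ‖controlDrift G Y (fun s => us j s - u s) Φ t y‖) (f := fun _ => 0)
      (fun _ => d * ((C + C) * B) * t)
      (fun j => (stronglyMeasurable_controlDrift hI hΦ (hwm j) hY ht.1).norm.aestronglyMeasurable)
      (integrable_const _)
      (fun j => Eventually.of_forall fun y => by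
        rw [norm_norm]; exact norm_controlDrift_le hI (hwC j) ht.1 y)
      (Eventually.of_forall fun y => tendsto_zero_iff_norm_tendsto_zero.1
        (h.tendsto_controlDrift hI hm hC hu huC hY y (hΦ.continuous_left y) ht))
    simpa using this

theorem WeakTendsto.tendsto_leaderPath_seq (h : WeakTendsto T us u)
    (hm : ∀ j, Measurable (us j)) (hC : ∀ j t, ‖us j t‖ ≤ C) (hu : Measurable u)
    (huC : ∀ t, ‖u t‖ ≤ C) (Y0 : Leaders m d) {ts : ℕ → ℝ} {t : ℝ}
    (ht : t ∈ Icc 0 T) (hlim : Tendsto ts atTop (𝓝 t)) :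
    Tendsto (fun j => leaderPath (us j) Y0 (ts j)) atTop (𝓝 (leaderPath u Y0 t)) := by
  have h1 : Tendsto (fun j => leaderPath (us j) Y0 (ts j) - leaderPath (us j) Y0 t) atTop
      (𝓝 0) := by
    refine squeeze_zero_norm (fun j => norm_leaderPath_sub_le (hm j) (hC j) Y0 t (ts j)) ?_
    simpa using ((hlim.sub_const t).abs).const_mul C
  simpa using h1.add (h.tendsto_leaderPath hm hC hu huC Y0 ht)

/-- Stability of the mean-field flow under Wasserstein perturbations of the datum and weak
perturbations of the control. -/
theorem WeakTendsto.tendsto_W1_flow (h : WeakTendsto T us u) (hI : Interactions B K H G)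
    (hm : ∀ j, Measurable (us j)) (hC : ∀ j t, ‖us j t‖ ≤ C) (hu : Measurable u)
    (huC : ∀ t, ‖u t‖ ≤ C) {μ0s : ℕ → Measure (Space d)} {μ0 : Measure (Space d)}
    (hPs : ∀ j, IsProbabilityMeasure (μ0s j)) [IsProbabilityMeasure μ0]
    (hW : Tendsto (fun j => W1 (μ0s j) μ0) atTop (𝓝 0)) {Φs : ℕ → ℝ → Space d → Space d}
    {Φ : ℝ → Space d → Space d}
    (hΦs : ∀ j, IsFlow H G (us j) (leaderPath (us j) Y0) (μ0s j) (Φs j))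
    (hΦ : IsFlow H G u (leaderPath u Y0) μ0 Φ) {ts : ℕ → ℝ} {t : ℝ} (hts : ∀ j, ts j ∈ Icc 0 T)
    (ht : t ∈ Icc 0 T) (hlim : Tendsto ts atTop (𝓝 t)) :
    Tendsto (fun j => W1 ((μ0s j).map (Φs j (ts j))) (μ0.map (Φ t))) atTop (𝓝 0) := by
  have hT : 0 ≤ T := ht.1.trans ht.2
  have hY := continuous_leaderPath hu huC Y0
  have hV := hI.velBound_nonneg ((norm_nonneg _).trans (huC 0))
  set c : ℝ := d * (C * K) * T with hc
  set E : ℝ := Real.exp ((2 * K + d * (C * K)) * T) with hE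
  rw [ENNReal.tendsto_nhds_zero]
  intro ε hε
  -- The coupling cost, the distance of the leaders, the mean drift and the time shift are all given
  -- the same size `x`.
  have hsmall : Tendsto (fun x : ℝ => ENNReal.ofReal ((x + d * (C * K) * x * T + x) * E +
      velBound d B C * x)) (𝓝[>] 0) (𝓝 0) := by
    have h1 : Continuous fun x : ℝ => (x + d * (C * K) * x * T + x) * E +
      velBound d B C * x := by fun_prop
    have h2 := (ENNReal.continuous_ofReal.comp h1).tendsto 0
    simp only [Function.comp_def, mul_zero, zero_mul, add_zero, ENNReal.ofReal_zero] at h2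
    exact h2.mono_left nhdsWithin_le_nhds
  obtain ⟨x, hxε, hx0⟩ := (((ENNReal.tendsto_nhds_zero.1 hsmall) ε hε).and
    self_mem_nhdsWithin).exists
  have hx : 0 < x := hx0
  have hlt : ∀ᶠ j in atTop, W1 (μ0s j) μ0 < ENNReal.ofReal x :=
    hW.eventually_lt_const (ENNReal.ofReal_pos.2 hx)
  have hdt : ∀ᶠ j in atTop, |t - ts j| < x := by
    have := (hlim.const_sub t).abs
    rw [sub_self, abs_zero] at this
    exact this.eventually_lt_const hx
  filter_upwards [hlt, hdt, h.eventually_leaderPath_le hm hC hu huC Y0 hx,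
    h.eventually_controlDrift_le hI hm hC hu huC hY hΦ hx] with j h1 h2 h3 h4
  -- An almost optimal coupling suffices; no minimizer of the transport problem is needed.
  obtain ⟨π, ⟨hπ, hπ1, hπ2⟩, hcost⟩ := exists_coupling_of_W1_lt h1
  have := hPs j
  have hmeas : AEStronglyMeasurable (fun p : Space d × Space d => ‖p.1 - p.2‖) π :=
    (by fun_prop : Continuous fun p : Space d × Space d => ‖p.1 - p.2‖).aestronglyMeasurable
  have hπi : Integrable (fun p : Space d × Space d => ‖p.1 - p.2‖) π := by
    refine ⟨hmeas, ?_⟩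
    rw [hasFiniteIntegral_iff_ofReal (Eventually.of_forall fun _ => norm_nonneg _)]
    exact hcost.trans ENNReal.ofReal_lt_top
  have ha : ∫ p, ‖p.1 - p.2‖ ∂π ≤ x := by
    rw [integral_eq_lintegral_of_nonneg_ae (Eventually.of_forall fun _ => norm_nonneg _) hmeas]
    exact ENNReal.toReal_le_of_le_ofReal hx.le hcost.le
  have hYj := continuous_leaderPath (hm j) (hC j) Y0
  have hfd := flowDist_le hI hT hu huC (hm j) (hC j) hY hYj hΦ (hΦs j) hπ1 hπ2 hπi ha h3 h4 (hts j)
  refine (W1_flow_le hI hu huC (hm j) (hC j) hY hYj hΦ (hΦs j) hπ1 hπ2 hπi (hts j) ht).trans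
    (le_trans (ENNReal.ofReal_le_ofReal ?_) hxε)
  gcongr

end Weak

end LeaderFollower
end

noncomputable section

namespace LeaderFollower

/-! ### The cost functional and existence of optimal controls -/

section Cost

variable {m d : ℕ} {B K C T R : ℝ} {H : Space d → Space d} {G : Fin d → Space d → Space d}
  {L : Leaders m d → Measure (Space d) → ℝ}
  {us : ℕ → ℝ → Leaders m d} {u v Y : ℝ → Leaders m d} {Y0 : Leaders m d}
  {μ0s : ℕ → Measure (Space d)} {μ0 : Measure (Space d)} {μ : ℝ → Measure (Space d)}
  {Φs : ℕ → ℝ → Space d → Space d} {Φ : ℝ → Space d → Space d} {U : Set (Leaders m d)}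

theorem W1_self (μ : Measure (Space d)) [IsProbabilityMeasure μ] : W1 μ μ = 0 := by
  have := W1_map_le μ (measurable_id (α := Space d)) measurable_id
  simpa using this

/-- The running cost at time `t` along a flow. -/
def flowCost (L : Leaders m d → Measure (Space d) → ℝ) (Y0 : Leaders m d) (u : ℝ → Leaders m d)
    (μ0 : Measure (Space d)) (Φ : ℝ → Space d → Space d) (t : ℝ) : ℝ :=
  L (leaderPath u Y0 t) (μ0.map (Φ t))

theorem tendsto_flowCost_seq (hL : HypL L) (h : WeakTendsto T us u) (hI : Interactions B K H G)
    (hm : ∀ j, Measurable (us j)) (hC : ∀ j t, ‖us j t‖ ≤ C) (hu : Measurable u)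
    (huC : ∀ t, ‖u t‖ ≤ C) (hPs : ∀ j, IsProbabilityMeasure (μ0s j)) [IsProbabilityMeasure μ0]
    (hRs : ∀ j, SuppIn R (μ0s j)) (hR : SuppIn R μ0)
    (hW : Tendsto (fun j => W1 (μ0s j) μ0) atTop (𝓝 0))
    (hΦs : ∀ j, IsFlow H G (us j) (leaderPath (us j) Y0) (μ0s j) (Φs j))
    (hΦ : IsFlow H G u (leaderPath u Y0) μ0 Φ) {ts : ℕ → ℝ} {t : ℝ} (hts : ∀ j, ts j ∈ Icc 0 T)
    (ht : t ∈ Icc 0 T) (hlim : Tendsto ts atTop (𝓝 t)) :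
    Tendsto (fun j => flowCost L Y0 (us j) (μ0s j) (Φs j) (ts j)) atTop
      (𝓝 (flowCost L Y0 u μ0 Φ t)) := by
  have hs0 := hΦ.suppIn hI hu huC (continuous_leaderPath hu huC Y0) ht hR
  have hp0 := hΦ.prob t
  refine hL.continuous (R + velBound d B C * T) _ _ _ _ (fun j => ?_) (InP1.of_suppIn hs0) hs0
    (h.tendsto_leaderPath_seq hm hC hu huC Y0 ht hlim)
    (h.tendsto_W1_flow hI hm hC hu huC hPs hW hΦs hΦ hts ht hlim)
  have := hPs j
  have hp := (hΦs j).prob (ts j)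
  have hs := (hΦs j).suppIn hI (hm j) (hC j) (continuous_leaderPath (hm j) (hC j) Y0) (hts j)
    (hRs j)
  exact ⟨InP1.of_suppIn hs, hs⟩

theorem continuous_flowCost_clamp (hL : HypL L) (hI : Interactions B K H G) (hT : 0 ≤ T)
    (hu : Measurable u) (huC : ∀ t, ‖u t‖ ≤ C) [IsProbabilityMeasure μ0] (hR : SuppIn R μ0)
    (hΦ : IsFlow H G u (leaderPath u Y0) μ0 Φ) :
    Continuous fun t => flowCost L Y0 u μ0 Φ (clampIcc T t) := by
  refine continuous_iff_seqContinuous.2 fun ts t hts => ?_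
  exact tendsto_flowCost_seq hL (weakTendsto_const T u) hI (fun _ => hu) (fun _ => huC) hu huC
    (fun _ => inferInstance) (fun _ => hR) hR (by simp [W1_self]) (fun _ => hΦ) hΦ
    (fun j => clampIcc_mem hT (ts j)) (clampIcc_mem hT t)
    (((continuous_clampIcc T).tendsto t).comp hts)

theorem intervalIntegrable_flowCost (hL : HypL L) (hI : Interactions B K H G) (hT : 0 ≤ T)
    (hu : Measurable u) (huC : ∀ t, ‖u t‖ ≤ C) [IsProbabilityMeasure μ0] (hR : SuppIn R μ0)
    (hΦ : IsFlow H G u (leaderPath u Y0) μ0 Φ) :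
    IntervalIntegrable (flowCost L Y0 u μ0 Φ) volume 0 T := by
  refine ((continuous_flowCost_clamp hL hI hT hu huC hR hΦ).intervalIntegrable 0 T).congr ?_
  intro t ht
  rw [uIoc_of_le hT] at ht
  simp only [clampIcc_of_mem (Ioc_subset_Icc_self ht)]

theorem tendsto_integral_flowCost (hL : HypL L) (h : WeakTendsto T us u) (hI : Interactions B K H G)
    (hT : 0 ≤ T)
    (hm : ∀ j, Measurable (us j)) (hC : ∀ j t, ‖us j t‖ ≤ C) (hu : Measurable u)
    (huC : ∀ t, ‖u t‖ ≤ C) (hPs : ∀ j, IsProbabilityMeasure (μ0s j)) [IsProbabilityMeasure μ0]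
    (hRs : ∀ j, SuppIn R (μ0s j)) (hR : SuppIn R μ0)
    (hW : Tendsto (fun j => W1 (μ0s j) μ0) atTop (𝓝 0))
    (hΦs : ∀ j, IsFlow H G (us j) (leaderPath (us j) Y0) (μ0s j) (Φs j))
    (hΦ : IsFlow H G u (leaderPath u Y0) μ0 Φ) :
    Tendsto (fun j => ∫ t in (0 : ℝ)..T, flowCost L Y0 (us j) (μ0s j) (Φs j) t) atTop
      (𝓝 (∫ t in (0 : ℝ)..T, flowCost L Y0 u μ0 Φ t)) := by
  -- Uniformity follows by testing along convergent times: the perturbed and the limit running costs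
  -- both tend to the limit cost at the limit time.
  have hunif : ∀ ε > 0, ∀ᶠ j in atTop, ∀ t ∈ Icc 0 T,
      |flowCost L Y0 (us j) (μ0s j) (Φs j) t - flowCost L Y0 u μ0 Φ t| ≤ ε := by
    intro ε hε
    refine eventually_forall_le_of_seq (f := fun j t =>
      |flowCost L Y0 (us j) (μ0s j) (Φs j) t - flowCost L Y0 u μ0 Φ t|)
      (fun ψ hψ ts hts t ht hlim => ?_) hε
    have h1 := tendsto_flowCost_seq hL (h.subseq hψ) hI (fun j => hm (ψ j)) (fun j => hC (ψ j)) hu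
      huC (fun j => hPs (ψ j)) (fun j => hRs (ψ j)) hR (hW.comp hψ.tendsto_atTop)
      (fun j => hΦs (ψ j)) hΦ hts ht hlim
    have h2 := tendsto_flowCost_seq hL (weakTendsto_const T u) hI (fun _ => hu) (fun _ => huC) hu
      huC (fun _ => inferInstance) (fun _ => hR) hR (by simp [W1_self]) (fun _ => hΦ) hΦ hts ht hlim
    simpa using (h1.sub h2).abs
  rw [Metric.tendsto_atTop']
  intro ε hε
  obtain ⟨n, hn⟩ := eventually_atTop.1 (hunif (ε / (T + 1)) (by positivity))
  refine ⟨n, fun j hj => ?_⟩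
  have := hPs j
  rw [dist_eq_norm, ← intervalIntegral.integral_sub
    (intervalIntegrable_flowCost hL hI hT (hm j) (hC j) (hRs j) (hΦs j))
    (intervalIntegrable_flowCost hL hI hT hu huC hR hΦ)]
  refine (intervalIntegral.norm_integral_le_of_norm_le_const (C := ε / (T + 1)) fun t ht => ?_).trans_lt ?_
  · rw [uIoc_of_le hT] at ht
    exact hn j hj.le t (Ioc_subset_Icc_self ht)
  · rw [sub_zero, abs_of_nonneg hT, div_mul_eq_mul_div, div_lt_iff₀ (by positivity)]
    nlinarith

theorem IsMeanFieldSol.cost_eq (hL : HypL L) (hI : Interactions B K H G) (hT : 0 ≤ T)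
    (huv : u =ᵐ[volume.restrict (Icc 0 T)] v) (hv : Measurable v) (hvC : ∀ t, ‖v t‖ ≤ C)
    (hμ0 : InP1 μ0) (hR : SuppIn R μ0) (hΦ : IsFlow H G v (leaderPath v Y0) μ0 Φ)
    (hs : IsMeanFieldSol T H G u Y0 μ0 Y μ) :
    cost T L u Y μ = (∫ t in (0 : ℝ)..T, flowCost L Y0 v μ0 Φ t) + energy T v := by
  have := hμ0.prob
  have hs' := hs.congr huv
  rw [cost_congr hT huv (fun t ht => hs'.eq_leaderPath ht)
    (fun t ht => hs'.eq_map_flow hI hT hv hvC hμ0 hR hΦ ht)]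
  have he : energy T v = ∫ t in (0 : ℝ)..T, ∑ k, ‖v t k‖ ^ 2 := by
    rw [intervalIntegral.integral_of_le hT, ← integral_Icc_eq_integral_Ioc]; rfl
  have hi : IntervalIntegrable (fun t => ∑ k, ‖v t k‖ ^ 2) volume 0 T := by
    rw [intervalIntegrable_iff_integrableOn_Icc_of_le hT]
    exact integrable_sum_norm_sq hv hvC
  rw [he, ← intervalIntegral.integral_add
    (intervalIntegrable_flowCost hL hI hT hv hvC hR hΦ) hi]
  rfl

theorem energy_nonneg (T : ℝ) (u : ℝ → Leaders m d) : 0 ≤ energy T u :=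
  integral_nonneg fun _ => by positivity

theorem ControlsTendsto.congr {us' : ℕ → ℝ → Leaders m d}
    (h : ∀ j, us j =ᵐ[volume.restrict (Icc 0 T)] us' j) (hs : ControlsTendsto T us u) :
    ControlsTendsto T us' u := by
  refine Tendsto.congr (fun j => eLpNorm_congr_ae ?_) hs
  filter_upwards [h j] with t ht
  rw [ht]

/-- Almost optimal controls for converging initial data have a subsequence that converges
strongly to an optimal control of the limit problem. -/
theorem exists_tendsto_isMeanFieldOptimal (hL : HypL L) (hI : Interactions B K H G) (hT : 0 ≤ T)
    (hU : IsClosed U) (hconv : Convex ℝ U) (hUC : ∀ w ∈ U, ‖w‖ ≤ C)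
    (hPs : ∀ j, InP1 (μ0s j)) (hP : InP1 μ0) (hRs : ∀ j, SuppIn R (μ0s j)) (hR : SuppIn R μ0)
    (hW : Tendsto (fun j => W1 (μ0s j) μ0) atTop (𝓝 0)) (hne : U.Nonempty)
    (hadm : ∀ j, Admissible T U (us j)) {Ys : ℕ → ℝ → Leaders m d}
    {μs : ℕ → ℝ → Measure (Space d)}
    (hs : ∀ j, IsMeanFieldSol T H G (us j) Y0 (μ0s j) (Ys j) (μs j)) {ε : ℕ → ℝ}
    (hε : Tendsto ε atTop (𝓝 0))
    (hopt : ∀ j v, Admissible T U v → ∀ Z ν, IsMeanFieldSol T H G v Y0 (μ0s j) Z ν →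
      cost T L (us j) (Ys j) (μs j) ≤ cost T L v Z ν + ε j) :
    ∃ (σ : ℕ → ℕ) (u : ℝ → Leaders m d), StrictMono σ ∧
      ControlsTendsto T (fun j => us (σ j)) u ∧ IsMeanFieldOptimal T U H G L Y0 μ0 u := by
  have := hP.prob
  have hPs' : ∀ j, IsProbabilityMeasure (μ0s j) := fun j => (hPs j).prob
  choose vs hvm hvU huv using fun j => (hadm j).exists_measurable hU hne
  have hvC : ∀ j t, ‖vs j t‖ ≤ C := fun j t => hUC _ (hvU j t)
  obtain ⟨σ, u, hσ, hum, huU, hw⟩ := exists_weakTendsto (T := T) hU hconv hUC hvm hvU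
  have huC : ∀ t, ‖u t‖ ≤ C := fun t => hUC _ (huU t)
  have hWσ := hW.comp hσ.tendsto_atTop
  have hflow : ∀ (w : ℝ → Leaders m d), Measurable w → (∀ t, ‖w t‖ ≤ C) → ∀ j,
      ∃ Φ, IsFlow H G w (leaderPath w Y0) (μ0s j) Φ := fun w hw hwC j =>
    hI.exists_isFlow hw hwC Y0 (hPs j)
  choose Φs hΦs using fun j => hflow (vs j) (hvm j) (hvC j) j
  obtain ⟨Φ, hΦ⟩ := hI.exists_isFlow hum huC Y0 hP
  -- comparison with a fixed competitor
  have hcomp : ∀ w : ℝ → Leaders m d, Measurable w → (∀ t, w t ∈ U) → ∀ Ψ,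
      IsFlow H G w (leaderPath w Y0) μ0 Ψ → ∃ c : ℕ → ℝ,
      Tendsto c atTop (𝓝 ((∫ t in (0 : ℝ)..T, flowCost L Y0 w μ0 Ψ t) + energy T w)) ∧
      ∀ j, (∫ t in (0 : ℝ)..T, flowCost L Y0 (vs (σ j)) (μ0s (σ j)) (Φs (σ j)) t) +
        energy T (vs (σ j)) ≤ c j + ε (σ j) := by
    intro w hw hwU Ψ hΨ
    have hwC : ∀ t, ‖w t‖ ≤ C := fun t => hUC _ (hwU t)
    choose Ψs hΨs using hflow w hw hwC
    refine ⟨fun j => (∫ t in (0 : ℝ)..T, flowCost L Y0 w (μ0s (σ j)) (Ψs (σ j)) t) + energy T w,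
      (tendsto_integral_flowCost hL (weakTendsto_const T w) hI hT (fun _ => hw) (fun _ => hwC) hw
        hwC (fun j => hPs' (σ j)) (fun j => hRs (σ j)) hR hWσ (fun j => hΨs (σ j)) hΨ).add_const _,
      fun j => ?_⟩
    have := hPs' (σ j)
    have hsol := (hΨs (σ j)).isMeanFieldSol (T := T) hI hw hwC (hRs (σ j))
    have h1 := hopt (σ j) w (admissible_of_forall_mem hw hwU) _ _ hsol
    rwa [(hs (σ j)).cost_eq hL hI hT (huv _) (hvm _) (hvC _) (hPs _) (hRs _) (hΦs _),
      hsol.cost_eq hL hI hT EventuallyEq.rfl hw hwC (hPs _) (hRs _) (hΨs _)] at h1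
  have hI1 := tendsto_integral_flowCost hL hw hI hT (fun j => hvm (σ j)) (fun j => hvC (σ j)) hum
    huC (fun j => hPs' (σ j)) (fun j => hRs (σ j)) hR hWσ (fun j => hΦs (σ j)) hΦ
  have hE := hw.tendsto_energy (fun j => hvm (σ j)) (fun j => hvC (σ j)) hum huC
  have hεσ := hε.comp hσ.tendsto_atTop
  -- The weak limit `u` is itself the competitor. The running costs on both sides have the same
  -- limit and cancel, so the energies are asymptotically at most that of `u`, and `hE` turns the
  -- excess into the energy of the difference.
  have hD : Tendsto (fun j => energy T fun s => vs (σ j) s - u s) atTop (𝓝 0) := by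
    obtain ⟨c, hc, hle⟩ := hcomp u hum huU Φ hΦ
    have hup := (((hc.add hεσ).sub hI1).sub_const (energy T u)).sub hE
    refine tendsto_of_tendsto_of_tendsto_of_le_of_le tendsto_const_nhds
      (hup.trans_eq ?_) (fun j => energy_nonneg _ _) fun j => ?_
    · congr 1; ring
    · have := hle j
      simp only [Function.comp_apply]
      linarith
  refine ⟨σ, u, hσ, ControlsTendsto.congr (fun j => (huv (σ j)).symm)
    (controlsTendsto_of_energy (fun j => hvm (σ j)) (fun j => hvC (σ j)) hum huC hD),
    admissible_of_forall_mem hum huU, _, _, hΦ.isMeanFieldSol hI hum huC hR, ?_⟩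
  intro v hv Z ν hZ
  obtain ⟨w, hwm, hwU, hvw⟩ := hv.exists_measurable hU hne
  have hwC : ∀ t, ‖w t‖ ≤ C := fun t => hUC _ (hwU t)
  obtain ⟨Ψ, hΨ⟩ := hI.exists_isFlow hwm hwC Y0 hP
  rw [(hΦ.isMeanFieldSol hI hum huC hR).cost_eq hL hI hT EventuallyEq.rfl hum huC hP hR hΦ,
    hZ.cost_eq hL hI hT hvw hwm hwC hP hR hΨ]
  obtain ⟨c, hc, hle⟩ := hcomp w hwm hwU Ψ hΨ
  -- By `hE` and `hD` the energies converge to that of `u`, so the full costs converge and the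
  -- comparison with any competitor passes to the limit.
  have hlow := (hI1.add ((hE.add hD).add_const (energy T u)))
  have hup := hc.add hεσ
  rw [add_zero] at hup
  refine (le_of_tendsto_of_tendsto' hlow hup fun j => ?_).trans_eq' ?_
  · have := hle j
    simp only [Function.comp_apply]
    linarith
  · ring

/-- Existence of an optimal control for globally Lipschitz interactions. -/
theorem exists_isMeanFieldOptimal (hL : HypL L) (hI : Interactions B K H G) (hT : 0 ≤ T)
    (hU : IsClosed U) (hconv : Convex ℝ U) (hUC : ∀ w ∈ U, ‖w‖ ≤ C) (hne : U.Nonempty)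
    (hP : InP1 μ0) (hR : SuppIn R μ0) (Y0 : Leaders m d) :
    ∃ u, IsMeanFieldOptimal T U H G L Y0 μ0 u := by
  have := hP.prob
  set S : Set ℝ := {c | ∃ u Y μ, Admissible T U u ∧ IsMeanFieldSol T H G u Y0 μ0 Y μ ∧
    cost T L u Y μ = c} with hS
  have hbdd : BddBelow S := by
    refine ⟨0, ?_⟩
    rintro c ⟨u, Y, μ, -, hs, rfl⟩
    refine intervalIntegral.integral_nonneg hT fun t ht => ?_
    exact add_nonneg (hL.nonneg _ _ (hs.inP1 t ht)) (by positivity)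
  have hSne : S.Nonempty := by
    obtain ⟨w, hw⟩ := hne
    have hadm : Admissible T U fun _ : ℝ => w :=
      admissible_of_forall_mem measurable_const fun _ => hw
    obtain ⟨⟨Y, μ, hs⟩, -⟩ := hI.meanField_wellPosed hT hU ⟨w, hw⟩ hUC Y0 hP hR hadm
    exact ⟨_, _, Y, μ, hadm, hs, rfl⟩
  have hmin : ∀ j : ℕ, ∃ c ∈ S, c < sInf S + 1 / ((j : ℝ) + 1) := fun j =>
    exists_lt_of_csInf_lt hSne (lt_add_of_pos_right _ Nat.one_div_pos_of_nat)
  choose c hc hlt using hmin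
  choose us Ys μs hadm hs hcost using hc
  -- A minimizing sequence is a sequence of almost optimal controls for a constant datum.
  obtain ⟨σ, u, -, -, hopt⟩ := exists_tendsto_isMeanFieldOptimal (μ0s := fun _ => μ0) hL hI hT hU
    hconv hUC (fun _ => hP) hP (fun _ => hR) hR (by simp [W1_self]) hne hadm hs
    tendsto_one_div_add_atTop_nhds_zero_nat fun j v hv Z ν hZ => by
      rw [hcost j]
      have h1 : sInf S ≤ cost T L v Z ν := csInf_le hbdd ⟨v, Z, ν, hv, hZ, rfl⟩
      linarith [hlt j]
  exact ⟨u, hopt⟩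

end Cost

end LeaderFollower
end

noncomputable section

namespace LeaderFollower

/-! ### Approximation by empirical measures -/

section Empirical

variable {d : ℕ}

/-- Each cell `[k/N, (k+1)/N)` has length `1/N`. Thus an empirical measure is the law of a step
function on the unit interval, and can be compared there with any other law. -/
theorem map_floor_eq {N : ℕ} (hN : 1 ≤ N) :
    (volume.restrict (Ico (0 : ℝ) 1)).map (fun s : ℝ => ⌊(N : ℝ) * s⌋₊) =
      (N : ℝ≥0∞)⁻¹ • ∑ i : Fin N, Measure.dirac (i : ℕ) := by
  have hN' : (0 : ℝ) < N := by exact_mod_cast hN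
  have hm : Measurable fun s : ℝ => ⌊(N : ℝ) * s⌋₊ := by fun_prop
  refine Measure.ext_of_singleton fun k => ?_
  rw [Measure.map_apply hm (measurableSet_singleton k),
    Measure.restrict_apply (hm (measurableSet_singleton k)), Measure.smul_apply,
    Measure.finsetSum_apply]
  by_cases hk : k < N
  · have hset : (fun s : ℝ => ⌊(N : ℝ) * s⌋₊) ⁻¹' {k} ∩ Ico 0 1 =
        Ico ((k : ℝ) / N) (((k : ℝ) + 1) / N) := by
      ext s
      simp only [mem_inter_iff, mem_preimage, mem_singleton_iff, mem_Ico]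
      rw [div_le_iff₀ hN', lt_div_iff₀ hN', mul_comm s]
      constructor
      · rintro ⟨h1, h2, -⟩
        exact (Nat.floor_eq_iff (by positivity)).1 h1
      · rintro ⟨h1, h2⟩
        have h3 : (0 : ℝ) ≤ N * s := (Nat.cast_nonneg k).trans h1
        refine ⟨(Nat.floor_eq_iff h3).2 ⟨h1, h2⟩, nonneg_of_mul_nonneg_right h3 hN', ?_⟩
        have : (k : ℝ) + 1 ≤ N := by exact_mod_cast hk
        by_contra hs
        nlinarith [not_lt.1 hs]
    have hsum : ∑ i : Fin N, Measure.dirac (i : ℕ) ({k} : Set ℕ) = 1 := by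
      rw [Finset.sum_eq_single_of_mem (⟨k, hk⟩ : Fin N) (Finset.mem_univ _)]
      · simp
      · intro i _ hi
        have : (i : ℕ) ≠ k := fun h => hi (Fin.ext h)
        simp [this]
    rw [hset, Real.volume_Ico, hsum, ← sub_div, add_sub_cancel_left, smul_eq_mul, mul_one, one_div,
      ENNReal.ofReal_inv_of_pos hN', ENNReal.ofReal_natCast]
  · have hset : (fun s : ℝ => ⌊(N : ℝ) * s⌋₊) ⁻¹' {k} ∩ Ico 0 1 = ∅ := by
      refine eq_empty_iff_forall_notMem.2 fun s hs => hk ?_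
      obtain ⟨h1, h2, h3⟩ := hs
      rw [mem_preimage, mem_singleton_iff] at h1
      rw [← h1, Nat.floor_lt (by positivity)]
      nlinarith
    have hsum : ∑ i : Fin N, Measure.dirac (i : ℕ) ({k} : Set ℕ) = 0 := by
      refine Finset.sum_eq_zero fun i _ => ?_
      have : (i : ℕ) ≠ k := fun h => hk (h ▸ i.2)
      simp [this]
    rw [hset, hsum]; simp

theorem map_floor_comp {N : ℕ} (hN : 1 ≤ N) (a : ℕ → Space d) :
    (volume.restrict (Ico (0 : ℝ) 1)).map (fun s : ℝ => a ⌊(N : ℝ) * s⌋₊) =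
      empirical fun i : Fin N => a i := by
  have hm : Measurable fun s : ℝ => ⌊(N : ℝ) * s⌋₊ := by fun_prop
  have ha : Measurable a := measurable_from_top
  have h1 := Measure.map_map (μ := volume.restrict (Ico (0 : ℝ) 1)) ha hm
  rw [Function.comp_def] at h1
  rw [← h1, map_floor_eq hN, Measure.map_smul, Measure.map_finset_sum ha.aemeasurable]
  unfold empirical
  congr 1
  exact Finset.sum_congr rfl fun i _ => Measure.map_dirac' ha _

/-- A compactly supported probability measure is the law of a bounded function on the unit
interval. -/
theorem exists_bounded_map_eq {μ : Measure (Space d)} [IsProbabilityMeasure μ] {R : ℝ}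
    (hR0 : 0 ≤ R) (hR : SuppIn R μ) : ∃ f : ℝ → Space d, Measurable f ∧ (∀ s, ‖f s‖ ≤ R) ∧
      (volume.restrict (Ico (0 : ℝ) 1)).map f = μ := by
  obtain ⟨f, hf, hfμ⟩ := Measure.exists_measurable_map_eq μ
  classical
  -- The representing function takes values outside the ball only on a null set; resetting them to
  -- `0` makes the bound hold everywhere without changing the law.
  set φ : Space d → Space d := fun x => if ‖x‖ ≤ R then x else 0 with hφ
  have hφm : Measurable φ :=
    Measurable.ite (measurableSet_le measurable_norm measurable_const) measurable_id measurable_const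
  have hφR : ∀ x, ‖φ x‖ ≤ R := fun x => by
    simp only [hφ]
    split_ifs with h
    exacts [h, by simpa using hR0]
  have hφμ : μ.map φ = μ := by
    have : φ =ᵐ[μ] id := by
      filter_upwards [hR.ae_norm_le] with x hx
      simp only [hφ, if_pos hx, id]
    rw [Measure.map_congr this, Measure.map_id]
  have hp : Measurable (projIcc (0 : ℝ) 1 zero_le_one) := continuous_projIcc.measurable
  refine ⟨fun s => φ (f (projIcc 0 1 zero_le_one s)), hφm.comp (hf.comp hp), fun s => hφR _, ?_⟩
  have hv : (volume.restrict (Ico (0 : ℝ) 1)) =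
      (volume : Measure unitInterval).map Subtype.val := by
    rw [Measure.restrict_congr_set Ico_ae_eq_Icc]
    exact (measurePreserving_subtype_coe measurableSet_Icc).map_eq.symm
  have hcomp : Measurable fun s => φ (f (projIcc (0 : ℝ) 1 zero_le_one s)) :=
    hφm.comp (hf.comp hp)
  rw [hv, Measure.map_map hcomp measurable_subtype_coe]
  have : (fun s => φ (f (projIcc (0 : ℝ) 1 zero_le_one s))) ∘ (Subtype.val : unitInterval → ℝ) =
      φ ∘ f := by
    funext s
    simp only [Function.comp_apply]
    rw [projIcc_val zero_le_one s]
  rw [this, ← Measure.map_map hφm hf, hfμ, hφμ]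

/-- A compactly supported probability measure is a limit of empirical measures of points in a
ball that supports it. -/
theorem exists_tendsto_empirical {μ : Measure (Space d)} [IsProbabilityMeasure μ] {R : ℝ}
    (hR0 : 0 ≤ R) (hR : SuppIn R μ) : ∃ X : (N : ℕ) → Fin N → Space d, (∀ N i, ‖X N i‖ ≤ R) ∧
      Tendsto (fun N => W1 (empirical (X N)) μ) atTop (𝓝 0) := by
  obtain ⟨f, hf, hfR, hfμ⟩ := exists_bounded_map_eq hR0 hR
  -- The closed ball is the cell `[i/N, (i+1)/N]`, so the particles are the cell averages of `f`.
  -- They stay in the ball of radius `R` by convexity.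
  set a : ℕ → ℕ → Space d := fun N i =>
    ⨍ y in Metric.closedBall (((i : ℝ) + 1 / 2) / N) (1 / (2 * N)), f y with ha
  have hloc : LocallyIntegrable f volume := by
    refine (locallyIntegrable_const R).mono hf.aestronglyMeasurable (Eventually.of_forall fun s => ?_)
    rw [Real.norm_of_nonneg hR0]; exact hfR s
  have haR : ∀ N : ℕ, 1 ≤ N → ∀ i, ‖a N i‖ ≤ R := by
    intro N hN i
    have hN' : (0 : ℝ) < N := by exact_mod_cast hN
    have := (convex_closedBall (0 : Space d) R).set_average_mem (μ := volume)
      (t := Metric.closedBall (((i : ℝ) + 1 / 2) / N) (1 / (2 * N))) (f := f)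
      Metric.isClosed_closedBall
      (Metric.measure_closedBall_pos volume _ (by positivity)).ne'
      (by rw [Real.volume_closedBall]; exact ENNReal.ofReal_ne_top)
      (Eventually.of_forall fun s => mem_closedBall_zero_iff.2 (hfR s))
      (hloc.integrableOn_isCompact (isCompact_closedBall _ _))
    exact mem_closedBall_zero_iff.1 this
  refine ⟨fun N i => a N i, fun N i => haR N (Nat.one_le_iff_ne_zero.2 fun h => ?_) i, ?_⟩
  · subst h; exact i.elim0
  set P : Measure ℝ := volume.restrict (Ico 0 1) with hP
  have hPp : IsProbabilityMeasure P := ⟨by simp [hP]⟩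
  have hstep : ∀ N : ℕ, Measurable fun s : ℝ => a N ⌊(N : ℝ) * s⌋₊ := fun N => by
    have h1 : Measurable (a N) := measurable_from_top
    have h2 : Measurable fun s : ℝ => ⌊(N : ℝ) * s⌋₊ := by fun_prop
    exact h1.comp h2
  -- Lebesgue differentiation along the shrinking cells that contain `s`; they are not centred at
  -- `s`, but `s` lies within one radius of the centre. The shift by one avoids the degenerate case
  -- `N = 0`.
  have hlim : ∀ᵐ s ∂P, Tendsto (fun N : ℕ => a (N + 1) ⌊((N + 1 : ℕ) : ℝ) * s⌋₊) atTop (𝓝 (f s)) := by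
    have h1 := ae_restrict_of_ae (s := Ico (0 : ℝ) 1)
      (IsUnifLocDoublingMeasure.ae_tendsto_average volume hloc 1)
    filter_upwards [h1, ae_restrict_mem measurableSet_Ico] with s hs hs01
    refine hs (fun N : ℕ => (((⌊((N + 1 : ℕ) : ℝ) * s⌋₊ : ℕ) : ℝ) + 1 / 2) / ((N + 1 : ℕ) : ℝ))
      (fun N : ℕ => 1 / (2 * ((N + 1 : ℕ) : ℝ))) ?_ (Eventually.of_forall fun N => ?_)
    · refine tendsto_nhdsWithin_iff.2 ⟨?_, Eventually.of_forall fun N => ?_⟩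
      · have := (tendsto_one_div_add_atTop_nhds_zero_nat (𝕜 := ℝ)).const_mul (1 / 2)
        rw [mul_zero] at this
        refine this.congr fun N => ?_
        push_cast
        field_simp
      · exact mem_Ioi.2 (by positivity)
    · have hN' : (0 : ℝ) < ((N + 1 : ℕ) : ℝ) := by positivity
      rw [Metric.mem_closedBall, Real.dist_eq, one_mul]
      have h2 := Nat.floor_le (mul_nonneg hN'.le hs01.1)
      have h3 := Nat.lt_floor_add_one (((N + 1 : ℕ) : ℝ) * s)
      set n : ℝ := ((N + 1 : ℕ) : ℝ)
      set q : ℝ := (⌊n * s⌋₊ : ℝ)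
      have h4 : s - (q + 1 / 2) / n = (n * s - q - 1 / 2) / n := by field_simp; ring
      have h5 : 1 / (2 * n) = (1 / 2) / n := by field_simp
      rw [h4, h5, abs_div, abs_of_pos hN']
      gcongr
      rw [abs_le]
      constructor <;> linarith
  have hdom := tendsto_lintegral_norm_of_dominated_convergence (μ := P) (bound := fun _ => R)
    (F := fun (N : ℕ) s => a (N + 1) ⌊((N + 1 : ℕ) : ℝ) * s⌋₊) (f := f)
    (fun N => (hstep (N + 1)).aestronglyMeasurable) (integrable_const R).2
    (fun N => Eventually.of_forall fun s => haR _ (by simp) _) hlim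
  rw [← tendsto_add_atTop_iff_nat 1]
  refine tendsto_of_tendsto_of_tendsto_of_le_of_le tendsto_const_nhds hdom (fun _ => zero_le)
    fun N => ?_
  beta_reduce
  rw [← map_floor_comp (by simp) (a (N + 1)), ← hfμ]
  exact W1_map_le P (hstep (N + 1)) hf

end Empirical

/-! ### Optimal controls of the finite problems -/

section Optimal

variable {m d N : ℕ} {B K C T R : ℝ} {H H' : Space d → Space d} {G G' : Fin d → Space d → Space d}
  {L : Leaders m d → Measure (Space d) → ℝ} {U : Set (Leaders m d)}
  {u v : ℝ → Leaders m d} {Y0 : Leaders m d} {μ0 : Measure (Space d)} {X0 : Fin N → Space d}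

theorem IsMeanFieldOptimal.congr_sol (h : ∀ u, Admissible T U u → ∀ Y μ,
      IsMeanFieldSol T H G u Y0 μ0 Y μ ↔ IsMeanFieldSol T H' G' u Y0 μ0 Y μ)
    (hu : IsMeanFieldOptimal T U H G L Y0 μ0 u) : IsMeanFieldOptimal T U H' G' L Y0 μ0 u := by
  obtain ⟨hadm, Y, μ, hs, hopt⟩ := hu
  exact ⟨hadm, Y, μ, (h u hadm Y μ).1 hs, fun v hv Z ν hZ => hopt v hv Z ν ((h v hv Z ν).2 hZ)⟩

theorem IsFiniteOptimal.congr_sol (h : ∀ u, Admissible T U u → ∀ Y X,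
      IsFiniteSol T H G u Y0 X0 Y X ↔ IsFiniteSol T H' G' u Y0 X0 Y X)
    (hu : IsFiniteOptimal T U H G L Y0 X0 u) : IsFiniteOptimal T U H' G' L Y0 X0 u := by
  obtain ⟨hadm, Y, X, hs, hopt⟩ := hu
  exact ⟨hadm, Y, X, (h u hadm Y X).1 hs, fun v hv Z W hZ => hopt v hv Z W ((h v hv Z W).2 hZ)⟩

theorem IsMeanFieldOptimal.congr (hT : 0 ≤ T) (huv : u =ᵐ[volume.restrict (Icc 0 T)] v)
    (hu : IsMeanFieldOptimal T U H G L Y0 μ0 u) : IsMeanFieldOptimal T U H G L Y0 μ0 v := by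
  obtain ⟨hadm, Y, μ, hs, hopt⟩ := hu
  refine ⟨⟨hadm.measurable.congr huv, ?_⟩, Y, μ, hs.congr huv, fun w hw Z ν hZ => ?_⟩
  · filter_upwards [hadm.mem, huv] with t h1 h2
    rwa [← h2]
  · rw [← cost_congr hT huv (fun _ _ => rfl) fun _ _ => rfl]
    exact hopt w hw Z ν hZ

/-- The problem with finitely many followers is the mean-field problem for an empirical datum. -/
theorem isFiniteOptimal_iff (hI : Interactions B K H G) (hT : 0 ≤ T) (hU : IsClosed U)
    (hne : U.Nonempty) (hUC : ∀ w ∈ U, ‖w‖ ≤ C) (hN : 1 ≤ N) (hX0 : ∀ i, ‖X0 i‖ ≤ R) :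
    IsFiniteOptimal T U H G L Y0 X0 u ↔ IsMeanFieldOptimal T U H G L Y0 (empirical X0) u := by
  have := isProbabilityMeasure_empirical hN X0
  have hR := suppIn_empirical hX0
  have hP : InP1 (empirical X0) := InP1.of_suppIn hR
  -- The empirical curve extends to a mean-field solution, and mean-field uniqueness identifies it
  -- on `[0, T]` with any other one.
  have hcost : ∀ v, Admissible T U v → ∀ Z W, IsFiniteSol T H G v Y0 X0 Z W → ∀ Z' ν,
      IsMeanFieldSol T H G v Y0 (empirical X0) Z' ν →
      cost T L v Z (fun t => empirical (W t)) = cost T L v Z' ν := by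
    intro v hv Z W hZ Z' ν hZ'
    obtain ⟨Z₁, ν₁, hs₁, heq⟩ := hZ.exists_isMeanFieldSol hI hT hU hne hUC hN hX0 hv
    have huniq := (hI.meanField_wellPosed hT hU hne hUC Y0 hP hR hv).2 _ _ _ _ hs₁ hZ'
    exact cost_congr hT EventuallyEq.rfl (fun t ht => (heq t ht).1.trans (huniq t ht).1)
      fun t ht => (heq t ht).2.trans (huniq t ht).2
  constructor
  · rintro ⟨hadm, Y, X, hs, hopt⟩
    obtain ⟨Z, ν, hZ, -⟩ := hs.exists_isMeanFieldSol hI hT hU hne hUC hN hX0 hadm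
    refine ⟨hadm, Z, ν, hZ, fun v hv Z' ν' hZ' => ?_⟩
    obtain ⟨Y₁, X₁, hs₁⟩ := (hI.finite_wellPosed hT hU hne hUC Y0 hN X0 hX0 hv).1
    rw [← hcost u hadm Y X hs Z ν hZ, ← hcost v hv Y₁ X₁ hs₁ Z' ν' hZ']
    exact hopt v hv Y₁ X₁ hs₁
  · rintro ⟨hadm, Z, ν, hZ, hopt⟩
    obtain ⟨Y, X, hs⟩ := (hI.finite_wellPosed hT hU hne hUC Y0 hN X0 hX0 hadm).1
    refine ⟨hadm, Y, X, hs, fun v hv Y₁ X₁ hs₁ => ?_⟩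
    obtain ⟨Z', ν', hZ', -⟩ := hs₁.exists_isMeanFieldSol hI hT hU hne hUC hN hX0 hv
    rw [hcost u hadm Y X hs Z ν hZ, hcost v hv Y₁ X₁ hs₁ Z' ν' hZ']
    exact hopt v hv Z' ν' hZ'

theorem ControlsTendsto.subseq {us : ℕ → ℝ → Leaders m d} (h : ControlsTendsto T us u)
    {ψ : ℕ → ℕ} (hψ : Tendsto ψ atTop atTop) : ControlsTendsto T (fun j => us (ψ j)) u := by
  unfold ControlsTendsto at h ⊢
  exact h.comp hψ

theorem ControlsTendsto.ae_eq {us : ℕ → ℝ → Leaders m d}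
    (hus : ∀ j, AEStronglyMeasurable (us j) (volume.restrict (Icc 0 T)))
    (hum : AEStronglyMeasurable u (volume.restrict (Icc 0 T)))
    (hvm : AEStronglyMeasurable v (volume.restrict (Icc 0 T)))
    (hu : ControlsTendsto T us u) (hv : ControlsTendsto T us v) :
    u =ᵐ[volume.restrict (Icc 0 T)] v :=
  tendstoInMeasure_ae_unique
    (tendstoInMeasure_of_tendsto_eLpNorm two_ne_zero hus hum hu)
    (tendstoInMeasure_of_tendsto_eLpNorm two_ne_zero hus hvm hv)

/-- The indices `φ` are arbitrary so that the result also applies along a given subsequence. The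
condition `1 ≤ φ j` is needed because the empirical measure of no points is not a probability
measure. -/
theorem exists_tendsto_of_isFiniteOptimal (hL : HypL L) (hI : Interactions B K H G) (hT : 0 ≤ T)
    (hU : IsClosed U) (hconv : Convex ℝ U) (hUC : ∀ w ∈ U, ‖w‖ ≤ C) (hne : U.Nonempty)
    (hP : InP1 μ0) (hR : SuppIn R μ0) {X0 : (N : ℕ) → Fin N → Space d}
    (hX0 : ∀ N i, ‖X0 N i‖ ≤ R)
    (hW : Tendsto (fun N => W1 (empirical (X0 N)) μ0) atTop (𝓝 0)) {us : ℕ → ℝ → Leaders m d}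
    (hopt : ∀ N, 1 ≤ N → IsFiniteOptimal T U H G L Y0 (X0 N) (us N)) {φ : ℕ → ℕ}
    (hφ : Tendsto φ atTop atTop) (hφ1 : ∀ j, 1 ≤ φ j) :
    ∃ (σ : ℕ → ℕ) (u : ℝ → Leaders m d), StrictMono σ ∧
      ControlsTendsto T (fun j => us (φ (σ j))) u ∧ IsMeanFieldOptimal T U H G L Y0 μ0 u := by
  have hmf : ∀ j, IsMeanFieldOptimal T U H G L Y0 (empirical (X0 (φ j))) (us (φ j)) := fun j =>
    (isFiniteOptimal_iff hI hT hU hne hUC (hφ1 j) (hX0 _)).1 (hopt _ (hφ1 j))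
  choose hadm Ys μs hs hmin using hmf
  have hRs : ∀ j, SuppIn R (empirical (X0 (φ j))) := fun j => suppIn_empirical (hX0 _)
  refine exists_tendsto_isMeanFieldOptimal (us := fun j => us (φ j)) hL hI hT hU hconv hUC
    (fun j => ?_) hP hRs hR (hW.comp hφ) hne hadm hs tendsto_const_nhds
    fun j v hv Z ν hZ => (hmin j v hv Z ν hZ).trans_eq (add_zero _).symm
  have := isProbabilityMeasure_empirical (hφ1 j) (X0 (φ j))
  exact InP1.of_suppIn (hRs j)

/-- A further subsequence converges to some minimizer; limits in `L²` agree almost everywhere, and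
optimality depends only on the class of the control. -/
theorem isMeanFieldOptimal_of_tendsto (hL : HypL L) (hI : Interactions B K H G) (hT : 0 ≤ T)
    (hU : IsClosed U) (hconv : Convex ℝ U) (hUC : ∀ w ∈ U, ‖w‖ ≤ C) (hne : U.Nonempty)
    (hP : InP1 μ0) (hR : SuppIn R μ0) {X0 : (N : ℕ) → Fin N → Space d}
    (hX0 : ∀ N i, ‖X0 N i‖ ≤ R)
    (hW : Tendsto (fun N => W1 (empirical (X0 N)) μ0) atTop (𝓝 0)) {us : ℕ → ℝ → Leaders m d}
    (hopt : ∀ N, 1 ≤ N → IsFiniteOptimal T U H G L Y0 (X0 N) (us N)) {σ : ℕ → ℕ}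
    (hσ : StrictMono σ) (hum : AEStronglyMeasurable u (volume.restrict (Icc 0 T)))
    (hu : ControlsTendsto T (fun j => us (σ j)) u) : IsMeanFieldOptimal T U H G L Y0 μ0 u := by
  -- The index `σ 0` may be `0`, where nothing is known about the control, so the first term is
  -- dropped.
  have hσ1 : ∀ j, 1 ≤ σ (j + 1) := fun j => (Nat.le_add_left 1 j).trans (hσ.id_le (j + 1))
  have hshift : Tendsto (fun j => j + 1) atTop atTop := tendsto_add_atTop_nat 1
  obtain ⟨ψ, v, hψ, hv, hvopt⟩ := exists_tendsto_of_isFiniteOptimal hL hI hT hU hconv hUC hne hP hR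
    hX0 hW hopt (hσ.tendsto_atTop.comp hshift) hσ1
  refine hvopt.congr hT ?_
  exact ControlsTendsto.ae_eq (fun j => (hopt _ (hσ1 (ψ j))).1.measurable) hvopt.1.measurable hum hv
    (hu.subseq (hshift.comp hψ.tendsto_atTop))

end Optimal

end LeaderFollower
end

/-! ### The main theorem: transfer from globally Lipschitz to the given interactions -/

theorem mainTheorem3 {m d : ℕ} (T : ℝ) (hT : 0 < T)
    (U : Set (LeaderFollower.Leaders m d))
    (hUne : U.Nonempty) (hUcompact : IsCompact U) (hUconvex : Convex ℝ U)
    (H : LeaderFollower.Space d → LeaderFollower.Space d)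
    (G : Fin d → LeaderFollower.Space d → LeaderFollower.Space d)
    (hHG : LeaderFollower.HypH H G)
    (L : LeaderFollower.Leaders m d → Measure (LeaderFollower.Space d) → ℝ)
    (hL : LeaderFollower.HypL L)
    (Y0 : LeaderFollower.Leaders m d) (μ0 : Measure (LeaderFollower.Space d))
    (hμ0 : LeaderFollower.InP1 μ0) (hμ0supp : ∃ R : ℝ, LeaderFollower.SuppIn R μ0) :
    -- the infinite dimensional system is well posed for every admissible control
    (∀ u, LeaderFollower.Admissible T U u →
      (∃ Y μ, LeaderFollower.IsMeanFieldSol T H G u Y0 μ0 Y μ) ∧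
      (∀ Y μ Z ν, LeaderFollower.IsMeanFieldSol T H G u Y0 μ0 Y μ →
        LeaderFollower.IsMeanFieldSol T H G u Y0 μ0 Z ν →
        ∀ t ∈ Icc 0 T, Y t = Z t ∧ μ t = ν t)) ∧
    -- the infinite dimensional optimal control problem has a solution
    (∃ u, LeaderFollower.IsMeanFieldOptimal T U H G L Y0 μ0 u) ∧
    -- the initial datum is a limit of equi-compactly supported empirical measures
    (∃ X0 : (N : ℕ) → Fin N → LeaderFollower.Space d, (∃ R : ℝ, ∀ N i, ‖X0 N i‖ ≤ R) ∧
      Tendsto (fun N => LeaderFollower.W1 (LeaderFollower.empirical (X0 N)) μ0) atTop (𝓝 0)) ∧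
    -- solutions are limits of optimal controls of the finite dimensional problems
    (∀ X0 : (N : ℕ) → Fin N → LeaderFollower.Space d,
      (∃ R : ℝ, ∀ N i, ‖X0 N i‖ ≤ R) →
      Tendsto (fun N => LeaderFollower.W1 (LeaderFollower.empirical (X0 N)) μ0) atTop (𝓝 0) →
      (∀ N : ℕ, 1 ≤ N → ∀ u, LeaderFollower.Admissible T U u →
        (∃ Y X, LeaderFollower.IsFiniteSol T H G u Y0 (X0 N) Y X) ∧
        (∀ Y X Z W, LeaderFollower.IsFiniteSol T H G u Y0 (X0 N) Y X →
          LeaderFollower.IsFiniteSol T H G u Y0 (X0 N) Z W →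
          ∀ t ∈ Icc 0 T, Y t = Z t ∧ X t = W t)) ∧
      (∀ N : ℕ, 1 ≤ N → ∃ u, LeaderFollower.IsFiniteOptimal T U H G L Y0 (X0 N) u) ∧
      (∀ us : ℕ → ℝ → LeaderFollower.Leaders m d,
        (∀ N : ℕ, 1 ≤ N → LeaderFollower.IsFiniteOptimal T U H G L Y0 (X0 N) (us N)) →
        (∃ (σ : ℕ → ℕ) (u : ℝ → LeaderFollower.Leaders m d), StrictMono σ ∧
          LeaderFollower.ControlsTendsto T (fun j => us (σ j)) u ∧
          LeaderFollower.IsMeanFieldOptimal T U H G L Y0 μ0 u) ∧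
        (∀ (σ : ℕ → ℕ) (u : ℝ → LeaderFollower.Leaders m d), StrictMono σ →
          AEStronglyMeasurable u (volume.restrict (Icc 0 T)) →
          LeaderFollower.ControlsTendsto T (fun j => us (σ j)) u →
          LeaderFollower.IsMeanFieldOptimal T U H G L Y0 μ0 u))) := by
  obtain ⟨R0, hR0⟩ := hμ0supp
  obtain ⟨C, hC⟩ := hUcompact.isBounded.exists_norm_le
  have hP0 := hμ0.prob
  have hU := hUcompact.isClosed
  obtain ⟨H₁, G₁, B₁, K₁, hI₁, hmf₁, -⟩ :=
    hHG.exists_globalization hT.le hU hUne hC Y0 R0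
  refine ⟨fun u hu => ?_, ?_, ?_, fun X0 hX0 hW => ?_⟩
  · obtain ⟨⟨Y, μ, hs⟩, huniq⟩ := hI₁.meanField_wellPosed hT.le hU hUne hC Y0 hμ0 hR0 hu
    exact ⟨⟨Y, μ, (hmf₁ u hu μ0 hμ0 hR0 Y μ).2 hs⟩, fun Y μ Z ν h1 h2 =>
      huniq Y μ Z ν ((hmf₁ u hu μ0 hμ0 hR0 Y μ).1 h1) ((hmf₁ u hu μ0 hμ0 hR0 Z ν).1 h2)⟩
  · obtain ⟨u, hu⟩ := LeaderFollower.exists_isMeanFieldOptimal hL hI₁ hT.le hU hUconvex hC hUne hμ0 hR0 Y0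
    exact ⟨u, hu.congr_sol fun v hv Y μ => (hmf₁ v hv μ0 hμ0 hR0 Y μ).symm⟩
  · obtain ⟨X, hX, hW⟩ := LeaderFollower.exists_tendsto_empirical (le_max_right R0 0)
      (hR0.mono (le_max_left R0 0))
    exact ⟨X, ⟨_, hX⟩, hW⟩
  · obtain ⟨R1, hR1⟩ := hX0
    have hXR : ∀ N i, ‖X0 N i‖ ≤ max R0 R1 := fun N i => (hR1 N i).trans (le_max_right _ _)
    have hR := hR0.mono (le_max_left R0 R1)
    -- One truncation must serve the limit problem and all finite problems, so its radius covers
    -- both `μ0` and the data of all followers.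
    obtain ⟨H', G', B, K, hI, hmf, hfin⟩ :=
      hHG.exists_globalization hT.le hU hUne hC Y0 (max R0 R1)
    have hfin' := fun (N : ℕ) (hN : 1 ≤ N) u hu => hfin u hu N hN (X0 N) (hXR N)
    refine ⟨fun N hN u hu => ?_, fun N hN => ?_, fun us hus => ?_⟩
    · obtain ⟨⟨Y, X, hs⟩, huniq⟩ :=
        hI.finite_wellPosed hT.le hU hUne hC Y0 hN (X0 N) (hXR N) hu
      exact ⟨⟨Y, X, (hfin' N hN u hu Y X).2 hs⟩, fun Y X Z W h1 h2 =>
        huniq Y X Z W ((hfin' N hN u hu Y X).1 h1) ((hfin' N hN u hu Z W).1 h2)⟩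
    · have := LeaderFollower.isProbabilityMeasure_empirical hN (X0 N)
      have hRN := LeaderFollower.suppIn_empirical (hXR N)
      obtain ⟨u, hu⟩ := LeaderFollower.exists_isMeanFieldOptimal hL hI hT.le hU hUconvex hC hUne
        (LeaderFollower.InP1.of_suppIn hRN) hRN Y0
      exact ⟨u, ((LeaderFollower.isFiniteOptimal_iff hI hT.le hU hUne hC hN (hXR N)).2 hu).congr_sol
        fun v hv Y X => (hfin' N hN v hv Y X).symm⟩
    · have hopt : ∀ N, 1 ≤ N → LeaderFollower.IsFiniteOptimal T U H' G' L Y0 (X0 N) (us N) := fun N hN =>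
        (hus N hN).congr_sol (hfin' N hN)
      have hback : ∀ u, LeaderFollower.IsMeanFieldOptimal T U H' G' L Y0 μ0 u →
          LeaderFollower.IsMeanFieldOptimal T U H G L Y0 μ0 u := fun u hu =>
        hu.congr_sol fun v hv Y μ => (hmf v hv μ0 hμ0 hR Y μ).symm
      constructor
      · obtain ⟨σ, u, hσ, hlim, hu⟩ := LeaderFollower.exists_tendsto_of_isFiniteOptimal hL hI hT.le hU hUconvex hC
          hUne hμ0 hR hXR hW hopt (tendsto_add_atTop_nat 1) fun j => Nat.le_add_left 1 j
        -- The compactness result was applied to the shifted indices `j + 1`, which skip the empty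
        -- problem `N = 0`.
        exact ⟨fun j => σ j + 1, u, fun i j hij => Nat.add_lt_add_right (hσ hij) 1, hlim, hback u hu⟩
      · intro σ u hσ hum hlim
        exact hback u (LeaderFollower.isMeanFieldOptimal_of_tendsto hL hI hT.le hU hUconvex hC hUne hμ0 hR hXR hW
          hopt hσ hum hlim)
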